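/- Fix $\sigma>0$ and real constants $m_5,c_3$. For $N\ge 1$ let $X_N=N^{-1/2}W_N$, where $W_N$ is a random $N\times N$ matrix of one of the following two kinds. (Real symmetric case) $W_N$ is real symmetric, the entries $(W_N)_{ij}$, $1\le i\le j\le N$, are jointly independent and centered, $\mathbb V (W_N)_{ij}=\sigma^2$ and $\mathbb E|(W_N)_{ij}|^5\le m_5$ for $i\neq j$, and $\mathbb E|(W_N)_{ii}|^3\le c_3$ for all $i$. (Hermitian case) $W_N$ is Hermitian, the random variables $\Re (W_N)_{ij},\Im (W_N)_{ij}$ $(1\le i<j\le N)$ and $(W_N)_{ii}$ $(1\le i\le N)$ are jointly independent and centered, $\mathbb V[\Re (W_N)_{ij}]=\mathbb V[\Im (W_N)_{ij}]=\sigma^2/2$ and $\mathbb E|(W_N)_{ij}|^5\le m_5$ for $i\ne j$, and $\mathbb E|(W_N)_{ii}|^3\le c_3$ for all $i$. Let $R_N(z)=(zI_N-X_N)^{-1}$ for $z\in\mathbb C\setminus\mathbb R$, and let $$g_\sigma(z)=\int\frac{d\mu_{sc}(x)}{z-x},\qquad \frac{d\mu_{sc}}{dx}(x)=\frac{1}{2\pi\sigma^2}\sqrt{4\sigma^2-x^2}\,\mathbf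 1_{[-2\sigma,2\sigma]}(x),$$ be the Stieltjes transform of the semicircle law. Let $\langle u,v\rangle=\sum_i\overline{u_i}v_i$ on $\mathbb C^N$, and $\mathbb V\xi=\mathbb E|\xi-\mathbb E\xi|^2$ for a complex random variable $\xi$. Then, for nonrandom unit vectors $u,v\in\mathbb C^N$, the random variable $\langle u,R_N(z)v\rangle$ is square integrable and the following hold. 1. For every bounded set $B\subset\mathbb C\setminus\mathbb R$ (which may accumulate at $\mathbb R$), $$\mathbb E\langle u,R_N(z)v\rangle=g_\sigma(z)\langle u,v\rangle+O\!\left(\frac{1}{|\Im z|^{7}\sqrt N}\right)$$ uniformly for $z\in B$. 2. There are a real constant $M$ and a real polynomial $P_8$ of degree $8$ with all coefficients positive such that $$\mathbb E\langle u,R_N(z)v\rangle=g_\sigma(z)\langle u,v\rangle+O\!\left((|z|+M)\frac{P_8(|\Im z|^{-1})}{\sqrt N}\right)$$ uniformly for $z\in\mathbb C\setminus\mathbb R$. 3. There is a real polynomial $P_8$ of degree $8$ with all coefficients positive such that $$\mathbb V\langle u,R_N(z)v\rangle=O\!\left(\frac{P_8(|\Im z|^{-1})}{N}\right)$$ uniformly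 for $z\in\mathbb C\setminus\mathbb R$. The constants implied in $O(\cdot)$, the constant $M$ and the polynomials depend only on $\sigma,m_5,c_3$ (and, in 1, on $B$); in particular they do not depend on $N$, on $u,v$, or on the law of $W_N$ within the class above. -/

import Mathlib

open MeasureTheory ProbabilityTheory

universe u

noncomputable section

namespace WignerResolvent

/-- Density of the semicircle distribution with variance `σ ^ 2`, supported on `[-2σ, 2σ]`. -/
def semicircleDensity (σ x : ℝ) : ℝ :=
  (Set.Icc (-(2 * σ)) (2 * σ)).indicator
    (fun x => 1 / (2 * Real.pi * σ ^ 2) * Real.sqrt (4 * σ ^ 2 - x ^ 2)) x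

/-- The semicircle distribution. -/
def semicircle (σ : ℝ) : Measure ℝ :=
  volume.withDensity (fun x => ENNReal.ofReal (semicircleDensity σ x))

/-- The Stieltjes transform `g_σ(z) = ∫ (z - x)⁻¹ dμ_sc(x)` of the semicircle distribution. -/
def semicircleStieltjes (σ : ℝ) (z : ℂ) : ℂ :=
  ∫ x : ℝ, 1 / (z - (x : ℂ)) ∂(semicircle σ)

/-- `W` is a real symmetric `N × N` Wigner matrix (before normalization by `√N`): the entries on and
above the diagonal are jointly independent and centered, the off-diagonal entries have variance
`σ ^ 2` and fifth absolute moment at most `m₅`, the diagonal entries have third absolute moment at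
most `c₃`. -/
structure IsRealSymmetricWigner {Ω : Type u} [MeasurableSpace Ω] (μ : Measure Ω) {N : ℕ}
    (σ m₅ c₃ : ℝ) (W : Ω → Matrix (Fin N) (Fin N) ℝ) : Prop where
  measurable_entry : ∀ i j, Measurable (fun ω => W ω i j)
  isSymm : ∀ ω, (W ω).IsSymm
  indep : iIndepFun (fun (p : {p : Fin N × Fin N // p.1 ≤ p.2}) ω => W ω p.1.1 p.1.2) μ
  mean_offDiag : ∀ i j, i ≠ j → ∫ ω, W ω i j ∂μ = 0
  variance_offDiag : ∀ i j, i ≠ j → variance (fun ω => W ω i j) μ = σ ^ 2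
  integrable_offDiag : ∀ i j, i ≠ j → Integrable (fun ω => |W ω i j| ^ 5) μ
  moment_offDiag : ∀ i j, i ≠ j → ∫ ω, |W ω i j| ^ 5 ∂μ ≤ m₅
  mean_diag : ∀ i, ∫ ω, W ω i i ∂μ = 0
  integrable_diag : ∀ i, Integrable (fun ω => |W ω i i| ^ 3) μ
  moment_diag : ∀ i, ∫ ω, |W ω i i| ^ 3 ∂μ ≤ c₃

/-- The independent real coordinates of a random Hermitian matrix: the real parts and the imaginary
parts of the entries strictly above the diagonal, and the (real) diagonal entries. -/
def hermitianCoordinates {Ω : Type u} {N : ℕ} (W : Ω → Matrix (Fin N) (Fin N) ℂ) :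
    ({p : Fin N × Fin N // p.1 < p.2} ⊕ {p : Fin N × Fin N // p.1 < p.2}) ⊕ Fin N → Ω → ℝ
  | Sum.inl (Sum.inl p), ω => (W ω p.1.1 p.1.2).re
  | Sum.inl (Sum.inr p), ω => (W ω p.1.1 p.1.2).im
  | Sum.inr i, ω => (W ω i i).re

/-- `W` is a Hermitian `N × N` Wigner matrix (before normalization by `√N`): the real and imaginary
parts of the entries above the diagonal and the diagonal entries are jointly independent and
centered, the real and imaginary parts of off-diagonal entries have variance `σ ^ 2 / 2`, the
off-diagonal entries have fifth absolute moment at most `m₅`, and the diagonal entries have third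
absolute moment at most `c₃`. -/
structure IsHermitianWigner {Ω : Type u} [MeasurableSpace Ω] (μ : Measure Ω) {N : ℕ}
    (σ m₅ c₃ : ℝ) (W : Ω → Matrix (Fin N) (Fin N) ℂ) : Prop where
  measurable_entry : ∀ i j, Measurable (fun ω => W ω i j)
  isHermitian : ∀ ω, (W ω).IsHermitian
  indep : iIndepFun (hermitianCoordinates W) μ
  mean_offDiag : ∀ i j, i ≠ j → ∫ ω, W ω i j ∂μ = 0
  variance_re_offDiag : ∀ i j, i ≠ j → variance (fun ω => (W ω i j).re) μ = σ ^ 2 / 2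
  variance_im_offDiag : ∀ i j, i ≠ j → variance (fun ω => (W ω i j).im) μ = σ ^ 2 / 2
  integrable_offDiag : ∀ i j, i ≠ j → Integrable (fun ω => ‖W ω i j‖ ^ 5) μ
  moment_offDiag : ∀ i j, i ≠ j → ∫ ω, ‖W ω i j‖ ^ 5 ∂μ ≤ m₅
  mean_diag : ∀ i, ∫ ω, W ω i i ∂μ = 0
  integrable_diag : ∀ i, Integrable (fun ω => ‖W ω i i‖ ^ 3) μ
  moment_diag : ∀ i, ∫ ω, ‖W ω i i‖ ^ 3 ∂μ ≤ c₃

/-- A Wigner matrix, real symmetric (viewed as a complex matrix) or Hermitian. -/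
def IsWigner {Ω : Type u} [MeasurableSpace Ω] (μ : Measure Ω) {N : ℕ}
    (σ m₅ c₃ : ℝ) (W : Ω → Matrix (Fin N) (Fin N) ℂ) : Prop :=
  (∃ V : Ω → Matrix (Fin N) (Fin N) ℝ, IsRealSymmetricWigner μ σ m₅ c₃ V ∧
    ∀ ω, W ω = (V ω).map Complex.ofReal) ∨
  IsHermitianWigner μ σ m₅ c₃ W

/-- The resolvent `R_N(z) = (z I - X_N)⁻¹` of the normalized matrix `X_N = W / √N`. -/
def resolventMatrix {N : ℕ} (W : Matrix (Fin N) (Fin N) ℂ) (z : ℂ) : Matrix (Fin N) (Fin N) ℂ :=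
  (z • (1 : Matrix (Fin N) (Fin N) ℂ) - ((1 / Real.sqrt N : ℝ) : ℂ) • W)⁻¹

/-- The sesquilinear form `⟨u, R_N(z) v⟩ = ∑ i j, conj (u i) * R_N(z) i j * v j`. -/
def resolventForm {N : ℕ} (W : Matrix (Fin N) (Fin N) ℂ) (u v : EuclideanSpace ℂ (Fin N))
    (z : ℂ) : ℂ :=
  inner ℂ u (Matrix.toEuclideanLin (resolventMatrix W z) v)

/-- The variance `E |ξ - E ξ|²` of a complex random variable. -/
def complexVariance {Ω : Type u} [MeasurableSpace Ω] (μ : Measure Ω) (ξ : Ω → ℂ) : ℝ :=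
  ∫ ω, ‖ξ ω - ∫ ω', ξ ω' ∂μ‖ ^ 2 ∂μ

/-- A real polynomial of degree `l` all of whose `l + 1` coefficients are positive. -/
def IsPositivePolynomial (l : ℕ) (P : Polynomial ℝ) : Prop :=
  P.natDegree = l ∧ ∀ k ≤ l, 0 < P.coeff k

end WignerResolvent

end

/-!
Let `X = W / √N`, `R = (z - X)⁻¹` and let `m` be the normalized trace of `R`. Replacing one entry of
`X` by zero and expanding `R` to second order around the result, which is independent of that entry,
turns the identity `z R = 1 + X R` into `E⟨u, R v⟩ (z - σ² E m) = ⟨u, v⟩ + O(N^(-1/2))`; the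
covariance of `m` and `⟨u, R v⟩` lost on the way is controlled by the Efron–Stein inequality, which
bounds the variance of a resolvent form by `O(1 / N)`. Averaging over an orthonormal basis gives
`E m (z - σ² E m) = 1 + O(N^(-1/2))`, a perturbation of the equation `g (z - σ² g) = 1` of the
semicircle law. Since `m` and `g` both have imaginary part of sign opposite to that of `z`, the
factors `z - σ² m` and `z - σ² g` stay away from zero by `|Im z|`, so the equation is stable and
`E⟨u, R v⟩` is close to `g ⟨u, v⟩`.
-/

namespace WignerResolvent

/-! ### The Stieltjes transform of the semicircle law -/

section Semicircle

open Complex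

theorem one_sub_mul_ne_zero {w ζ : ℂ} (hw : ‖w‖ < 1) (hζ : ‖ζ‖ ≤ 1) : 1 - w * ζ ≠ 0 := by
  refine sub_ne_zero.2 fun h => ?_
  have := norm_mul w ζ
  rw [← h, norm_one] at this
  nlinarith [norm_nonneg w]

theorem circleAverage_one_sub_sq_div {w : ℂ} (hw : ‖w‖ < 1) :
    Real.circleAverage (fun ζ : ℂ => (1 - ζ ^ 2) / (1 - w * ζ)) 0 1 = 1 := by
  have hdiff : DiffContOnCl ℂ (fun ζ : ℂ => (1 - ζ ^ 2) / (1 - w * ζ)) (Metric.ball 0 |1|) := by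
    refine DifferentiableOn.diffContOnCl fun ζ hζ => ?_
    rw [closure_ball _ (by norm_num), abs_one, mem_closedBall_zero_iff] at hζ
    have hne := one_sub_mul_ne_zero hw hζ
    exact DifferentiableAt.differentiableWithinAt (by fun_prop (disch := assumption))
  simpa using hdiff.circleAverage

theorem sin_sq_div_eq {w : ℂ} (hw : ‖w‖ < 1) (θ : ℝ) :
    (Real.sin θ : ℂ) ^ 2 / (1 + w ^ 2 - 2 * w * Real.cos θ) = 1 / 4 *
      ((1 - circleMap 0 1 θ ^ 2) / (1 - w * circleMap 0 1 θ) +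
        (1 - circleMap 0 1 (2 * Real.pi - θ) ^ 2) / (1 - w * circleMap 0 1 (2 * Real.pi - θ))) := by
  have hmul : circleMap 0 1 θ * circleMap 0 1 (2 * Real.pi - θ) = 1 := by
    rw [circleMap_zero, circleMap_zero, ofReal_one, one_mul, one_mul, ← exp_add,
      ← exp_two_pi_mul_I]
    push_cast
    ring_nf
  have hcos : 2 * (Real.cos θ : ℂ) = circleMap 0 1 θ + circleMap 0 1 (2 * Real.pi - θ) := by
    simp [circleMap_zero, exp_mul_I, Complex.cos_two_pi_sub, Complex.sin_two_pi_sub]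
    ring
  have hsin : 2 * I * (Real.sin θ : ℂ) = circleMap 0 1 θ - circleMap 0 1 (2 * Real.pi - θ) := by
    simp [circleMap_zero, exp_mul_I, Complex.cos_two_pi_sub, Complex.sin_two_pi_sub]
    ring
  have ha := one_sub_mul_ne_zero hw (ζ := circleMap 0 1 θ) (by simp)
  have hb := one_sub_mul_ne_zero hw (ζ := circleMap 0 1 (2 * Real.pi - θ)) (by simp)
  generalize circleMap 0 1 θ = a at *
  generalize circleMap 0 1 (2 * Real.pi - θ) = b at *
  have hden : 1 + w ^ 2 - 2 * w * Real.cos θ = (1 - w * a) * (1 - w * b) := by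
    linear_combination (-w ^ 2) * hmul - w * hcos
  have hnum : (Real.sin θ : ℂ) ^ 2 = -(1 / 4) * (a - b) ^ 2 := by
    rw [← hsin]
    linear_combination (Real.sin θ : ℂ) ^ 2 * I_sq
  rw [hden, hnum, div_add_div _ _ ha hb, ← mul_div_assoc]
  congr 1
  linear_combination (1 / 4 * (2 - w * (a + b))) * hmul

/- The substitution `x = -2σ cos θ` and the Joukowski coordinate `z = σ (w + w⁻¹)` turn the
Stieltjes transform into this integral, with `-w` in place of `w`. -/
theorem integral_sin_sq_div_eq {w : ℂ} (hw : ‖w‖ < 1) :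
    ∫ θ in (0 : ℝ)..Real.pi, (Real.sin θ : ℂ) ^ 2 / (1 + w ^ 2 - 2 * w * Real.cos θ) =
      (Real.pi / 2 : ℂ) := by
  set P : ℝ → ℂ := fun θ => (1 - circleMap 0 1 θ ^ 2) / (1 - w * circleMap 0 1 θ)
  have hcont : Continuous P :=
    Continuous.div (by fun_prop) (by fun_prop) fun θ => one_sub_mul_ne_zero hw (by simp)
  have hcont' : Continuous fun θ => P (2 * Real.pi - θ) := by fun_prop
  have hrefl : ∫ θ in (0 : ℝ)..Real.pi, P (2 * Real.pi - θ) = ∫ θ in Real.pi..2 * Real.pi, P θ := by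
    rw [intervalIntegral.integral_comp_sub_left P]
    congr 1 <;> ring
  have htotal : ∫ θ in (0 : ℝ)..2 * Real.pi, P θ = 2 * Real.pi := by
    have h := circleAverage_one_sub_sq_div hw
    rw [Real.circleAverage_def, inv_smul_eq_iff₀ Real.two_pi_pos.ne'] at h
    simpa using h
  calc ∫ θ in (0 : ℝ)..Real.pi, (Real.sin θ : ℂ) ^ 2 / (1 + w ^ 2 - 2 * w * Real.cos θ)
      = ∫ θ in (0 : ℝ)..Real.pi, 1 / 4 * (P θ + P (2 * Real.pi - θ)) :=
        intervalIntegral.integral_congr fun θ _ => sin_sq_div_eq hw θ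
    _ = 1 / 4 * ∫ θ in (0 : ℝ)..2 * Real.pi, P θ := by
        rw [intervalIntegral.integral_const_mul,
          intervalIntegral.integral_add (hcont.intervalIntegrable _ _)
            (hcont'.intervalIntegrable _ _), hrefl,
          intervalIntegral.integral_add_adjacent_intervals
            (hcont.intervalIntegrable _ _) (hcont.intervalIntegrable _ _)]
    _ = Real.pi / 2 := by rw [htotal]; ring

theorem exists_eq_add_inv_of_im_ne_zero {ζ : ℂ} (hζ : ζ.im ≠ 0) :
    ∃ w : ℂ, w ≠ 0 ∧ ‖w‖ < 1 ∧ ζ = w + w⁻¹ := by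
  obtain ⟨w, hw⟩ : ∃ w : ℂ, w ^ 2 - ζ * w + 1 = 0 := by
    obtain ⟨s, hs⟩ := IsAlgClosed.exists_pow_nat_eq (ζ ^ 2 - 4) two_pos
    exact ⟨(ζ + s) / 2, by linear_combination (1 / 4) * hs⟩
  have hw0 : w ≠ 0 := by rintro rfl; simp at hw
  have hsum : ζ = w + w⁻¹ := by field_simp; linear_combination -hw
  rcases lt_trichotomy ‖w‖ 1 with h | h | h
  · exact ⟨w, hw0, h, hsum⟩
  · refine absurd ?_ hζ
    rw [hsum, add_im, inv_im, normSq_eq_norm_sq, h]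
    ring
  · exact ⟨w⁻¹, inv_ne_zero hw0, by rw [norm_inv]; exact inv_lt_one_of_one_lt₀ h,
      by rw [inv_inv, add_comm, hsum]⟩

theorem semicircleStieltjes_eq_intervalIntegral {σ : ℝ} (hσ : 0 < σ) (z : ℂ) :
    semicircleStieltjes σ z = ∫ x in (-(2 * σ))..(2 * σ),
      ((1 / (2 * Real.pi * σ ^ 2) * Real.sqrt (4 * σ ^ 2 - x ^ 2) : ℝ) : ℂ) * (1 / (z - x)) := by
  have hmeas : Measurable (semicircleDensity σ) :=
    Measurable.indicator (by fun_prop) measurableSet_Icc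
  have hpos (x : ℝ) : 0 ≤ semicircleDensity σ x :=
    Set.indicator_nonneg (fun x _ => by positivity) x
  rw [semicircleStieltjes, semicircle,
    integral_withDensity_eq_integral_toReal_smul hmeas.ennreal_ofReal (by simp),
    intervalIntegral.integral_of_le (by linarith), ← integral_Icc_eq_integral_Ioc,
    ← MeasureTheory.integral_indicator measurableSet_Icc]
  refine integral_congr_ae (ae_of_all _ fun x => ?_)
  simp only [ENNReal.toReal_ofReal (hpos x)]
  by_cases hx : x ∈ Set.Icc (-(2 * σ)) (2 * σ) <;> simp [semicircleDensity, hx]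

theorem sqrt_four_mul_sq_sub_cos_sq {σ θ : ℝ} (hσ : 0 ≤ σ) (hθ : θ ∈ Set.Icc 0 Real.pi) :
    Real.sqrt (4 * σ ^ 2 - (-(2 * σ) * Real.cos θ) ^ 2) = 2 * σ * Real.sin θ := by
  have hs := Real.sin_nonneg_of_mem_Icc hθ
  rw [show 4 * σ ^ 2 - (-(2 * σ) * Real.cos θ) ^ 2 = (2 * σ * Real.sin θ) ^ 2 by
    rw [mul_pow _ (Real.sin θ), Real.sin_sq]; ring]
  exact Real.sqrt_sq (by positivity)

theorem semicircleStieltjes_mul_add_inv {σ : ℝ} (hσ : 0 < σ) {w : ℂ} (hw0 : w ≠ 0)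
    (hw : ‖w‖ < 1) (hz : (σ * (w + w⁻¹)).im ≠ 0) :
    semicircleStieltjes σ (σ * (w + w⁻¹)) = w / σ := by
  set z : ℂ := σ * (w + w⁻¹) with hzw
  have hσ' : (σ : ℂ) ≠ 0 := by exact_mod_cast hσ.ne'
  have hzx (x : ℝ) : z - x ≠ 0 := sub_ne_zero.2 fun h => hz (by rw [h, ofReal_im])
  set G : ℝ → ℂ := fun x =>
    ((1 / (2 * Real.pi * σ ^ 2) * Real.sqrt (4 * σ ^ 2 - x ^ 2) : ℝ) : ℂ) * (1 / (z - x)) with hG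
  have hGc : Continuous G :=
    (continuous_ofReal.comp (by fun_prop)).mul (Continuous.div (by fun_prop) (by fun_prop) hzx)
  have hsubst : ∫ x in (-(2 * σ))..(2 * σ), G x =
      ∫ θ in (0 : ℝ)..Real.pi, (2 * σ * Real.sin θ) • G (-(2 * σ) * Real.cos θ) := by
    have := intervalIntegral.integral_deriv_smul_comp (a := 0) (b := Real.pi)
      (f := fun θ => -(2 * σ) * Real.cos θ) (f' := fun θ => 2 * σ * Real.sin θ) (g := G)
      (fun θ _ => by simpa using (Real.hasDerivAt_cos θ).const_mul (-(2 * σ))) (by fun_prop) hGc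
    simpa using this.symm
  have hpt : ∀ θ ∈ Set.uIcc 0 Real.pi, (2 * σ * Real.sin θ) • G (-(2 * σ) * Real.cos θ) =
      (2 * w / (σ * Real.pi)) *
        ((Real.sin θ : ℂ) ^ 2 / (1 + (-w) ^ 2 - 2 * (-w) * Real.cos θ)) := fun θ hθ => by
    rw [Set.uIcc_of_le Real.pi_pos.le] at hθ
    have hden : z - ((-(2 * σ) * Real.cos θ : ℝ) : ℂ) =
        (σ / w) * (1 + (-w) ^ 2 - 2 * (-w) * Real.cos θ) := by
      rw [hzw]
      push_cast
      field_simp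
      ring
    have hne := right_ne_zero_of_mul (hden ▸ hzx _)
    simp only [hG, real_smul, sqrt_four_mul_sq_sub_cos_sq hσ.le hθ, hden]
    generalize 1 + (-w) ^ 2 - 2 * (-w) * (Real.cos θ : ℂ) = D at *
    push_cast
    field_simp
  rw [semicircleStieltjes_eq_intervalIntegral hσ, hsubst,
    intervalIntegral.integral_congr hpt, intervalIntegral.integral_const_mul,
    integral_sin_sq_div_eq (by rwa [norm_neg])]
  field_simp

theorem exists_semicircleStieltjes_eq_div {σ : ℝ} (hσ : 0 < σ) {z : ℂ} (hz : z.im ≠ 0) :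
    ∃ w : ℂ, w ≠ 0 ∧ ‖w‖ < 1 ∧ z = σ * (w + w⁻¹) ∧ semicircleStieltjes σ z = w / σ := by
  have hσ' : (σ : ℂ) ≠ 0 := by exact_mod_cast hσ.ne'
  obtain ⟨w, hw0, hw, h⟩ := exists_eq_add_inv_of_im_ne_zero (ζ := z / σ)
    (by rw [div_ofReal_im]; exact div_ne_zero hz hσ.ne')
  have hzw : z = σ * (w + w⁻¹) := by rw [← h]; field_simp
  exact ⟨w, hw0, hw, hzw, by
    rw [hzw]; exact semicircleStieltjes_mul_add_inv hσ hw0 hw (hzw ▸ hz)⟩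

theorem sub_mul_semicircleStieltjes_mul_self {σ : ℝ} (hσ : 0 < σ) {z : ℂ} (hz : z.im ≠ 0) :
    (z - σ ^ 2 * semicircleStieltjes σ z) * semicircleStieltjes σ z = 1 := by
  have hσ' : (σ : ℂ) ≠ 0 := by exact_mod_cast hσ.ne'
  obtain ⟨w, hw0, -, hzw, hg⟩ := exists_semicircleStieltjes_eq_div hσ hz
  rw [hg, hzw]
  field_simp
  ring

theorem im_mul_im_semicircleStieltjes_nonpos {σ : ℝ} (hσ : 0 < σ) {z : ℂ} (hz : z.im ≠ 0) :
    z.im * (semicircleStieltjes σ z).im ≤ 0 := by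
  obtain ⟨w, hw0, hw, hzw, hg⟩ := exists_semicircleStieltjes_eq_div hσ hz
  have hn : 1 ≤ (normSq w)⁻¹ := (one_le_inv₀ (normSq_pos.2 hw0)).2 <| by
    rw [normSq_eq_norm_sq]; exact pow_le_one₀ (norm_nonneg w) hw.le
  have him : z.im * (semicircleStieltjes σ z).im = w.im ^ 2 * (1 - (normSq w)⁻¹) := by
    rw [hg, div_ofReal_im, hzw, im_ofReal_mul, add_im, inv_im]
    field_simp
    ring
  rw [him]
  exact mul_nonpos_of_nonneg_of_nonpos (sq_nonneg _) (by linarith)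

end Semicircle

/-! ### The Efron–Stein inequality -/

section EfronStein

open MeasurableSpace

variable {Ω : Type*} {m₀ : MeasurableSpace Ω} {μ : Measure Ω} [IsProbabilityMeasure μ]

theorem generateFrom_measurableSet_inter (m₁ m₂ : MeasurableSpace Ω) :
    generateFrom {s | ∃ a b, MeasurableSet[m₁] a ∧ MeasurableSet[m₂] b ∧ a ∩ b = s} =
      m₁ ⊔ m₂ := by
  refine le_antisymm (generateFrom_le ?_) (sup_le (fun a ha => ?_) fun b hb => ?_)
  · rintro _ ⟨a, b, ha, hb, rfl⟩
    exact MeasurableSet.inter (le_sup_left (b := m₂) a ha) (le_sup_right (a := m₁) b hb)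
  · exact measurableSet_generateFrom ⟨a, Set.univ, ha, .univ, Set.inter_univ a⟩
  · exact measurableSet_generateFrom ⟨Set.univ, b, .univ, hb, Set.univ_inter b⟩

theorem isPiSystem_measurableSet_inter (m₁ m₂ : MeasurableSpace Ω) :
    IsPiSystem {s | ∃ a b, MeasurableSet[m₁] a ∧ MeasurableSet[m₂] b ∧ a ∩ b = s} := by
  rintro _ ⟨a, b, ha, hb, rfl⟩ _ ⟨c, d, hc, hd, rfl⟩ -
  exact ⟨a ∩ c, b ∩ d, ha.inter hc, hb.inter hd, Set.inter_inter_inter_comm a c b d⟩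

theorem setIntegral_condExp_inter_of_indep {m m₁ m₂ : MeasurableSpace Ω} (hm : m ≤ m₁)
    (hm₁ : m₁ ≤ m₀) (hm₂ : m₂ ≤ m₀) (hindep : Indep m₁ m₂ μ) {g : Ω → ℝ}
    (hg : StronglyMeasurable[m₁] g) (hgi : Integrable g μ) {a b : Set Ω}
    (ha : MeasurableSet[m] a) (hb : MeasurableSet[m₂] b) :
    ∫ ω in a ∩ b, (μ[g | m]) ω ∂μ = ∫ ω in a ∩ b, g ω ∂μ := by
  have key : ∀ f : Ω → ℝ, StronglyMeasurable[m₁] f →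
      ∫ ω in a ∩ b, f ω ∂μ = μ.real b • ∫ ω in a, f ω ∂μ := fun f hf => by
    rw [← integral_indicator (hm.trans hm₁ _ ha), Set.inter_comm,
      ← setIntegral_indicator (hm.trans hm₁ _ ha)]
    have hmeas := (hf.indicator (hm _ ha)).measurable
    exact (indep_of_indep_of_le_right hindep.symm hmeas.comap_le).setIntegral_eq_smul hm₂
      (hmeas.mono hm₁ le_rfl).aemeasurable hb stronglyMeasurable_id.aestronglyMeasurable
  rw [key _ (stronglyMeasurable_condExp.mono hm), key g hg,
    setIntegral_condExp (hm.trans hm₁) hgi ha]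

theorem condExp_sup_of_indep {m m₁ m₂ : MeasurableSpace Ω} (hm : m ≤ m₁) (hm₁ : m₁ ≤ m₀)
    (hm₂ : m₂ ≤ m₀) (hindep : Indep m₁ m₂ μ) {g : Ω → ℝ} (hg : StronglyMeasurable[m₁] g)
    (hgi : Integrable g μ) : μ[g | m ⊔ m₂] =ᵐ[μ] μ[g | m] := by
  have hle : m ⊔ m₂ ≤ m₀ := sup_le (hm.trans hm₁) hm₂
  suffices h : ∀ s, MeasurableSet[m ⊔ m₂] s → ∫ ω in s, (μ[g | m]) ω ∂μ = ∫ ω in s, g ω ∂μ from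
    (ae_eq_condExp_of_forall_setIntegral_eq hle hgi
      (fun _ _ _ => integrable_condExp.integrableOn) (fun s hs _ => h s hs)
      (stronglyMeasurable_condExp.mono le_sup_left).aestronglyMeasurable).symm
  intro s hs
  induction s, hs using induction_on_inter (generateFrom_measurableSet_inter m m₂).symm
    (isPiSystem_measurableSet_inter m m₂) with
  | empty => simp
  | basic s hs =>
    obtain ⟨a, b, ha, hb, rfl⟩ := hs
    exact setIntegral_condExp_inter_of_indep hm hm₁ hm₂ hindep hg hgi ha hb
  | compl s hs ih =>
    rw [setIntegral_compl (hle _ hs) integrable_condExp, setIntegral_compl (hle _ hs) hgi, ih,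
      integral_condExp (hm.trans hm₁)]
  | iUnion s hd hs ih =>
    rw [integral_iUnion (fun i => hle _ (hs i)) hd integrable_condExp.integrableOn,
      integral_iUnion (fun i => hle _ (hs i)) hd hgi.integrableOn]
    exact tsum_congr ih

theorem variance_condExp_le {m : MeasurableSpace Ω} (hm : m ≤ m₀) {f : Ω → ℝ}
    (hf : MemLp f 2 μ) : Var[μ[f | m]; μ] ≤ Var[f; μ] := by
  have h : 0 ≤ μ[Var[f; μ | m]] := integral_nonneg_of_ae <|
    condExp_nonneg (ae_of_all _ fun _ => sq_nonneg _)
  linarith [integral_condVar_add_variance_condExp hm hf]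

theorem integral_condVar_eq {m : MeasurableSpace Ω} (hm : m ≤ m₀) (f : Ω → ℝ) :
    μ[Var[f; μ | m]] = ∫ ω, (f ω - (μ[f | m]) ω) ^ 2 ∂μ :=
  integral_condExp hm

/- Given everything in `m`, the function `g` carries no information on `m₂`; subtracting it from `f`
therefore does not change the variance gained by passing from `m` to `m ⊔ m₂`. -/
theorem variance_condExp_sup_le {m m₁ m₂ : MeasurableSpace Ω} (hm : m ≤ m₁) (hm₁ : m₁ ≤ m₀)
    (hm₂ : m₂ ≤ m₀) (hindep : Indep m₁ m₂ μ) {f g : Ω → ℝ} (hf : MemLp f 2 μ)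
    (hg : StronglyMeasurable[m₁] g) (hgi : MemLp g 2 μ) :
    Var[μ[f | m ⊔ m₂]; μ] ≤ Var[μ[f | m]; μ] + ∫ ω, (f ω - g ω) ^ 2 ∂μ := by
  have hm' := hm.trans hm₁
  have hle : m ⊔ m₂ ≤ m₀ := sup_le hm' hm₂
  have tower (k : Ω → ℝ) : μ[μ[k | m ⊔ m₂] | m] =ᵐ[μ] μ[k | m] :=
    condExp_condExp_of_le le_sup_left hle
  have hlevel (k : Ω → ℝ) (hk : MemLp k 2 μ) :
      (∫ ω, ((μ[k | m ⊔ m₂]) ω - (μ[k | m]) ω) ^ 2 ∂μ) + Var[μ[k | m]; μ] =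
        Var[μ[k | m ⊔ m₂]; μ] := by
    rw [← integral_condVar_add_variance_condExp hm' (hk.condExp (m := m ⊔ m₂) one_le_two),
      variance_congr (tower k), integral_condVar_eq hm']
    congr 1
    refine integral_congr_ae ((tower k).mono fun ω h => ?_)
    simp only [h]
  have hincr : ∫ ω, ((μ[f | m ⊔ m₂]) ω - (μ[f | m]) ω) ^ 2 ∂μ =
      ∫ ω, ((μ[f - g | m ⊔ m₂]) ω - (μ[f - g | m]) ω) ^ 2 ∂μ := by
    refine integral_congr_ae ?_
    filter_upwards [condExp_sub (hf.integrable one_le_two) (hgi.integrable one_le_two) (m ⊔ m₂),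
      condExp_sub (hf.integrable one_le_two) (hgi.integrable one_le_two) m,
      condExp_sup_of_indep hm hm₁ hm₂ hindep hg (hgi.integrable one_le_two)] with ω h₁ h₂ h₃
    simp only [h₁, h₂, Pi.sub_apply, h₃]
    ring
  calc Var[μ[f | m ⊔ m₂]; μ]
      ≤ Var[μ[f | m]; μ] + Var[μ[f - g | m ⊔ m₂]; μ] := by
        linarith [hlevel f hf, hlevel _ (hf.sub hgi), variance_nonneg (μ[f - g | m]) μ]
    _ ≤ Var[μ[f | m]; μ] + Var[f - g; μ] := by
        gcongr; exact variance_condExp_le hle (hf.sub hgi)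
    _ ≤ Var[μ[f | m]; μ] + ∫ ω, (f ω - g ω) ^ 2 ∂μ := by
        gcongr
        exact variance_le_expectation_sq (hf.sub hgi).aestronglyMeasurable

theorem variance_le_sum_of_iIndep {ι : Type*} [Fintype ι] {m : ι → MeasurableSpace Ω}
    (hm : ∀ i, m i ≤ m₀) (hindep : iIndep m μ) {f : Ω → ℝ} (hf : StronglyMeasurable[⨆ i, m i] f)
    (hf2 : MemLp f 2 μ) {g : ι → Ω → ℝ} (hg : ∀ i, StronglyMeasurable[⨆ j ≠ i, m j] (g i))
    (hg2 : ∀ i, MemLp (g i) 2 μ) : Var[f; μ] ≤ ∑ i, ∫ ω, (f ω - g i ω) ^ 2 ∂μ := by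
  classical
  have hle (p : ι → Prop) : ⨆ j, ⨆ _ : p j, m j ≤ m₀ := iSup₂_le fun j _ => hm j
  have key (s : Finset ι) :
      Var[μ[f | ⨆ j ∈ s, m j]; μ] ≤ ∑ i ∈ s, ∫ ω, (f ω - g i ω) ^ 2 ∂μ := by
    induction s using Finset.induction_on with
    | empty => simp [condExp_bot, variance, evariance]
    | insert i s hi ih =>
      have hdisj : Indep (⨆ j ≠ i, m j) (m i) μ := by
        simpa using indep_iSup_of_disjoint hm hindep (S := {i}ᶜ) (T := {i}) disjoint_compl_left
      have hs : ⨆ j ∈ s, m j ≤ ⨆ j ≠ i, m j :=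
        iSup₂_mono' fun j hj => ⟨j, ne_of_mem_of_not_mem hj hi, le_rfl⟩
      rw [Finset.iSup_insert, sup_comm, Finset.sum_insert hi]
      linarith [variance_condExp_sup_le hs (hle _) (hm i) hdisj hf2 (hg i) (hg2 i)]
  simpa [condExp_of_stronglyMeasurable (iSup_le hm) hf (hf2.integrable one_le_two)] using
    key Finset.univ

theorem complexVariance_eq_variance_re_add_variance_im {f : Ω → ℂ} (hf : MemLp f 2 μ) :
    complexVariance μ f = Var[fun ω => (f ω).re; μ] + Var[fun ω => (f ω).im; μ] := by
  have hre : MemLp (fun ω => (f ω).re) 2 μ := hf.re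
  have him : MemLp (fun ω => (f ω).im) 2 μ := hf.im
  have hre_sub : MemLp (fun ω => (f ω).re - ∫ ω', (f ω').re ∂μ) 2 μ := hre.sub (memLp_const _)
  have him_sub : MemLp (fun ω => (f ω).im - ∫ ω', (f ω').im ∂μ) 2 μ := him.sub (memLp_const _)
  rw [variance_eq_integral hre.aemeasurable, variance_eq_integral him.aemeasurable,
    ← integral_add hre_sub.integrable_sq him_sub.integrable_sq]
  have hfi := hf.integrable one_le_two
  have hre_int : ∫ ω, (f ω).re ∂μ = (∫ ω, f ω ∂μ).re := integral_re hfi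
  have him_int : ∫ ω, (f ω).im ∂μ = (∫ ω, f ω ∂μ).im := integral_im hfi
  refine integral_congr_ae (ae_of_all _ fun ω => ?_)
  simp only [hre_int, him_int, Complex.sq_norm, Complex.normSq_apply, Complex.sub_re,
    Complex.sub_im]
  ring

theorem complexVariance_le_sum_of_iIndep {ι : Type*} [Fintype ι] {m : ι → MeasurableSpace Ω}
    (hm : ∀ i, m i ≤ m₀) (hindep : iIndep m μ) {f : Ω → ℂ} (hf : StronglyMeasurable[⨆ i, m i] f)
    (hf2 : MemLp f 2 μ) {g : ι → Ω → ℂ} (hg : ∀ i, StronglyMeasurable[⨆ j ≠ i, m j] (g i))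
    (hg2 : ∀ i, MemLp (g i) 2 μ) : complexVariance μ f ≤ ∑ i, ∫ ω, ‖f ω - g i ω‖ ^ 2 ∂μ := by
  have hre (i : ι) : MemLp (fun ω => (f ω).re - (g i ω).re) 2 μ := hf2.re.sub (hg2 i).re
  have him (i : ι) : MemLp (fun ω => (f ω).im - (g i ω).im) 2 μ := hf2.im.sub (hg2 i).im
  calc complexVariance μ f
      = Var[fun ω => (f ω).re; μ] + Var[fun ω => (f ω).im; μ] :=
        complexVariance_eq_variance_re_add_variance_im hf2
    _ ≤ (∑ i, ∫ ω, ((f ω).re - (g i ω).re) ^ 2 ∂μ) +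
          ∑ i, ∫ ω, ((f ω).im - (g i ω).im) ^ 2 ∂μ := by
        gcongr
        · exact variance_le_sum_of_iIndep hm hindep
            (Complex.continuous_re.comp_stronglyMeasurable hf) hf2.re
            (fun i => Complex.continuous_re.comp_stronglyMeasurable (hg i)) fun i => (hg2 i).re
        · exact variance_le_sum_of_iIndep hm hindep
            (Complex.continuous_im.comp_stronglyMeasurable hf) hf2.im
            (fun i => Complex.continuous_im.comp_stronglyMeasurable (hg i)) fun i => (hg2 i).im
    _ = ∑ i, ∫ ω, ‖f ω - g i ω‖ ^ 2 ∂μ := by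
        rw [← Finset.sum_add_distrib]
        refine Finset.sum_congr rfl fun i _ => ?_
        rw [← integral_add (hre i).integrable_sq (him i).integrable_sq]
        refine integral_congr_ae (ae_of_all _ fun ω => ?_)
        simp only [Complex.sq_norm, Complex.normSq_apply, Complex.sub_re, Complex.sub_im]
        ring

end EfronStein

/-! ### Resolvents of Hermitian matrices -/

section ResolventOperator

open scoped ComplexConjugate InnerProductSpace

variable {H : Type*} [NormedAddCommGroup H] [InnerProductSpace ℂ H] [CompleteSpace H]
  {A B : H →L[ℂ] H} {z : ℂ}

theorem mem_resolventSet_of_im_ne_zero (hA : IsSelfAdjoint A) (hz : z.im ≠ 0) :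
    z ∈ resolventSet ℂ A := by
  by_contra h
  exact hz (by rw [hA.mem_spectrum_eq_re (z := z) h, Complex.ofReal_im])

theorem smul_resolvent_apply (hA : IsSelfAdjoint A) (hz : z.im ≠ 0) (v : H) :
    z • resolvent A z v = v + A (resolvent A z v) := by
  have h : (algebraMap ℂ (H →L[ℂ] H) z - A) * resolvent A z = 1 :=
    Ring.mul_inverse_cancel _ (mem_resolventSet_of_im_ne_zero hA hz)
  have := congr($h v)
  simp only [mul_apply_eq_comp, sub_apply, Algebra.algebraMap_eq_smul_one, smul_apply,
    one_apply_eq_self] at this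
  rw [← sub_eq_iff_eq_add, this]

theorem im_inner_resolvent_apply (hA : IsSelfAdjoint A) (hz : z.im ≠ 0) (v : H) :
    (⟪v, resolvent A z v⟫_ℂ).im = -z.im * ‖resolvent A z v‖ ^ 2 := by
  have hv : v = z • resolvent A z v - A (resolvent A z v) := by
    rw [smul_resolvent_apply hA hz, add_sub_cancel_right]
  have hreal : (⟪A (resolvent A z v), resolvent A z v⟫_ℂ).im = 0 :=
    hA.isSymmetric.im_inner_apply_self _
  nth_rw 1 [hv]
  rw [inner_sub_left, inner_smul_left, inner_self_eq_norm_sq_to_K, Complex.sub_im, hreal]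
  simp [← Complex.ofReal_pow]

theorem norm_resolvent_apply_le (hA : IsSelfAdjoint A) (hz : z.im ≠ 0) (v : H) :
    ‖resolvent A z v‖ ≤ |z.im|⁻¹ * ‖v‖ := by
  have him : |z.im| * ‖resolvent A z v‖ ^ 2 ≤ ‖v‖ * ‖resolvent A z v‖ := by
    calc |z.im| * ‖resolvent A z v‖ ^ 2
        = |(⟪v, resolvent A z v⟫_ℂ).im| := by
          rw [im_inner_resolvent_apply hA hz, abs_mul, abs_neg, abs_sq]
      _ ≤ ‖v‖ * ‖resolvent A z v‖ :=
          (Complex.abs_im_le_norm _).trans (norm_inner_le_norm _ _)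
  rw [le_inv_mul_iff₀ (abs_pos.2 hz)]
  rcases (norm_nonneg (resolvent A z v)).eq_or_lt with h | h
  · rw [← h, mul_zero]; exact norm_nonneg v
  · exact le_of_mul_le_mul_right (by linarith) h

theorem inner_resolvent_apply (hA : IsSelfAdjoint A) (u v : H) :
    ⟪u, resolvent A z v⟫_ℂ = ⟪resolvent A (conj z) u, v⟫_ℂ := by
  have hstar : star (resolvent A (conj z)) = resolvent A z := by
    simp only [resolvent, ← Ring.inverse_star, star_sub, hA.star_eq, ← algebraMap_star_comm]
    simp
  rw [← hstar, ContinuousLinearMap.star_eq_adjoint, ContinuousLinearMap.adjoint_inner_right]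

theorem resolvent_apply_sub (hA : IsSelfAdjoint A) (hB : IsSelfAdjoint B) (hz : z.im ≠ 0) (v : H) :
    resolvent A z v - resolvent B z v = resolvent A z ((A - B) (resolvent B z v)) :=
  congr($(spectrum.resolvent_sub_resolvent (mem_resolventSet_of_im_ne_zero hA hz)
    (mem_resolventSet_of_im_ne_zero hB hz)) v)

theorem inner_resolvent_apply_sub (hA : IsSelfAdjoint A) (hB : IsSelfAdjoint B) (hz : z.im ≠ 0)
    (u v : H) : ⟪u, resolvent A z v⟫_ℂ - ⟪u, resolvent B z v⟫_ℂ =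
      ⟪resolvent A (conj z) u, (A - B) (resolvent B z v)⟫_ℂ := by
  rw [← inner_sub_right, resolvent_apply_sub hA hB hz, inner_resolvent_apply hA]

end ResolventOperator

section ResolventMatrix

open scoped ComplexConjugate InnerProductSpace

variable {ι : Type*} [Fintype ι] [DecidableEq ι] {X Y : Matrix ι ι ℂ} {z : ℂ}

/-- The vector `(z - X)⁻¹ v`, whose coordinates and inner products are the quantities estimated
below; the junk value when `z` is an eigenvalue of `X` is `0`. -/
noncomputable def resolventVec (X : Matrix ι ι ℂ) (z : ℂ) (v : EuclideanSpace ℂ ι) :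
    EuclideanSpace ℂ ι :=
  resolvent (Matrix.toEuclideanCLM (𝕜 := ℂ) X) z v

theorem isSelfAdjoint_toEuclideanCLM (hX : X.IsHermitian) :
    IsSelfAdjoint (Matrix.toEuclideanCLM (𝕜 := ℂ) X) :=
  IsSelfAdjoint.map (x := X) hX _

theorem toEuclideanCLM_apply (X : Matrix ι ι ℂ) (v : EuclideanSpace ℂ ι) (i : ι) :
    Matrix.toEuclideanCLM (𝕜 := ℂ) X v i = ∑ j, X i j * v j :=
  rfl

theorem mul_resolventVec (hX : X.IsHermitian) (hz : z.im ≠ 0) (v : EuclideanSpace ℂ ι) (i : ι) :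
    z * resolventVec X z v i = v i + ∑ j, X i j * resolventVec X z v j :=
  congr($(smul_resolvent_apply (isSelfAdjoint_toEuclideanCLM hX) hz v) i)

theorem norm_resolventVec_le (hX : X.IsHermitian) (hz : z.im ≠ 0) (v : EuclideanSpace ℂ ι) :
    ‖resolventVec X z v‖ ≤ |z.im|⁻¹ * ‖v‖ :=
  norm_resolvent_apply_le (isSelfAdjoint_toEuclideanCLM hX) hz v

theorem inner_resolventVec (hX : X.IsHermitian) (z : ℂ) (u v : EuclideanSpace ℂ ι) :
    ⟪u, resolventVec X z v⟫_ℂ = ⟪resolventVec X (conj z) u, v⟫_ℂ :=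
  inner_resolvent_apply (isSelfAdjoint_toEuclideanCLM hX) u v

theorem inner_resolventVec_sub (hX : X.IsHermitian) (hY : Y.IsHermitian) (hz : z.im ≠ 0)
    (u v : EuclideanSpace ℂ ι) : ⟪u, resolventVec X z v⟫_ℂ - ⟪u, resolventVec Y z v⟫_ℂ =
      ⟪resolventVec X (conj z) u,
        Matrix.toEuclideanCLM (𝕜 := ℂ) (X - Y) (resolventVec Y z v)⟫_ℂ := by
  rw [map_sub]
  exact inner_resolvent_apply_sub (isSelfAdjoint_toEuclideanCLM hX)
    (isSelfAdjoint_toEuclideanCLM hY) hz u v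

theorem im_mul_im_inner_resolventVec_nonpos (hX : X.IsHermitian) (hz : z.im ≠ 0)
    (v : EuclideanSpace ℂ ι) : z.im * (⟪v, resolventVec X z v⟫_ℂ).im ≤ 0 := by
  rw [resolventVec, im_inner_resolvent_apply (isSelfAdjoint_toEuclideanCLM hX) hz]
  nlinarith [mul_nonneg (sq_nonneg z.im) (sq_nonneg ‖resolventVec X z v‖)]

theorem resolventVec_eq_toEuclideanCLM_inv (hX : X.IsHermitian) (hz : z.im ≠ 0)
    (v : EuclideanSpace ℂ ι) :
    resolventVec X z v = Matrix.toEuclideanCLM (𝕜 := ℂ) (z • (1 : Matrix ι ι ℂ) - X)⁻¹ v := by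
  have hmap : algebraMap ℂ _ z - Matrix.toEuclideanCLM (𝕜 := ℂ) X =
      Matrix.toEuclideanCLM (𝕜 := ℂ) (z • (1 : Matrix ι ι ℂ) - X) := by
    rw [Algebra.algebraMap_eq_smul_one, map_sub, map_smul, map_one]
  have hunit := mem_resolventSet_of_im_ne_zero (isSelfAdjoint_toEuclideanCLM hX) hz
  rw [spectrum.mem_resolventSet_iff, hmap, MulEquiv.isUnit_map] at hunit
  obtain ⟨U, hU⟩ := hunit
  rw [resolventVec, resolvent, hmap, ← hU, ← Matrix.coe_units_inv]
  have hinv := Ring.inverse_unit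
    (Units.map (MonoidHomClass.toMonoidHom (Matrix.toEuclideanCLM (n := ι) (𝕜 := ℂ))) U)
  exact congr($hinv v)

theorem stronglyMeasurable_resolventVec {Ω : Type*} {m : MeasurableSpace Ω}
    {X : Ω → Matrix ι ι ℂ} (hmeas : ∀ i j, Measurable[m] fun ω => X ω i j)
    (hX : ∀ ω, (X ω).IsHermitian) (hz : z.im ≠ 0) (v : EuclideanSpace ℂ ι) (i : ι) :
    StronglyMeasurable[m] fun ω => resolventVec (X ω) z v i := by
  have hX' : StronglyMeasurable[m] fun ω => z • (1 : Matrix ι ι ℂ) - X ω :=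
    stronglyMeasurable_const.sub
      (measurable_pi_iff.2 fun i => measurable_pi_iff.2 (hmeas i)).stronglyMeasurable
  simp only [resolventVec_eq_toEuclideanCLM_inv (hX _) hz, toEuclideanCLM_apply, Matrix.inv_def,
    Ring.inverse_eq_inv', Matrix.smul_apply, smul_eq_mul]
  have hdet := (Continuous.matrix_det continuous_id).comp_stronglyMeasurable hX'
  refine Finset.stronglyMeasurable_fun_sum _ fun j _ => StronglyMeasurable.mul_const
    (StronglyMeasurable.mul hdet.measurable.inv.stronglyMeasurable ?_) _
  exact ((Continuous.matrix_adjugate continuous_id).matrix_elem i j).comp_stronglyMeasurable hX'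

end ResolventMatrix

/-! ### Perturbing one entry -/

section ZeroOut

open scoped ComplexConjugate InnerProductSpace

variable {ι : Type*} {X : Matrix ι ι ℂ} {z : ℂ} {u v : EuclideanSpace ℂ ι}

/-- The total size of the coordinates `i` and `j` of a vector. -/
noncomputable def pairNorm (w : EuclideanSpace ℂ ι) (i j : ι) : ℝ :=
  ‖w i‖ + ‖w j‖

/-- The size of the entry `(i, j)` of the symmetrized rank one matrix built from `p` and `q`; it
controls `⟪p, D q⟫` for Hermitian `D` supported on the positions `(i, j)` and `(j, i)`. -/
noncomputable def crossNorm (p q : EuclideanSpace ℂ ι) (i j : ι) : ℝ :=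
  ‖p i‖ * ‖q j‖ + ‖p j‖ * ‖q i‖

theorem pairNorm_nonneg (w : EuclideanSpace ℂ ι) (i j : ι) : 0 ≤ pairNorm w i j := by
  unfold pairNorm; positivity

theorem crossNorm_nonneg (p q : EuclideanSpace ℂ ι) (i j : ι) : 0 ≤ crossNorm p q i j := by
  unfold crossNorm; positivity

theorem crossNorm_le_mul_pairNorm {p : EuclideanSpace ℂ ι} {y : ℝ} (hp : ∀ k, ‖p k‖ ≤ y)
    (q : EuclideanSpace ℂ ι) (i j : ι) : crossNorm p q i j ≤ y * pairNorm q i j := by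
  rw [crossNorm, pairNorm, mul_add, add_comm]
  gcongr <;> exact hp _

theorem crossNorm_le_add {p p' q q' : EuclideanSpace ℂ ι} {y ε₁ ε₂ : ℝ} (hp : ∀ k, ‖p k‖ ≤ y)
    (hq' : ∀ k, ‖q' k‖ ≤ y) (hpp' : ∀ k, ‖p k - p' k‖ ≤ ε₁) (hqq' : ∀ k, ‖q k - q' k‖ ≤ ε₂)
    (i j : ι) : crossNorm p' q' i j ≤ crossNorm p q i j + 2 * y * (ε₁ + ε₂) := by
  have key (k l : ι) : ‖p' k‖ * ‖q' l‖ ≤ ‖p k‖ * ‖q l‖ + y * (ε₁ + ε₂) := by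
    have h₁ : ‖p' k‖ ≤ ‖p k‖ + ε₁ :=
      (norm_le_norm_add_norm_sub _ _).trans (add_le_add_right (hpp' k) _)
    have h₂ : ‖q' l‖ ≤ ‖q l‖ + ε₂ :=
      (norm_le_norm_add_norm_sub _ _).trans (add_le_add_right (hqq' l) _)
    have hε₁ : 0 ≤ ε₁ := (norm_nonneg _).trans (hpp' k)
    have hε₂ : 0 ≤ ε₂ := (norm_nonneg _).trans (hqq' k)
    calc ‖p' k‖ * ‖q' l‖ ≤ (‖p k‖ + ε₁) * ‖q' l‖ := by gcongr
      _ = ‖p k‖ * ‖q' l‖ + ε₁ * ‖q' l‖ := by ring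
      _ ≤ ‖p k‖ * (‖q l‖ + ε₂) + ε₁ * y := by gcongr; exact hq' l
      _ = ‖p k‖ * ‖q l‖ + ‖p k‖ * ε₂ + ε₁ * y := by ring
      _ ≤ ‖p k‖ * ‖q l‖ + y * ε₂ + ε₁ * y := by gcongr; exact hp k
      _ = ‖p k‖ * ‖q l‖ + y * (ε₁ + ε₂) := by ring
  simp only [crossNorm]
  linarith [key i j, key j i]

variable [DecidableEq ι]

/-- The matrix `X` with its entries at the unordered position `s` replaced by zero. -/
def zeroOut (X : Matrix ι ι ℂ) (s : Sym2 ι) : Matrix ι ι ℂ :=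
  Matrix.of fun i j => if s(i, j) = s then 0 else X i j

theorem isHermitian_zeroOut (hX : X.IsHermitian) (s : Sym2 ι) : (zeroOut X s).IsHermitian := by
  ext i j
  simp only [zeroOut, Matrix.conjTranspose_apply, Matrix.of_apply, Sym2.eq_swap (a := j)]
  split_ifs
  · exact star_zero ℂ
  · exact hX.apply i j

theorem sub_zeroOut_of_ne {i j : ι} (hij : i ≠ j) :
    X - zeroOut X s(i, j) = Matrix.single i j (X i j) + Matrix.single j i (X j i) := by
  ext a b
  simp only [zeroOut, Matrix.sub_apply, Matrix.of_apply, Matrix.add_apply, Matrix.single_apply,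
    Sym2.eq_iff]
  grind

theorem sub_zeroOut_diag (i : ι) : X - zeroOut X s(i, i) = Matrix.single i i (X i i) := by
  ext a b
  simp only [zeroOut, Matrix.sub_apply, Matrix.of_apply, Matrix.single_apply, Sym2.eq_iff]
  grind

variable [Fintype ι]

theorem norm_resolventVec_le_inv (hX : X.IsHermitian) (hz : z.im ≠ 0) (hv : ‖v‖ ≤ 1) :
    ‖resolventVec X z v‖ ≤ |z.im|⁻¹ :=
  (norm_resolventVec_le hX hz v).trans <| mul_le_of_le_one_right (by positivity) hv

theorem norm_resolventVec_apply_le (hX : X.IsHermitian) (hz : z.im ≠ 0) (hv : ‖v‖ ≤ 1) (k : ι) :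
    ‖resolventVec X z v k‖ ≤ |z.im|⁻¹ :=
  (PiLp.norm_apply_le _ k).trans (norm_resolventVec_le_inv hX hz hv)

theorem inner_toEuclideanCLM_single (p q : EuclideanSpace ℂ ι) (i j : ι) (c : ℂ) :
    ⟪p, Matrix.toEuclideanCLM (𝕜 := ℂ) (Matrix.single i j c) q⟫_ℂ = conj (p i) * c * q j := by
  simp [PiLp.inner_apply, toEuclideanCLM_apply, Matrix.single_apply, ite_and, Finset.sum_ite_eq]
  ring

theorem inner_sub_zeroOut_of_ne (p q : EuclideanSpace ℂ ι) {i j : ι} (hij : i ≠ j) :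
    ⟪p, Matrix.toEuclideanCLM (𝕜 := ℂ) (X - zeroOut X s(i, j)) q⟫_ℂ =
      conj (p i) * X i j * q j + conj (p j) * X j i * q i := by
  rw [sub_zeroOut_of_ne hij, map_add, add_apply, inner_add_right, inner_toEuclideanCLM_single,
    inner_toEuclideanCLM_single]

theorem norm_inner_sub_zeroOut_le (hX : X.IsHermitian) (p q : EuclideanSpace ℂ ι) (i j : ι) :
    ‖⟪p, Matrix.toEuclideanCLM (𝕜 := ℂ) (X - zeroOut X s(i, j)) q⟫_ℂ‖ ≤
      ‖X i j‖ * crossNorm p q i j := by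
  rcases eq_or_ne i j with rfl | hij
  · rw [sub_zeroOut_diag, inner_toEuclideanCLM_single, norm_mul, norm_mul, RCLike.norm_conj,
      crossNorm]
    nlinarith only [show 0 ≤ ‖X i i‖ * (‖p i‖ * ‖q i‖) by positivity]
  · have hji : ‖X j i‖ = ‖X i j‖ := by rw [← hX.apply, norm_star]
    rw [inner_sub_zeroOut_of_ne _ _ hij]
    refine (norm_add_le _ _).trans_eq ?_
    rw [norm_mul, norm_mul, norm_mul, norm_mul, RCLike.norm_conj, RCLike.norm_conj, hji, crossNorm]
    ring

theorem norm_inner_resolventVec_sub_zeroOut_le (hX : X.IsHermitian) (hz : z.im ≠ 0) (i j : ι) :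
    ‖⟪u, resolventVec X z v⟫_ℂ - ⟪u, resolventVec (zeroOut X s(i, j)) z v⟫_ℂ‖ ≤
      ‖X i j‖ * crossNorm (resolventVec X (conj z) u)
        (resolventVec (zeroOut X s(i, j)) z v) i j := by
  rw [inner_resolventVec_sub hX (isHermitian_zeroOut hX _) hz]
  exact norm_inner_sub_zeroOut_le hX _ _ i j

theorem norm_inner_resolventVec_sub_zeroOut_le_pairNorm (hX : X.IsHermitian) (hz : z.im ≠ 0)
    (hu : ‖u‖ ≤ 1) (i j : ι) :
    ‖⟪u, resolventVec X z v⟫_ℂ - ⟪u, resolventVec (zeroOut X s(i, j)) z v⟫_ℂ‖ ≤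
      ‖X i j‖ * |z.im|⁻¹ * pairNorm (resolventVec (zeroOut X s(i, j)) z v) i j := by
  rw [mul_assoc]
  refine (norm_inner_resolventVec_sub_zeroOut_le hX hz i j).trans ?_
  gcongr
  refine crossNorm_le_mul_pairNorm (fun k => ?_) _ i j
  simpa using norm_resolventVec_apply_le hX (z := conj z) (by simpa using hz) hu k

theorem norm_resolventVec_sub_zeroOut_apply_le (hX : X.IsHermitian) (hz : z.im ≠ 0) (i j k : ι) :
    ‖resolventVec X z v k - resolventVec (zeroOut X s(i, j)) z v k‖ ≤
      ‖X i j‖ * |z.im|⁻¹ * pairNorm (resolventVec (zeroOut X s(i, j)) z v) i j := by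
  simpa [EuclideanSpace.inner_single_left] using norm_inner_resolventVec_sub_zeroOut_le_pairNorm
    (u := EuclideanSpace.single k 1) (v := v) hX hz (by simp) i j

theorem pairNorm_resolventVec_le (hX : X.IsHermitian) (hz : z.im ≠ 0) (hv : ‖v‖ ≤ 1) (i j : ι) :
    pairNorm (resolventVec X z v) i j ≤ 2 * |z.im|⁻¹ := by
  rw [pairNorm, two_mul]
  gcongr <;> exact norm_resolventVec_apply_le hX hz hv _

theorem pairNorm_zeroOut_le (hX : X.IsHermitian) (hz : z.im ≠ 0) (hv : ‖v‖ ≤ 1) (i j : ι) :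
    pairNorm (resolventVec (zeroOut X s(i, j)) z v) i j ≤
      pairNorm (resolventVec X z v) i j + 4 * ‖X i j‖ * |z.im|⁻¹ ^ 2 := by
  have hle (k : ι) : ‖resolventVec (zeroOut X s(i, j)) z v k‖ ≤
      ‖resolventVec X z v k‖ + ‖X i j‖ * |z.im|⁻¹ * (2 * |z.im|⁻¹) := by
    refine (norm_le_norm_add_norm_sub _ _).trans (add_le_add_right ?_ _)
    refine (norm_resolventVec_sub_zeroOut_apply_le hX hz i j k).trans ?_
    gcongr
    exact pairNorm_resolventVec_le (isHermitian_zeroOut hX _) hz hv i j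
  simp only [pairNorm]
  linarith [hle i, hle j]

theorem pairNorm_zeroOut_sq_le (hX : X.IsHermitian) (hz : z.im ≠ 0) (hv : ‖v‖ ≤ 1) (i j : ι) :
    pairNorm (resolventVec (zeroOut X s(i, j)) z v) i j ^ 2 ≤
      2 * pairNorm (resolventVec X z v) i j ^ 2 + 32 * |z.im|⁻¹ ^ 4 * ‖X i j‖ ^ 2 := by
  calc pairNorm (resolventVec (zeroOut X s(i, j)) z v) i j ^ 2
      ≤ (pairNorm (resolventVec X z v) i j + 4 * ‖X i j‖ * |z.im|⁻¹ ^ 2) ^ 2 := by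
        gcongr
        · exact pairNorm_nonneg _ i j
        · exact pairNorm_zeroOut_le hX hz hv i j
    _ ≤ 2 * (pairNorm (resolventVec X z v) i j ^ 2 + (4 * ‖X i j‖ * |z.im|⁻¹ ^ 2) ^ 2) :=
        add_sq_le
    _ = 2 * pairNorm (resolventVec X z v) i j ^ 2 + 32 * |z.im|⁻¹ ^ 4 * ‖X i j‖ ^ 2 := by ring

theorem crossNorm_zeroOut_sq_le (hX : X.IsHermitian) (hz : z.im ≠ 0) (hu : ‖u‖ ≤ 1)
    (hv : ‖v‖ ≤ 1) (i j : ι) :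
    crossNorm (resolventVec (zeroOut X s(i, j)) (conj z) u)
        (resolventVec (zeroOut X s(i, j)) z v) i j ^ 2 ≤
      2 * crossNorm (resolventVec X (conj z) u) (resolventVec X z v) i j ^ 2 +
        16 * |z.im|⁻¹ ^ 4 * (‖X i j‖ ^ 2 *
          (pairNorm (resolventVec (zeroOut X s(i, j)) (conj z) u) i j ^ 2 +
            pairNorm (resolventVec (zeroOut X s(i, j)) z v) i j ^ 2)) := by
  have hz' : (conj z).im ≠ 0 := by simpa using hz
  have hy : |(conj z).im|⁻¹ = |z.im|⁻¹ := by simp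
  have h := crossNorm_le_add (fun k => hy ▸ norm_resolventVec_apply_le hX hz' hu k)
    (norm_resolventVec_apply_le (isHermitian_zeroOut hX s(i, j)) hz hv)
    (hy ▸ norm_resolventVec_sub_zeroOut_apply_le (v := u) hX hz' i j)
    (norm_resolventVec_sub_zeroOut_apply_le (v := v) hX hz i j) i j
  have hc' := crossNorm_nonneg (resolventVec (zeroOut X s(i, j)) (conj z) u)
    (resolventVec (zeroOut X s(i, j)) z v) i j
  generalize crossNorm (resolventVec (zeroOut X s(i, j)) (conj z) u) _ i j = c' at *
  generalize crossNorm _ _ i j = c at *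
  generalize pairNorm _ i j = S₁ at *
  generalize pairNorm _ i j = S₂ at *
  generalize |z.im|⁻¹ = y at *
  calc c' ^ 2 ≤ (c + 2 * y * (‖X i j‖ * y * S₁ + ‖X i j‖ * y * S₂)) ^ 2 := by gcongr
    _ ≤ 2 * (c ^ 2 + (2 * y * (‖X i j‖ * y * S₁ + ‖X i j‖ * y * S₂)) ^ 2) := add_sq_le
    _ = 2 * c ^ 2 + 8 * y ^ 4 * (‖X i j‖ ^ 2 * (S₁ + S₂) ^ 2) := by ring
    _ ≤ 2 * c ^ 2 + 8 * y ^ 4 * (‖X i j‖ ^ 2 * (2 * (S₁ ^ 2 + S₂ ^ 2))) := by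
        gcongr; exact add_sq_le
    _ = 2 * c ^ 2 + 16 * y ^ 4 * (‖X i j‖ ^ 2 * (S₁ ^ 2 + S₂ ^ 2)) := by ring

theorem norm_inner_resolventVec_sub_zeroOut_sq_le (hX : X.IsHermitian) (hz : z.im ≠ 0)
    (hu : ‖u‖ ≤ 1) (hv : ‖v‖ ≤ 1) (i j : ι) :
    ‖⟪u, resolventVec X z v⟫_ℂ - ⟪u, resolventVec (zeroOut X s(i, j)) z v⟫_ℂ‖ ^ 2 ≤
      2 * (‖X i j‖ ^ 2 * crossNorm (resolventVec (zeroOut X s(i, j)) (conj z) u)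
        (resolventVec (zeroOut X s(i, j)) z v) i j ^ 2) +
      8 * |z.im|⁻¹ ^ 4 *
        (‖X i j‖ ^ 4 * pairNorm (resolventVec (zeroOut X s(i, j)) (conj z) u) i j ^ 2) := by
  have hz' : (conj z).im ≠ 0 := by simpa using hz
  have hy : |(conj z).im|⁻¹ = |z.im|⁻¹ := by simp
  have hX' := isHermitian_zeroOut hX s(i, j)
  have hcross := crossNorm_le_add (ε₂ := 0)
    (fun k => hy ▸ norm_resolventVec_apply_le hX' hz' hu k)
    (norm_resolventVec_apply_le hX' hz hv)
    (fun k => norm_sub_rev _ _ |>.trans_le <|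
      hy ▸ norm_resolventVec_sub_zeroOut_apply_le (v := u) hX hz' i j k)
    (fun k => (sub_self (resolventVec (zeroOut X s(i, j)) z v k)).symm ▸ norm_zero.le) i j
  have h := (norm_inner_resolventVec_sub_zeroOut_le (u := u) (v := v) hX hz i j).trans
    (mul_le_mul_of_nonneg_left hcross (norm_nonneg _))
  refine (pow_le_pow_left₀ (norm_nonneg _) h 2).trans ?_
  rw [mul_add]
  exact add_sq_le.trans_eq (by ring)

end ZeroOut

/-! ### Wigner matrices through their entries -/

section Decoupling

variable {Ω ι : Type*}

/-- The σ-algebra generated by the entries of the random matrix `X` at the unordered position `s`,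
that is by `X i j` and `X j i` for `s = s(i, j)`. -/
abbrev entrySigma (X : Ω → Matrix ι ι ℂ) (s : Sym2 ι) : MeasurableSpace Ω :=
  ⨆ (p : ι × ι) (_ : s(p.1, p.2) = s),
    MeasurableSpace.comap (fun ω => X ω p.1 p.2) (inferInstanceAs (MeasurableSpace ℂ))

/-- The σ-algebra generated by the entries of the random matrix `X` away from the unordered
position `s`. -/
abbrev restSigma (X : Ω → Matrix ι ι ℂ) (s : Sym2 ι) : MeasurableSpace Ω :=
  ⨆ t ≠ s, entrySigma X t

variable {X : Ω → Matrix ι ι ℂ}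

theorem measurable_entrySigma (X : Ω → Matrix ι ι ℂ) (i j : ι) :
    Measurable[entrySigma X s(i, j)] fun ω => X ω i j :=
  measurable_iff_comap_le.2 <| le_iSup₂_of_le (i, j) rfl le_rfl

theorem entrySigma_le {m : MeasurableSpace Ω} {s : Sym2 ι}
    (hX : ∀ i j, s(i, j) = s → Measurable[m] fun ω => X ω i j) : entrySigma X s ≤ m :=
  iSup₂_le fun p hp => measurable_iff_comap_le.1 (hX p.1 p.2 hp)

theorem measurable_zeroOut_restSigma [DecidableEq ι] (X : Ω → Matrix ι ι ℂ) (s : Sym2 ι) (i j : ι) :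
    Measurable[restSigma X s] fun ω => zeroOut (X ω) s i j := by
  simp only [zeroOut, Matrix.of_apply]
  split_ifs with h
  · exact measurable_const
  · exact (measurable_entrySigma X i j).mono
      (le_iSup₂_of_le (f := fun t (_ : t ≠ s) => entrySigma X t) _ h le_rfl) le_rfl

theorem stronglyMeasurable_resolventVec_zeroOut [Fintype ι] [DecidableEq ι]
    (hX : ∀ ω, (X ω).IsHermitian) {z : ℂ} (hz : z.im ≠ 0) (v : EuclideanSpace ℂ ι) (s : Sym2 ι)
    (k : ι) : StronglyMeasurable[restSigma X s] fun ω => resolventVec (zeroOut (X ω) s) z v k :=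
  stronglyMeasurable_resolventVec (measurable_zeroOut_restSigma X s)
    (fun ω => isHermitian_zeroOut (hX ω) s) hz v k

theorem stronglyMeasurable_inner_left [Fintype ι] {m : MeasurableSpace Ω}
    {p : Ω → EuclideanSpace ℂ ι} (hp : ∀ k, StronglyMeasurable[m] fun ω => p ω k)
    (u : EuclideanSpace ℂ ι) : StronglyMeasurable[m] fun ω => inner ℂ u (p ω) := by
  simp only [PiLp.inner_apply, RCLike.inner_apply]
  exact Finset.stronglyMeasurable_fun_sum _ fun k _ => (hp k).mul_const _

theorem stronglyMeasurable_pairNorm {m : MeasurableSpace Ω}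
    {p : Ω → EuclideanSpace ℂ ι} (hp : ∀ k, StronglyMeasurable[m] fun ω => p ω k) (i j : ι) :
    StronglyMeasurable[m] fun ω => pairNorm (p ω) i j :=
  (hp i).norm.add (hp j).norm

theorem stronglyMeasurable_crossNorm {m : MeasurableSpace Ω}
    {p q : Ω → EuclideanSpace ℂ ι} (hp : ∀ k, StronglyMeasurable[m] fun ω => p ω k)
    (hq : ∀ k, StronglyMeasurable[m] fun ω => q ω k) (i j : ι) :
    StronglyMeasurable[m] fun ω => crossNorm (p ω) (q ω) i j :=
  ((hp i).norm.mul (hq j).norm).add ((hp j).norm.mul (hq i).norm)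

variable [m₀ : MeasurableSpace Ω] {μ : Measure Ω}

theorem memLp_inner_resolventVec [IsFiniteMeasure μ] [Fintype ι] [DecidableEq ι]
    (hmeas : ∀ i j, Measurable fun ω => X ω i j) (hX : ∀ ω, (X ω).IsHermitian) {z : ℂ}
    (hz : z.im ≠ 0) (u v : EuclideanSpace ℂ ι) (p : ENNReal) :
    MemLp (fun ω => inner ℂ u (resolventVec (X ω) z v)) p μ :=
  .of_bound (stronglyMeasurable_inner_left (stronglyMeasurable_resolventVec hmeas hX hz v)
    u).aestronglyMeasurable (‖u‖ * (|z.im|⁻¹ * ‖v‖)) <| ae_of_all _ fun ω =>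
      (norm_inner_le_norm _ _).trans <|
        mul_le_mul_of_nonneg_left (norm_resolventVec_le (hX ω) hz v) (norm_nonneg u)

theorem integral_mul_of_indep {𝕜 : Type*} [RCLike 𝕜] {m₁ m₂ : MeasurableSpace Ω} (hm₁ : m₁ ≤ m₀)
    (hm₂ : m₂ ≤ m₀) (hindep : Indep m₁ m₂ μ) {f g : Ω → 𝕜} (hf : StronglyMeasurable[m₁] f)
    (hg : StronglyMeasurable[m₂] g) : ∫ ω, f ω * g ω ∂μ = (∫ ω, f ω ∂μ) * ∫ ω, g ω ∂μ := by
  refine IndepFun.integral_fun_mul_eq_mul_integral ((IndepFun_iff_Indep f g μ).2 ?_)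
    (hf.mono hm₁).aestronglyMeasurable (hg.mono hm₂).aestronglyMeasurable
  exact indep_of_indep_of_le_left (indep_of_indep_of_le_right hindep hg.measurable.comap_le)
    hf.measurable.comap_le

theorem iIndep_mono {κ : Type*} {m m' : κ → MeasurableSpace Ω} (hindep : iIndep m μ)
    (hle : ∀ k, m' k ≤ m k) : iIndep m' μ :=
  (iIndep_iff _ μ).2 fun S _ hf => (iIndep_iff _ μ).1 hindep S fun k hk => hle k _ (hf k hk)

theorem indep_iSup_ne {κ : Type*} {m : κ → MeasurableSpace Ω} (hm : ∀ k, m k ≤ m₀)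
    (hindep : iIndep m μ) (k : κ) : Indep (m k) (⨆ l ≠ k, m l) μ := by
  simpa using indep_iSup_of_disjoint hm hindep (S := {k}) (T := {k}ᶜ) disjoint_compl_right

end Decoupling

section Model

variable {Ω ι : Type*} [MeasurableSpace Ω]

/-- The assumptions on a Wigner matrix `X` that enter the estimates, for entries of size `δ`. The
entries at distinct unordered positions are independent and centered, the off-diagonal entries `w`
satisfy `E |w|² = σ² δ²` and `E w² = τ δ²`, and `L` bounds the normalized moments of order up to
four off the diagonal and up to two on the diagonal. A real symmetric matrix has `τ = σ²`, a
Hermitian one `τ = 0`. -/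
structure IsWignerModel (μ : Measure Ω) (σ τ L δ : ℝ) (X : Ω → Matrix ι ι ℂ) : Prop where
  measurable_entry : ∀ i j, Measurable fun ω => X ω i j
  isHermitian : ∀ ω, (X ω).IsHermitian
  indep : iIndep (entrySigma X) μ
  scale_nonneg : 0 ≤ δ
  one_le : 1 ≤ L
  sq_le : σ ^ 2 ≤ L
  abs_le : |τ| ≤ L
  mean : ∀ i j, ∫ ω, X ω i j ∂μ = 0
  integral_norm_sq : ∀ i j, i ≠ j → ∫ ω, ‖X ω i j‖ ^ 2 ∂μ = σ ^ 2 * δ ^ 2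
  integral_sq : ∀ i j, i ≠ j → ∫ ω, X ω i j ^ 2 ∂μ = τ * δ ^ 2
  integrable_pow : ∀ i j, ∀ k ≤ 4, (k ≤ 2 ∨ i ≠ j) → Integrable (fun ω => ‖X ω i j‖ ^ k) μ
  moment_le : ∀ i j, ∀ k ≤ 4, (k ≤ 2 ∨ i ≠ j) → ∫ ω, ‖X ω i j‖ ^ k ∂μ ≤ L * δ ^ k

variable {μ : Measure Ω} {σ τ L δ : ℝ} {X : Ω → Matrix ι ι ℂ}

theorem IsWignerModel.smul (hX : IsWignerModel μ σ τ L δ X) {c : ℝ} (hc : 0 ≤ c) :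
    IsWignerModel μ σ τ L (c * δ) fun ω => (c : ℂ) • X ω where
  measurable_entry i j := (hX.measurable_entry i j).const_mul _
  isHermitian ω := by
    rw [Matrix.IsHermitian, Matrix.conjTranspose_smul, (hX.isHermitian ω).eq]
    simp
  indep := by
    refine iIndep_mono hX.indep fun s => entrySigma_le fun i j hs => ?_
    exact hs ▸ Measurable.const_mul (measurable_entrySigma X i j) _
  scale_nonneg := mul_nonneg hc hX.scale_nonneg
  one_le := hX.one_le
  sq_le := hX.sq_le
  abs_le := hX.abs_le
  mean i j := by
    simp only [Matrix.smul_apply, smul_eq_mul, integral_const_mul, hX.mean, mul_zero]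
  integral_norm_sq i j hij := by
    simp only [Matrix.smul_apply, norm_smul, mul_pow, integral_const_mul,
      hX.integral_norm_sq i j hij, Complex.norm_real, Real.norm_of_nonneg hc]
    ring
  integral_sq i j hij := by
    simp only [Matrix.smul_apply, smul_eq_mul, mul_pow, integral_const_mul,
      hX.integral_sq i j hij, Complex.ofReal_mul]
    ring
  integrable_pow i j k hk hij := by
    simpa only [Matrix.smul_apply, norm_smul, mul_pow] using
      (hX.integrable_pow i j k hk hij).const_mul _
  moment_le i j k hk hij := by
    simp only [Matrix.smul_apply, norm_smul, mul_pow, integral_const_mul, Complex.norm_real,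
      Real.norm_of_nonneg hc]
    rw [mul_left_comm]
    exact mul_le_mul_of_nonneg_left (hX.moment_le i j k hk hij) (by positivity)

namespace IsWignerModel

variable (hX : IsWignerModel μ σ τ L δ X)
include hX

theorem entrySigma_le (s : Sym2 ι) : entrySigma X s ≤ ‹MeasurableSpace Ω› :=
  WignerResolvent.entrySigma_le fun i j _ => hX.measurable_entry i j

theorem restSigma_le (s : Sym2 ι) : restSigma X s ≤ ‹MeasurableSpace Ω› :=
  iSup₂_le fun t _ => hX.entrySigma_le t

theorem integral_mul {𝕜 : Type*} [RCLike 𝕜] {s : Sym2 ι} {f g : Ω → 𝕜}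
    (hf : StronglyMeasurable[entrySigma X s] f) (hg : StronglyMeasurable[restSigma X s] g) :
    ∫ ω, f ω * g ω ∂μ = (∫ ω, f ω ∂μ) * ∫ ω, g ω ∂μ :=
  integral_mul_of_indep (hX.entrySigma_le s) (hX.restSigma_le s)
    (indep_iSup_ne hX.entrySigma_le hX.indep s) hf hg

theorem integral_norm_pow_mul_le {i j : ι} {k : ℕ} (hk : k ≤ 4) (hij : k ≤ 2 ∨ i ≠ j)
    {f : Ω → ℝ} (hf : StronglyMeasurable[restSigma X s(i, j)] f) (hf0 : 0 ≤ f) :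
    ∫ ω, ‖X ω i j‖ ^ k * f ω ∂μ ≤ L * δ ^ k * ∫ ω, f ω ∂μ := by
  have hmeas : StronglyMeasurable[entrySigma X s(i, j)] fun ω => ‖X ω i j‖ ^ k :=
    (measurable_entrySigma X i j).stronglyMeasurable.norm.pow k
  rw [hX.integral_mul hmeas hf]
  exact mul_le_mul_of_nonneg_right (hX.moment_le i j k hk hij) (integral_nonneg hf0)

theorem integrable_norm_pow_mul {i j : ι} {k : ℕ} (hk : k ≤ 4) (hij : k ≤ 2 ∨ i ≠ j)
    {f : Ω → ℝ} (hf : AEStronglyMeasurable f μ) {C : ℝ} (hC : ∀ ω, ‖f ω‖ ≤ C) :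
    Integrable (fun ω => ‖X ω i j‖ ^ k * f ω) μ :=
  (hX.integrable_pow i j k hk hij).mul_bdd hf (ae_of_all μ hC)

theorem integrable_pow_mul {i j : ι} {k : ℕ} (hk : k ≤ 4) (hij : k ≤ 2 ∨ i ≠ j) {f : Ω → ℂ}
    (hf : AEStronglyMeasurable f μ) {C : ℝ} (hC : ∀ ω, ‖f ω‖ ≤ C) :
    Integrable (fun ω => X ω i j ^ k * f ω) μ :=
  (Integrable.mono (hX.integrable_pow i j k hk hij)
    ((hX.measurable_entry i j).pow_const k).aestronglyMeasurable
    (ae_of_all μ fun ω => by simp)).mul_bdd hf (ae_of_all μ hC)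

theorem integral_norm_le (i j : ι) : ∫ ω, ‖X ω i j‖ ∂μ ≤ L * δ := by
  simpa using hX.moment_le i j 1 (by norm_num) (.inl (by norm_num))

theorem integrable_norm (i j : ι) : Integrable (fun ω => ‖X ω i j‖) μ := by
  simpa using hX.integrable_pow i j 1 (by norm_num) (.inl (by norm_num))

theorem integrable_mul {i j : ι} {f : Ω → ℂ} (hf : AEStronglyMeasurable f μ) {C : ℝ}
    (hC : ∀ ω, ‖f ω‖ ≤ C) : Integrable (fun ω => X ω i j * f ω) μ := by
  simpa only [pow_one] using hX.integrable_pow_mul (k := 1) (by norm_num) (.inl (by norm_num)) hf hC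

theorem integral_expansion {i j : ι} (hij : i ≠ j) {f g h : Ω → ℂ} {B C D : ℝ}
    (hf : StronglyMeasurable[restSigma X s(i, j)] f) (hfB : ∀ ω, ‖f ω‖ ≤ B)
    (hg : StronglyMeasurable[restSigma X s(i, j)] g) (hgC : ∀ ω, ‖g ω‖ ≤ C)
    (hh : StronglyMeasurable[restSigma X s(i, j)] h) (hhD : ∀ ω, ‖h ω‖ ≤ D) :
    Integrable (fun ω => X ω i j * f ω +
        (X ω i j ^ 2 * g ω + ((‖X ω i j‖ ^ 2 : ℝ) : ℂ) * h ω)) μ ∧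
      ∫ ω, (X ω i j * f ω + (X ω i j ^ 2 * g ω + ((‖X ω i j‖ ^ 2 : ℝ) : ℂ) * h ω)) ∂μ =
        τ * δ ^ 2 * ∫ ω, g ω ∂μ + σ ^ 2 * δ ^ 2 * ∫ ω, h ω ∂μ := by
  have hle := hX.restSigma_le s(i, j)
  have hmeas := measurable_entrySigma X i j
  have hf_int : Integrable (fun ω => X ω i j * f ω) μ :=
    hX.integrable_mul (hf.mono hle).aestronglyMeasurable hfB
  have hg_int : Integrable (fun ω => X ω i j ^ 2 * g ω) μ :=
    hX.integrable_pow_mul (by norm_num) (.inl le_rfl) (hg.mono hle).aestronglyMeasurable hgC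
  have hh_int : Integrable (fun ω => ((‖X ω i j‖ ^ 2 : ℝ) : ℂ) * h ω) μ :=
    (hX.integrable_pow i j 2 (by norm_num) (.inl le_rfl)).ofReal.mul_bdd
      (hh.mono hle).aestronglyMeasurable (ae_of_all μ hhD)
  have hnorm : StronglyMeasurable[entrySigma X s(i, j)] fun ω => ((‖X ω i j‖ ^ 2 : ℝ) : ℂ) :=
    Complex.continuous_ofReal.comp_stronglyMeasurable (hmeas.stronglyMeasurable.norm.pow 2)
  have hgh_int := hg_int.fun_add hh_int
  refine ⟨hf_int.add hgh_int, ?_⟩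
  rw [integral_add hf_int hgh_int, integral_add hg_int hh_int,
    hX.integral_mul hmeas.stronglyMeasurable hf, hX.mean,
    hX.integral_mul (hmeas.pow_const 2).stronglyMeasurable hg, hX.integral_sq i j hij,
    hX.integral_mul hnorm hh, integral_complex_ofReal, hX.integral_norm_sq i j hij]
  push_cast
  ring

variable [Fintype ι] [DecidableEq ι] {z : ℂ}

theorem stronglyMeasurable_resolventVec (hz : z.im ≠ 0) (v : EuclideanSpace ℂ ι) (k : ι) :
    StronglyMeasurable fun ω => resolventVec (X ω) z v k :=
  WignerResolvent.stronglyMeasurable_resolventVec hX.measurable_entry hX.isHermitian hz v k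

theorem memLp_inner_resolventVec [IsFiniteMeasure μ] (hz : z.im ≠ 0) (u v : EuclideanSpace ℂ ι)
    (p : ENNReal) : MemLp (fun ω => inner ℂ u (resolventVec (X ω) z v)) p μ :=
  WignerResolvent.memLp_inner_resolventVec hX.measurable_entry hX.isHermitian hz u v p

theorem memLp_inner_resolventVec_zeroOut [IsFiniteMeasure μ] (hz : z.im ≠ 0)
    (u v : EuclideanSpace ℂ ι) (s : Sym2 ι) (p : ENNReal) :
    MemLp (fun ω => inner ℂ u (resolventVec (zeroOut (X ω) s) z v)) p μ :=
  WignerResolvent.memLp_inner_resolventVec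
    (fun i j => (measurable_zeroOut_restSigma X s i j).mono (hX.restSigma_le s) le_rfl)
    (fun ω => isHermitian_zeroOut (hX.isHermitian ω) s) hz u v p

end IsWignerModel

end Model

/-! ### The variance of resolvent forms -/

section Variance

open scoped ComplexConjugate InnerProductSpace

theorem sum_sym2_le_sum_sum {ι : Type*} [Fintype ι] {f : Sym2 ι → ℝ}
    (hf : ∀ s, 0 ≤ f s) : ∑ s, f s ≤ ∑ i, ∑ j, f s(i, j) := by
  classical
  rw [← Fintype.sum_prod_type' (f := fun i j => f s(i, j)),
    ← Finset.sum_fiberwise (s := Finset.univ) (g := fun p : ι × ι => s(p.1, p.2))]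
  refine Finset.sum_le_sum fun s _ => ?_
  induction s with
  | _ i j =>
    have hmem : (i, j) ∈ Finset.univ.filter fun p : ι × ι => s(p.1, p.2) = s(i, j) := by simp
    exact Finset.single_le_sum (f := fun p : ι × ι => f s(p.1, p.2)) (fun p _ => hf _) hmem

theorem sum_pairNorm_sq_le {ι : Type*} [Fintype ι] (w : EuclideanSpace ℂ ι) :
    ∑ i, ∑ j, pairNorm w i j ^ 2 ≤ 4 * Fintype.card ι * ‖w‖ ^ 2 := by
  calc ∑ i, ∑ j, pairNorm w i j ^ 2 ≤ ∑ i, ∑ j, 2 * (‖w i‖ ^ 2 + ‖w j‖ ^ 2) :=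
        Finset.sum_le_sum fun i _ => Finset.sum_le_sum fun j _ => add_sq_le
    _ = 4 * Fintype.card ι * ‖w‖ ^ 2 := by
        simp only [← Finset.mul_sum, Finset.sum_add_distrib, Finset.sum_const, Finset.card_univ,
          EuclideanSpace.norm_sq_eq, nsmul_eq_mul]
        ring

theorem sum_pairNorm_diag_sq {ι : Type*} [Fintype ι] (w : EuclideanSpace ℂ ι) :
    ∑ i, pairNorm w i i ^ 2 = 4 * ‖w‖ ^ 2 := by
  rw [EuclideanSpace.norm_sq_eq, Finset.mul_sum]
  exact Finset.sum_congr rfl fun i _ => by rw [pairNorm]; ring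

theorem sum_crossNorm_sq_le {ι : Type*} [Fintype ι] (p q : EuclideanSpace ℂ ι) :
    ∑ i, ∑ j, crossNorm p q i j ^ 2 ≤ 4 * ‖p‖ ^ 2 * ‖q‖ ^ 2 := by
  calc ∑ i, ∑ j, crossNorm p q i j ^ 2
      ≤ ∑ i, ∑ j, 2 * (‖p i‖ ^ 2 * ‖q j‖ ^ 2 + ‖p j‖ ^ 2 * ‖q i‖ ^ 2) :=
        Finset.sum_le_sum fun i _ => Finset.sum_le_sum fun j _ =>
          add_sq_le.trans_eq (by rw [mul_pow, mul_pow])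
    _ = 4 * ‖p‖ ^ 2 * ‖q‖ ^ 2 := by
        simp only [← Finset.mul_sum, Finset.sum_add_distrib, ← Finset.sum_mul,
          EuclideanSpace.norm_sq_eq]
        ring

variable {Ω ι : Type*} [MeasurableSpace Ω] {μ : Measure Ω} [Fintype ι] [DecidableEq ι]
  {σ τ L δ : ℝ} {X : Ω → Matrix ι ι ℂ} {z : ℂ} {u v : EuclideanSpace ℂ ι}

theorem integral_le_of_forall_le [IsProbabilityMeasure μ] {f : Ω → ℝ} {c : ℝ}
    (hf : ∀ ω, 0 ≤ f ω) (hc : ∀ ω, f ω ≤ c) : ∫ ω, f ω ∂μ ≤ c :=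
  (integral_mono_of_nonneg (ae_of_all μ hf) (integrable_const c) (ae_of_all μ hc)).trans_eq
    (by simp)

theorem norm_pairNorm_resolventVec_sq_le {X : Matrix ι ι ℂ} (hX : X.IsHermitian) (hz : z.im ≠ 0)
    (hv : ‖v‖ ≤ 1) (i j : ι) : ‖pairNorm (resolventVec X z v) i j ^ 2‖ ≤ (2 * |z.im|⁻¹) ^ 2 := by
  rw [Real.norm_of_nonneg (sq_nonneg _)]
  gcongr
  · exact pairNorm_nonneg _ i j
  · exact pairNorm_resolventVec_le hX hz hv i j

theorem norm_crossNorm_resolventVec_sq_le {X : Matrix ι ι ℂ} (hX : X.IsHermitian) (hz : z.im ≠ 0)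
    (hu : ‖u‖ ≤ 1) (hv : ‖v‖ ≤ 1) (i j : ι) :
    ‖crossNorm (resolventVec X (conj z) u) (resolventVec X z v) i j ^ 2‖ ≤
      (|z.im|⁻¹ * (2 * |z.im|⁻¹)) ^ 2 := by
  rw [Real.norm_of_nonneg (sq_nonneg _)]
  gcongr
  · exact crossNorm_nonneg _ _ i j
  · refine (crossNorm_le_mul_pairNorm (fun k => ?_) _ i j).trans
      (mul_le_mul_of_nonneg_left (pairNorm_resolventVec_le hX hz hv i j) (by positivity))
    simpa using norm_resolventVec_apply_le hX (z := conj z) (by simpa using hz) hu k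

namespace IsWignerModel

theorem integrable_norm_pow_mul_pairNorm_zeroOut_sq (hX : IsWignerModel μ σ τ L δ X)
    (hz : z.im ≠ 0) (hv : ‖v‖ ≤ 1) {i j : ι} {k : ℕ} (hk : k ≤ 4) (hij : k ≤ 2 ∨ i ≠ j) :
    Integrable (fun ω => ‖X ω i j‖ ^ k *
      pairNorm (resolventVec (zeroOut (X ω) s(i, j)) z v) i j ^ 2) μ :=
  hX.integrable_norm_pow_mul hk hij
    (((stronglyMeasurable_pairNorm
      (stronglyMeasurable_resolventVec_zeroOut hX.isHermitian hz v _) i j).pow 2).mono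
        (hX.restSigma_le _)).aestronglyMeasurable
    fun ω => norm_pairNorm_resolventVec_sq_le (isHermitian_zeroOut (hX.isHermitian ω) _) hz hv i j

theorem integrable_norm_pow_mul_crossNorm_zeroOut_sq (hX : IsWignerModel μ σ τ L δ X)
    (hz : z.im ≠ 0) (hu : ‖u‖ ≤ 1) (hv : ‖v‖ ≤ 1) {i j : ι} {k : ℕ} (hk : k ≤ 4)
    (hij : k ≤ 2 ∨ i ≠ j) :
    Integrable (fun ω => ‖X ω i j‖ ^ k *
      crossNorm (resolventVec (zeroOut (X ω) s(i, j)) (conj z) u)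
        (resolventVec (zeroOut (X ω) s(i, j)) z v) i j ^ 2) μ :=
  hX.integrable_norm_pow_mul hk hij
    (((stronglyMeasurable_crossNorm
      (stronglyMeasurable_resolventVec_zeroOut hX.isHermitian (by simpa using hz) u _)
      (stronglyMeasurable_resolventVec_zeroOut hX.isHermitian hz v _) i j).pow 2).mono
        (hX.restSigma_le _)).aestronglyMeasurable
    fun ω => norm_crossNorm_resolventVec_sq_le (isHermitian_zeroOut (hX.isHermitian ω) _)
      hz hu hv i j

variable (hX : IsWignerModel μ σ τ L δ X)
include hX

theorem integral_norm_pow_mul_pairNorm_zeroOut_sq_le (hz : z.im ≠ 0) {i j : ι} {k : ℕ}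
    (hk : k ≤ 4) (hij : k ≤ 2 ∨ i ≠ j) :
    ∫ ω, ‖X ω i j‖ ^ k * pairNorm (resolventVec (zeroOut (X ω) s(i, j)) z v) i j ^ 2 ∂μ ≤
      L * δ ^ k * ∫ ω, pairNorm (resolventVec (zeroOut (X ω) s(i, j)) z v) i j ^ 2 ∂μ :=
  hX.integral_norm_pow_mul_le hk hij ((stronglyMeasurable_pairNorm
    (stronglyMeasurable_resolventVec_zeroOut hX.isHermitian hz v _) i j).pow 2)
    fun _ => sq_nonneg _

theorem integral_norm_sq_mul_crossNorm_zeroOut_sq_le (hz : z.im ≠ 0) (i j : ι) :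
    ∫ ω, ‖X ω i j‖ ^ 2 * crossNorm (resolventVec (zeroOut (X ω) s(i, j)) (conj z) u)
        (resolventVec (zeroOut (X ω) s(i, j)) z v) i j ^ 2 ∂μ ≤
      L * δ ^ 2 * ∫ ω, crossNorm (resolventVec (zeroOut (X ω) s(i, j)) (conj z) u)
        (resolventVec (zeroOut (X ω) s(i, j)) z v) i j ^ 2 ∂μ :=
  hX.integral_norm_pow_mul_le (by norm_num) (.inl le_rfl) ((stronglyMeasurable_crossNorm
    (stronglyMeasurable_resolventVec_zeroOut hX.isHermitian (by simpa using hz) u _)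
    (stronglyMeasurable_resolventVec_zeroOut hX.isHermitian hz v _) i j).pow 2)
    fun _ => sq_nonneg _

variable [IsProbabilityMeasure μ]

theorem integrable_pairNorm_sq (hz : z.im ≠ 0) (hv : ‖v‖ ≤ 1) (i j : ι) :
    Integrable (fun ω => pairNorm (resolventVec (X ω) z v) i j ^ 2) μ :=
  .of_bound ((stronglyMeasurable_pairNorm (hX.stronglyMeasurable_resolventVec hz v) i j).pow
    2).aestronglyMeasurable _
    (ae_of_all _ fun ω => norm_pairNorm_resolventVec_sq_le (hX.isHermitian ω) hz hv i j)

theorem integrable_crossNorm_sq (hz : z.im ≠ 0) (hu : ‖u‖ ≤ 1) (hv : ‖v‖ ≤ 1) (i j : ι) :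
    Integrable (fun ω =>
      crossNorm (resolventVec (X ω) (conj z) u) (resolventVec (X ω) z v) i j ^ 2) μ :=
  .of_bound ((stronglyMeasurable_crossNorm
    (hX.stronglyMeasurable_resolventVec (by simpa using hz) u)
    (hX.stronglyMeasurable_resolventVec hz v) i j).pow 2).aestronglyMeasurable _
    (ae_of_all _ fun ω => norm_crossNorm_resolventVec_sq_le (hX.isHermitian ω) hz hu hv i j)

theorem integral_pairNorm_zeroOut_sq_le (hz : z.im ≠ 0) (hv : ‖v‖ ≤ 1) (i j : ι) :
    ∫ ω, pairNorm (resolventVec (zeroOut (X ω) s(i, j)) z v) i j ^ 2 ∂μ ≤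
      2 * ∫ ω, pairNorm (resolventVec (X ω) z v) i j ^ 2 ∂μ +
        32 * |z.im|⁻¹ ^ 4 * (L * δ ^ 2) := by
  have hint := hX.integrable_pow i j 2 (by norm_num) (.inl le_rfl)
  have hS := hX.integrable_pairNorm_sq hz hv i j
  calc ∫ ω, pairNorm (resolventVec (zeroOut (X ω) s(i, j)) z v) i j ^ 2 ∂μ
      ≤ ∫ ω, (2 * pairNorm (resolventVec (X ω) z v) i j ^ 2 +
          32 * |z.im|⁻¹ ^ 4 * ‖X ω i j‖ ^ 2) ∂μ :=
        integral_mono_of_nonneg (ae_of_all _ fun _ => sq_nonneg _)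
          ((hS.const_mul _).add (hint.const_mul _))
          (ae_of_all _ fun ω => pairNorm_zeroOut_sq_le (hX.isHermitian ω) hz hv i j)
    _ = 2 * ∫ ω, pairNorm (resolventVec (X ω) z v) i j ^ 2 ∂μ +
          32 * |z.im|⁻¹ ^ 4 * ∫ ω, ‖X ω i j‖ ^ 2 ∂μ := by
        rw [integral_add (hS.const_mul _) (hint.const_mul _), integral_const_mul,
          integral_const_mul]
    _ ≤ _ := by
        gcongr
        exact hX.moment_le i j 2 (by norm_num) (.inl le_rfl)

theorem integral_crossNorm_zeroOut_sq_le (hz : z.im ≠ 0) (hu : ‖u‖ ≤ 1) (hv : ‖v‖ ≤ 1)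
    (i j : ι) :
    ∫ ω, crossNorm (resolventVec (zeroOut (X ω) s(i, j)) (conj z) u)
        (resolventVec (zeroOut (X ω) s(i, j)) z v) i j ^ 2 ∂μ ≤
      2 * ∫ ω, crossNorm (resolventVec (X ω) (conj z) u) (resolventVec (X ω) z v) i j ^ 2 ∂μ +
        16 * |z.im|⁻¹ ^ 4 * (L * δ ^ 2 *
          (∫ ω, pairNorm (resolventVec (zeroOut (X ω) s(i, j)) (conj z) u) i j ^ 2 ∂μ +
            ∫ ω, pairNorm (resolventVec (zeroOut (X ω) s(i, j)) z v) i j ^ 2 ∂μ)) := by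
  have hz' : (conj z).im ≠ 0 := by simpa using hz
  have hc := (hX.integrable_crossNorm_sq hz hu hv i j).const_mul 2
  have ha := hX.integrable_norm_pow_mul_pairNorm_zeroOut_sq hz' hu (i := i) (j := j) (k := 2)
    (by norm_num) (.inl le_rfl)
  have hb := hX.integrable_norm_pow_mul_pairNorm_zeroOut_sq hz hv (i := i) (j := j) (k := 2)
    (by norm_num) (.inl le_rfl)
  have hab := (ha.add hb).const_mul (16 * |z.im|⁻¹ ^ 4)
  refine (integral_mono_of_nonneg (ae_of_all _ fun _ => sq_nonneg _) (hc.add hab) (ae_of_all _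
    fun ω => (crossNorm_zeroOut_sq_le (hX.isHermitian ω) hz hu hv i j).trans_eq
      (by rw [mul_add (‖X ω i j‖ ^ 2)]; rfl))).trans ?_
  rw [integral_add' hc hab, integral_const_mul, integral_const_mul, integral_add' ha hb,
    mul_add (L * δ ^ 2)]
  gcongr
  · exact hX.integral_norm_pow_mul_pairNorm_zeroOut_sq_le hz' (by norm_num) (.inl le_rfl)
  · exact hX.integral_norm_pow_mul_pairNorm_zeroOut_sq_le hz (by norm_num) (.inl le_rfl)

theorem integral_norm_inner_sub_zeroOut_sq_le_of_ne (hz : z.im ≠ 0) (hu : ‖u‖ ≤ 1)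
    (hv : ‖v‖ ≤ 1) {i j : ι} (hij : i ≠ j) :
    ∫ ω, ‖⟪u, resolventVec (X ω) z v⟫_ℂ -
        ⟪u, resolventVec (zeroOut (X ω) s(i, j)) z v⟫_ℂ‖ ^ 2 ∂μ ≤
      4 * L * δ ^ 2 *
        ∫ ω, crossNorm (resolventVec (X ω) (conj z) u) (resolventVec (X ω) z v) i j ^ 2 ∂μ +
      80 * L ^ 2 * δ ^ 4 * |z.im|⁻¹ ^ 4 *
        (∫ ω, pairNorm (resolventVec (X ω) (conj z) u) i j ^ 2 ∂μ +
          ∫ ω, pairNorm (resolventVec (X ω) z v) i j ^ 2 ∂μ) +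
      2560 * L ^ 3 * δ ^ 6 * |z.im|⁻¹ ^ 8 := by
  have hz' : (conj z).im ≠ 0 := by simpa using hz
  have hy : |(conj z).im|⁻¹ = |z.im|⁻¹ := by simp
  have hL : 0 ≤ L := zero_le_one.trans hX.one_le
  have hc := (hX.integrable_norm_pow_mul_crossNorm_zeroOut_sq hz hu hv (i := i) (j := j) (k := 2)
    (by norm_num) (.inl le_rfl)).const_mul 2
  have ha := (hX.integrable_norm_pow_mul_pairNorm_zeroOut_sq hz' hu (i := i) (j := j) (k := 4)
    (by norm_num) (.inr hij)).const_mul (8 * |z.im|⁻¹ ^ 4)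
  have hmono := integral_mono_of_nonneg (ae_of_all _ fun _ => sq_nonneg _) (hc.add ha)
    (ae_of_all μ fun ω =>
      norm_inner_resolventVec_sub_zeroOut_sq_le (hX.isHermitian ω) hz hu hv i j)
  rw [integral_add' hc ha, integral_const_mul, integral_const_mul] at hmono
  have hc_le := hX.integral_norm_sq_mul_crossNorm_zeroOut_sq_le (u := u) (v := v) hz i j
  have ha_le := hX.integral_norm_pow_mul_pairNorm_zeroOut_sq_le (v := u) hz' (i := i) (j := j)
    (k := 4) (by norm_num) (.inr hij)
  have hc' := hX.integral_crossNorm_zeroOut_sq_le hz hu hv i j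
  have ha' := hX.integral_pairNorm_zeroOut_sq_le hz' hu i j
  have hb' := hX.integral_pairNorm_zeroOut_sq_le hz hv i j
  rw [hy] at ha'
  have hA : 0 ≤ ∫ ω, pairNorm (resolventVec (zeroOut (X ω) s(i, j)) (conj z) u) i j ^ 2 ∂μ :=
    integral_nonneg fun _ => sq_nonneg _
  have hB : 0 ≤ ∫ ω, pairNorm (resolventVec (zeroOut (X ω) s(i, j)) z v) i j ^ 2 ∂μ :=
    integral_nonneg fun _ => sq_nonneg _
  have hL1 : 0 ≤ L - 1 := sub_nonneg.2 hX.one_le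
  linear_combination hmono + 2 * hc_le + 8 * |z.im|⁻¹ ^ 4 * ha_le + 2 * L * δ ^ 2 * hc' +
    40 * L ^ 2 * δ ^ 4 * |z.im|⁻¹ ^ 4 * (ha' + hb') +
    8 * L * δ ^ 4 * |z.im|⁻¹ ^ 4 * ((L - 1) * hA + L * hB)

theorem integral_norm_inner_sub_zeroOut_diag_sq_le (hz : z.im ≠ 0) (hu : ‖u‖ ≤ 1)
    (hv : ‖v‖ ≤ 1) (i : ι) :
    ∫ ω, ‖⟪u, resolventVec (X ω) z v⟫_ℂ -
        ⟪u, resolventVec (zeroOut (X ω) s(i, i)) z v⟫_ℂ‖ ^ 2 ∂μ ≤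
      L * δ ^ 2 * |z.im|⁻¹ ^ 2 * (2 * ∫ ω, pairNorm (resolventVec (X ω) z v) i i ^ 2 ∂μ +
        32 * |z.im|⁻¹ ^ 4 * (L * δ ^ 2)) := by
  have hL : 0 ≤ L := zero_le_one.trans hX.one_le
  have hb := (hX.integrable_norm_pow_mul_pairNorm_zeroOut_sq hz hv (i := i) (j := i) (k := 2)
    (by norm_num) (.inl le_rfl)).const_mul (|z.im|⁻¹ ^ 2)
  have hmono := integral_mono_of_nonneg (ae_of_all _ fun _ => sq_nonneg _) hb
    (ae_of_all μ fun ω => (pow_le_pow_left₀ (norm_nonneg _)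
      (norm_inner_resolventVec_sub_zeroOut_le_pairNorm (v := v) (hX.isHermitian ω) hz hu i i)
        2).trans_eq (by ring))
  rw [integral_const_mul] at hmono
  have hb_le := hX.integral_norm_pow_mul_pairNorm_zeroOut_sq_le (v := v) hz (i := i) (j := i)
    (k := 2) (by norm_num) (.inl le_rfl)
  have hb' := hX.integral_pairNorm_zeroOut_sq_le hz hv i i
  linear_combination hmono + |z.im|⁻¹ ^ 2 * hb_le + |z.im|⁻¹ ^ 2 * L * δ ^ 2 * hb'

theorem sum_integral_pairNorm_sq_le (hz : z.im ≠ 0) (hv : ‖v‖ ≤ 1) :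
    ∑ i, ∑ j, ∫ ω, pairNorm (resolventVec (X ω) z v) i j ^ 2 ∂μ ≤
      4 * Fintype.card ι * |z.im|⁻¹ ^ 2 := by
  have hint := fun i j => hX.integrable_pairNorm_sq hz hv i j
  simp_rw [← integral_finsetSum _ fun j _ => hint _ j]
  rw [← integral_finsetSum _ fun i _ => integrable_finsetSum _ fun j _ => hint i j]
  refine integral_le_of_forall_le (fun ω => by positivity) fun ω => (sum_pairNorm_sq_le _).trans ?_
  gcongr
  exact norm_resolventVec_le_inv (hX.isHermitian ω) hz hv

theorem sum_integral_pairNorm_diag_sq_le (hz : z.im ≠ 0) (hv : ‖v‖ ≤ 1) :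
    ∑ i, ∫ ω, pairNorm (resolventVec (X ω) z v) i i ^ 2 ∂μ ≤ 4 * |z.im|⁻¹ ^ 2 := by
  rw [← integral_finsetSum _ fun i _ => hX.integrable_pairNorm_sq hz hv i i]
  refine integral_le_of_forall_le (fun ω => by positivity) fun ω =>
    (sum_pairNorm_diag_sq _).trans_le ?_
  gcongr
  exact norm_resolventVec_le_inv (hX.isHermitian ω) hz hv

theorem sum_integral_crossNorm_sq_le (hz : z.im ≠ 0) (hu : ‖u‖ ≤ 1) (hv : ‖v‖ ≤ 1) :
    ∑ i, ∑ j, ∫ ω, crossNorm (resolventVec (X ω) (conj z) u) (resolventVec (X ω) z v) i j ^ 2 ∂μ ≤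
      4 * |z.im|⁻¹ ^ 4 := by
  have hint := fun i j => hX.integrable_crossNorm_sq hz hu hv i j
  simp_rw [← integral_finsetSum _ fun j _ => hint _ j]
  rw [← integral_finsetSum _ fun i _ => integrable_finsetSum _ fun j _ => hint i j]
  refine integral_le_of_forall_le (fun ω => by positivity) fun ω =>
    (sum_crossNorm_sq_le _ _).trans ?_
  have ha := norm_resolventVec_le_inv (hX.isHermitian ω) (z := conj z) (by simpa using hz) hu
  have hb := norm_resolventVec_le_inv (hX.isHermitian ω) hz hv
  rw [Complex.conj_im, abs_neg] at ha
  calc 4 * ‖resolventVec (X ω) (conj z) u‖ ^ 2 * ‖resolventVec (X ω) z v‖ ^ 2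
      ≤ 4 * |z.im|⁻¹ ^ 2 * |z.im|⁻¹ ^ 2 := by gcongr
    _ = 4 * |z.im|⁻¹ ^ 4 := by ring

theorem complexVariance_inner_resolventVec_le_sum (hz : z.im ≠ 0) (u v : EuclideanSpace ℂ ι) :
    complexVariance μ (fun ω => ⟪u, resolventVec (X ω) z v⟫_ℂ) ≤
      ∑ i, ∑ j, ∫ ω, ‖⟪u, resolventVec (X ω) z v⟫_ℂ -
        ⟪u, resolventVec (zeroOut (X ω) s(i, j)) z v⟫_ℂ‖ ^ 2 ∂μ := by
  refine (complexVariance_le_sum_of_iIndep hX.entrySigma_le hX.indep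
    (g := fun s ω => ⟪u, resolventVec (zeroOut (X ω) s) z v⟫_ℂ) ?_
    (hX.memLp_inner_resolventVec hz u v 2) (fun s => ?_)
    fun s => hX.memLp_inner_resolventVec_zeroOut hz u v s 2).trans
    (sum_sym2_le_sum_sum fun s => integral_nonneg fun _ => sq_nonneg _)
  · exact stronglyMeasurable_inner_left (WignerResolvent.stronglyMeasurable_resolventVec
      (fun i j => (measurable_entrySigma X i j).mono (le_iSup _ _) le_rfl) hX.isHermitian hz v) u
  · exact stronglyMeasurable_inner_left
      (stronglyMeasurable_resolventVec_zeroOut hX.isHermitian hz v s) u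

theorem integral_norm_inner_sub_zeroOut_sq_le (hz : z.im ≠ 0) (hu : ‖u‖ ≤ 1) (hv : ‖v‖ ≤ 1)
    (i j : ι) :
    ∫ ω, ‖⟪u, resolventVec (X ω) z v⟫_ℂ -
        ⟪u, resolventVec (zeroOut (X ω) s(i, j)) z v⟫_ℂ‖ ^ 2 ∂μ ≤
      (4 * L * δ ^ 2 *
        ∫ ω, crossNorm (resolventVec (X ω) (conj z) u) (resolventVec (X ω) z v) i j ^ 2 ∂μ +
      80 * L ^ 2 * δ ^ 4 * |z.im|⁻¹ ^ 4 *
        (∫ ω, pairNorm (resolventVec (X ω) (conj z) u) i j ^ 2 ∂μ +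
          ∫ ω, pairNorm (resolventVec (X ω) z v) i j ^ 2 ∂μ) +
      2560 * L ^ 3 * δ ^ 6 * |z.im|⁻¹ ^ 8) +
      if i = j then L * δ ^ 2 * |z.im|⁻¹ ^ 2 *
        (2 * ∫ ω, pairNorm (resolventVec (X ω) z v) i i ^ 2 ∂μ +
          32 * |z.im|⁻¹ ^ 4 * (L * δ ^ 2)) else 0 := by
  have hL : 0 ≤ L := zero_le_one.trans hX.one_le
  split_ifs with hij
  · subst hij
    refine (hX.integral_norm_inner_sub_zeroOut_diag_sq_le hz hu hv i).trans
      (le_add_of_nonneg_left ?_)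
    positivity
  · rw [add_zero]
    exact hX.integral_norm_inner_sub_zeroOut_sq_le_of_ne hz hu hv hij

theorem complexVariance_inner_resolventVec_le (hcard : Fintype.card ι * δ ^ 2 = 1)
    (hz : z.im ≠ 0) (hu : ‖u‖ ≤ 1) (hv : ‖v‖ ≤ 1) :
    complexVariance μ (fun ω => ⟪u, resolventVec (X ω) z v⟫_ℂ) ≤
      2560 * L ^ 3 * δ ^ 2 * (|z.im|⁻¹ ^ 4 + |z.im|⁻¹ ^ 6 + |z.im|⁻¹ ^ 8) := by
  refine (hX.complexVariance_inner_resolventVec_le_sum hz u v).trans <|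
    (Finset.sum_le_sum fun i _ => Finset.sum_le_sum fun j _ =>
      hX.integral_norm_inner_sub_zeroOut_sq_le hz hu hv i j).trans ?_
  simp only [Finset.sum_add_distrib, Finset.sum_ite_eq, Finset.mem_univ, if_true,
    ← Finset.mul_sum, Finset.sum_const, Finset.card_univ, nsmul_eq_mul]
  have hc := hX.sum_integral_crossNorm_sq_le hz hu hv
  have ha := hX.sum_integral_pairNorm_sq_le (z := conj z) (by simpa using hz) hu
  have hb := hX.sum_integral_pairNorm_sq_le hz hv
  have hd := hX.sum_integral_pairNorm_diag_sq_le hz hv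
  rw [Complex.conj_im, abs_neg] at ha
  have hL : 0 ≤ L := zero_le_one.trans hX.one_le
  have hL3 : 0 ≤ L ^ 3 := by positivity
  have hL1 : L ≤ L ^ 3 := le_self_pow₀ hX.one_le (by norm_num)
  have hL2 : L ^ 2 ≤ L ^ 3 := pow_le_pow_right₀ hX.one_le (by norm_num)
  linear_combination 4 * L * δ ^ 2 * hc + 80 * L ^ 2 * δ ^ 4 * |z.im|⁻¹ ^ 4 * (ha + hb) +
    2 * L * δ ^ 2 * |z.im|⁻¹ ^ 2 * hd + 672 * L ^ 2 * δ ^ 2 * |z.im|⁻¹ ^ 6 * hcard +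
    2560 * L ^ 3 * δ ^ 2 * |z.im|⁻¹ ^ 8 * (Fintype.card ι * δ ^ 2 + 1) * hcard +
    24 * δ ^ 2 * |z.im|⁻¹ ^ 4 * hL1 + 672 * δ ^ 2 * |z.im|⁻¹ ^ 6 * hL2 +
    (2536 * δ ^ 2 * |z.im|⁻¹ ^ 4 + 1888 * δ ^ 2 * |z.im|⁻¹ ^ 6) * hL3

end IsWignerModel
end Variance

/-! ### Expansion of the resolvent in one entry -/

section Expansion

open scoped ComplexConjugate InnerProductSpace

variable {ι : Type*} [Fintype ι] [DecidableEq ι]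

/-- The entry at `(i, j)` of the resolvent `(z - X)⁻¹`. -/
noncomputable def resolventEntry (X : Matrix ι ι ℂ) (z : ℂ) (i j : ι) : ℂ :=
  resolventVec X z (EuclideanSpace.single j 1) i

section Deterministic

variable {X : Matrix ι ι ℂ} {z : ℂ} {v : EuclideanSpace ℂ ι}

theorem norm_left_le_pairNorm {ι : Type*} (w : EuclideanSpace ℂ ι) (i j : ι) :
    ‖w i‖ ≤ pairNorm w i j :=
  le_add_of_nonneg_right (norm_nonneg _)

theorem norm_right_le_pairNorm {ι : Type*} (w : EuclideanSpace ℂ ι) (i j : ι) :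
    ‖w j‖ ≤ pairNorm w i j :=
  le_add_of_nonneg_left (norm_nonneg _)

theorem norm_resolventEntry_le (hX : X.IsHermitian) (hz : z.im ≠ 0) (i j : ι) :
    ‖resolventEntry X z i j‖ ≤ |z.im|⁻¹ :=
  norm_resolventVec_apply_le hX hz (by simp) i

theorem conj_resolventEntry_conj (hX : X.IsHermitian) (i j : ι) :
    conj (resolventEntry X (conj z) i j) = resolventEntry X z j i := by
  simpa [resolventEntry, EuclideanSpace.inner_single_left, EuclideanSpace.inner_single_right] using
    (inner_resolventVec hX z (EuclideanSpace.single j 1) (EuclideanSpace.single i 1)).symm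

theorem norm_resolventVec_apply_sub_expansion_le (hX : X.IsHermitian) (hz : z.im ≠ 0) {i j : ι}
    (hij : i ≠ j) :
    ‖resolventVec X z v j - (resolventVec (zeroOut X s(i, j)) z v j +
      (resolventEntry (zeroOut X s(i, j)) z j i * X i j *
          resolventVec (zeroOut X s(i, j)) z v j +
        resolventEntry (zeroOut X s(i, j)) z j j * X j i *
          resolventVec (zeroOut X s(i, j)) z v i))‖ ≤
      2 * ‖X i j‖ ^ 2 * |z.im|⁻¹ ^ 2 * pairNorm (resolventVec (zeroOut X s(i, j)) z v) i j := by
  set X' := zeroOut X s(i, j) with hX'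
  have hherm : X'.IsHermitian := isHermitian_zeroOut hX _
  set a := resolventVec X' (conj z) (EuclideanSpace.single j 1) with ha
  set b := resolventVec X z v
  set b' := resolventVec X' z v
  have hfirst : ⟪a, Matrix.toEuclideanCLM (𝕜 := ℂ) (X - X') b'⟫_ℂ =
      resolventEntry X' z j i * X i j * b' j + resolventEntry X' z j j * X j i * b' i := by
    rw [hX', inner_sub_zeroOut_of_ne _ _ hij, ← hX', ← conj_resolventEntry_conj hherm i j,
      ← conj_resolventEntry_conj hherm j j]
    rfl
  have hfull : b j - b' j = ⟪a, Matrix.toEuclideanCLM (𝕜 := ℂ) (X - X') b⟫_ℂ := by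
    have h := inner_resolventVec_sub hherm hX hz (EuclideanSpace.single j 1) v
    rw [← neg_sub X, map_neg, neg_apply, inner_neg_right, ← ha] at h
    rw [← neg_eq_iff_eq_neg.2 h]
    simp [EuclideanSpace.inner_single_left, b, b']
  rw [← sub_sub, hfull, ← hfirst, ← inner_sub_right, ← map_sub]
  have happly (k : ι) : ‖a k‖ ≤ |z.im|⁻¹ := by
    simpa using norm_resolventVec_apply_le hherm (z := conj z) (by simpa using hz)
      (v := EuclideanSpace.single j 1) (by simp) k
  have hsub (k : ι) : ‖b k - b' k‖ ≤ ‖X i j‖ * |z.im|⁻¹ * pairNorm b' i j :=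
    norm_resolventVec_sub_zeroOut_apply_le hX hz i j k
  calc ‖⟪a, Matrix.toEuclideanCLM (𝕜 := ℂ) (X - X') (b - b')⟫_ℂ‖
      ≤ ‖X i j‖ * (|z.im|⁻¹ * (‖b i - b' i‖ + ‖b j - b' j‖)) :=
        (norm_inner_sub_zeroOut_le hX _ _ i j).trans <| mul_le_mul_of_nonneg_left
          (crossNorm_le_mul_pairNorm happly (b - b') i j) (norm_nonneg _)
    _ ≤ ‖X i j‖ * (|z.im|⁻¹ * (‖X i j‖ * |z.im|⁻¹ * pairNorm b' i j +
          ‖X i j‖ * |z.im|⁻¹ * pairNorm b' i j)) := by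
        gcongr <;> exact hsub _
    _ = 2 * ‖X i j‖ ^ 2 * |z.im|⁻¹ ^ 2 * pairNorm b' i j := by ring

theorem norm_mul_resolventVec_apply_sub_expansion_le (hX : X.IsHermitian) (hz : z.im ≠ 0)
    {i j : ι} (hij : i ≠ j) :
    ‖X i j * resolventVec X z v j - (X i j * resolventVec (zeroOut X s(i, j)) z v j +
      (X i j ^ 2 * (resolventEntry (zeroOut X s(i, j)) z j i *
          resolventVec (zeroOut X s(i, j)) z v j) +
        ((‖X i j‖ ^ 2 : ℝ) : ℂ) * (resolventEntry (zeroOut X s(i, j)) z j j *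
          resolventVec (zeroOut X s(i, j)) z v i)))‖ ≤
      2 * |z.im|⁻¹ ^ 2 *
        (‖X i j‖ ^ 3 * pairNorm (resolventVec (zeroOut X s(i, j)) z v) i j) := by
  have hnorm : ((‖X i j‖ ^ 2 : ℝ) : ℂ) = X i j * X j i := by
    rw [← hX.apply j i, RCLike.star_def, Complex.mul_conj, Complex.normSq_eq_norm_sq]
  have h := mul_le_mul_of_nonneg_left
    (norm_resolventVec_apply_sub_expansion_le (v := v) hX hz hij) (norm_nonneg (X i j))
  rw [← norm_mul] at h
  rw [hnorm]
  exact (congrArg _ (by ring)).trans_le (h.trans_eq (by ring))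

theorem norm_resolventEntry_mul_sub_zeroOut_le (hX : X.IsHermitian) (hz : z.im ≠ 0)
    {i j k : ι} (a l : ι)
    (hk : ‖resolventVec (zeroOut X s(i, j)) z v k‖ ≤
      pairNorm (resolventVec (zeroOut X s(i, j)) z v) i j) :
    ‖resolventEntry (zeroOut X s(i, j)) z a l * resolventVec (zeroOut X s(i, j)) z v k -
        resolventEntry X z a l * resolventVec X z v k‖ ≤
      3 * |z.im|⁻¹ ^ 2 *
        (‖X i j‖ ^ 1 * pairNorm (resolventVec (zeroOut X s(i, j)) z v) i j) := by
  have hherm : (zeroOut X s(i, j)).IsHermitian := isHermitian_zeroOut hX _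
  have hentry : ‖resolventEntry X z a l - resolventEntry (zeroOut X s(i, j)) z a l‖ ≤
      ‖X i j‖ * |z.im|⁻¹ * (2 * |z.im|⁻¹) :=
    (norm_resolventVec_sub_zeroOut_apply_le hX hz i j a).trans <|
      mul_le_mul_of_nonneg_left (pairNorm_resolventVec_le hherm hz (by simp) i j) (by positivity)
  have hvec := norm_resolventVec_sub_zeroOut_apply_le (v := v) hX hz i j k
  have hG := norm_resolventEntry_le hX hz a l
  rw [norm_sub_rev] at hentry hvec
  generalize resolventEntry (zeroOut X s(i, j)) z a l = G' at *
  generalize resolventEntry X z a l = G at *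
  generalize pairNorm (resolventVec (zeroOut X s(i, j)) z v) i j = S at *
  generalize resolventVec (zeroOut X s(i, j)) z v k = b' at *
  generalize resolventVec X z v k = b at *
  calc ‖G' * b' - G * b‖ = ‖(G' - G) * b' + G * (b' - b)‖ := by ring_nf
    _ ≤ ‖G' - G‖ * ‖b'‖ + ‖G‖ * ‖b' - b‖ := by
        rw [← norm_mul, ← norm_mul]; exact norm_add_le _ _
    _ ≤ ‖X i j‖ * |z.im|⁻¹ * (2 * |z.im|⁻¹) * S + |z.im|⁻¹ * (‖X i j‖ * |z.im|⁻¹ * S) := by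
        gcongr
    _ = 3 * |z.im|⁻¹ ^ 2 * (‖X i j‖ ^ 1 * S) := by ring

end Deterministic

section Expectation

variable {Ω : Type*} [MeasurableSpace Ω] {μ : Measure Ω} {σ τ L δ : ℝ} {X : Ω → Matrix ι ι ℂ}
  {z : ℂ} {u v : EuclideanSpace ℂ ι}

theorem norm_integral_sub_le {E : Type*} [NormedAddCommGroup E] [NormedSpace ℝ E] {f g : Ω → E}
    {h : Ω → ℝ} (hf : Integrable f μ) (hg : Integrable g μ) (hh : Integrable h μ)
    (hle : ∀ ω, ‖f ω - g ω‖ ≤ h ω) : ‖∫ ω, f ω ∂μ - ∫ ω, g ω ∂μ‖ ≤ ∫ ω, h ω ∂μ := by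
  rw [← integral_sub hf hg]
  exact norm_integral_le_of_norm_le hh (ae_of_all μ hle)

namespace IsWignerModel

variable (hX : IsWignerModel μ σ τ L δ X)
include hX

theorem stronglyMeasurable_resolventEntry (hz : z.im ≠ 0) (i j : ι) :
    StronglyMeasurable fun ω => resolventEntry (X ω) z i j :=
  hX.stronglyMeasurable_resolventVec hz _ i

theorem integrable_norm_pow_mul_pairNorm_zeroOut (hz : z.im ≠ 0) (hv : ‖v‖ ≤ 1) {i j : ι} {k : ℕ}
    (hk : k ≤ 4) (hij : k ≤ 2 ∨ i ≠ j) :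
    Integrable (fun ω => ‖X ω i j‖ ^ k *
      pairNorm (resolventVec (zeroOut (X ω) s(i, j)) z v) i j) μ :=
  hX.integrable_norm_pow_mul hk hij ((stronglyMeasurable_pairNorm
    (stronglyMeasurable_resolventVec_zeroOut hX.isHermitian hz v _) i j).mono
      (hX.restSigma_le _)).aestronglyMeasurable fun ω => by
    rw [Real.norm_of_nonneg (pairNorm_nonneg _ i j)]
    exact pairNorm_resolventVec_le (isHermitian_zeroOut (hX.isHermitian ω) _) hz hv i j

theorem integral_norm_pow_mul_pairNorm_zeroOut_le (hz : z.im ≠ 0) {i j : ι} {k : ℕ}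
    (hk : k ≤ 4) (hij : k ≤ 2 ∨ i ≠ j) :
    ∫ ω, ‖X ω i j‖ ^ k * pairNorm (resolventVec (zeroOut (X ω) s(i, j)) z v) i j ∂μ ≤
      L * δ ^ k * ∫ ω, pairNorm (resolventVec (zeroOut (X ω) s(i, j)) z v) i j ∂μ :=
  hX.integral_norm_pow_mul_le hk hij (stronglyMeasurable_pairNorm
    (stronglyMeasurable_resolventVec_zeroOut hX.isHermitian hz v _) i j)
    fun _ => pairNorm_nonneg _ i j

theorem norm_integral_mul_resolventVec_sub_zeroOut_le (hz : z.im ≠ 0) (hv : ‖v‖ ≤ 1) {i j : ι}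
    (hij : i ≠ j) :
    ‖∫ ω, X ω i j * resolventVec (X ω) z v j ∂μ -
      (τ * δ ^ 2 * ∫ ω, resolventEntry (zeroOut (X ω) s(i, j)) z j i *
          resolventVec (zeroOut (X ω) s(i, j)) z v j ∂μ +
        σ ^ 2 * δ ^ 2 * ∫ ω, resolventEntry (zeroOut (X ω) s(i, j)) z j j *
          resolventVec (zeroOut (X ω) s(i, j)) z v i ∂μ)‖ ≤
      2 * L * δ ^ 3 * |z.im|⁻¹ ^ 2 *
        ∫ ω, pairNorm (resolventVec (zeroOut (X ω) s(i, j)) z v) i j ∂μ := by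
  have hherm (ω : Ω) := isHermitian_zeroOut (hX.isHermitian ω) s(i, j)
  have hb (k : ι) := stronglyMeasurable_resolventVec_zeroOut hX.isHermitian hz v s(i, j) k
  have hGb (k l a : ι) : StronglyMeasurable[restSigma X s(i, j)] fun ω =>
      resolventEntry (zeroOut (X ω) s(i, j)) z k l * resolventVec (zeroOut (X ω) s(i, j)) z v a :=
    (stronglyMeasurable_resolventVec_zeroOut hX.isHermitian hz _ s(i, j) k).mul (hb a)
  have hbound (k l a : ι) (ω : Ω) : ‖resolventEntry (zeroOut (X ω) s(i, j)) z k l *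
      resolventVec (zeroOut (X ω) s(i, j)) z v a‖ ≤ |z.im|⁻¹ * |z.im|⁻¹ :=
    norm_mul_le_of_le (norm_resolventEntry_le (hherm ω) hz k l)
      (norm_resolventVec_apply_le (hherm ω) hz hv a)
  have hbj (ω : Ω) := norm_resolventVec_apply_le (hherm ω) hz hv j
  have hb_int : Integrable (fun ω => X ω i j * resolventVec (X ω) z v j) μ :=
    hX.integrable_mul (hX.stronglyMeasurable_resolventVec hz v j).aestronglyMeasurable
      fun ω => norm_resolventVec_apply_le (hX.isHermitian ω) hz hv j
  obtain ⟨hexp_int, hexp⟩ := hX.integral_expansion hij (hb j) hbj (hGb j i j) (hbound j i j)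
    (hGb j j i) (hbound j j i)
  rw [← hexp]
  refine (norm_integral_sub_le hb_int hexp_int
    ((hX.integrable_norm_pow_mul_pairNorm_zeroOut hz hv (by norm_num) (.inr hij)).const_mul _)
    fun ω => norm_mul_resolventVec_apply_sub_expansion_le (hX.isHermitian ω) hz hij).trans ?_
  rw [integral_const_mul]
  linear_combination 2 * |z.im|⁻¹ ^ 2 * hX.integral_norm_pow_mul_pairNorm_zeroOut_le (v := v) hz
    (i := i) (j := j) (k := 3) (by norm_num) (.inr hij)

variable [IsProbabilityMeasure μ]

theorem integrable_pairNorm (hz : z.im ≠ 0) (hv : ‖v‖ ≤ 1) (i j : ι) :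
    Integrable (fun ω => pairNorm (resolventVec (X ω) z v) i j) μ :=
  .of_bound (stronglyMeasurable_pairNorm (hX.stronglyMeasurable_resolventVec hz v)
    i j).aestronglyMeasurable _ <| ae_of_all _ fun ω => by
      rw [Real.norm_of_nonneg (pairNorm_nonneg _ i j)]
      exact pairNorm_resolventVec_le (hX.isHermitian ω) hz hv i j

theorem integrable_resolventEntry_mul (hz : z.im ≠ 0) (hv : ‖v‖ ≤ 1) (a l k : ι) :
    Integrable (fun ω => resolventEntry (X ω) z a l * resolventVec (X ω) z v k) μ :=
  .of_bound ((hX.stronglyMeasurable_resolventEntry hz a l).mul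
    (hX.stronglyMeasurable_resolventVec hz v k)).aestronglyMeasurable (|z.im|⁻¹ * |z.im|⁻¹) <|
      ae_of_all _ fun ω => norm_mul_le_of_le (norm_resolventEntry_le (hX.isHermitian ω) hz a l)
        (norm_resolventVec_apply_le (hX.isHermitian ω) hz hv k)

theorem integral_pairNorm_zeroOut_le (hz : z.im ≠ 0) (hv : ‖v‖ ≤ 1) (i j : ι) :
    ∫ ω, pairNorm (resolventVec (zeroOut (X ω) s(i, j)) z v) i j ∂μ ≤
      ∫ ω, pairNorm (resolventVec (X ω) z v) i j ∂μ + 4 * L * δ * |z.im|⁻¹ ^ 2 := by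
  have hS := hX.integrable_pairNorm hz hv i j
  have hx := (hX.integrable_norm i j).const_mul (4 * |z.im|⁻¹ ^ 2)
  calc ∫ ω, pairNorm (resolventVec (zeroOut (X ω) s(i, j)) z v) i j ∂μ
      ≤ ∫ ω, (pairNorm (resolventVec (X ω) z v) i j + 4 * |z.im|⁻¹ ^ 2 * ‖X ω i j‖) ∂μ :=
        integral_mono_of_nonneg (ae_of_all _ fun _ => pairNorm_nonneg _ i j) (hS.add hx)
          (ae_of_all _ fun ω => (pairNorm_zeroOut_le (hX.isHermitian ω) hz hv i j).trans_eq
            (by ring))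
    _ = ∫ ω, pairNorm (resolventVec (X ω) z v) i j ∂μ +
          4 * |z.im|⁻¹ ^ 2 * ∫ ω, ‖X ω i j‖ ∂μ := by
        rw [integral_add hS hx, integral_const_mul]
    _ ≤ _ := by
        linear_combination 4 * |z.im|⁻¹ ^ 2 * hX.integral_norm_le i j

theorem norm_integral_resolventEntry_mul_sub_zeroOut_le (hz : z.im ≠ 0) (hv : ‖v‖ ≤ 1)
    {i j k : ι} (a l : ι) (hk : ∀ w : EuclideanSpace ℂ ι, ‖w k‖ ≤ pairNorm w i j) :
    ‖∫ ω, resolventEntry (zeroOut (X ω) s(i, j)) z a l *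
          resolventVec (zeroOut (X ω) s(i, j)) z v k ∂μ -
        ∫ ω, resolventEntry (X ω) z a l * resolventVec (X ω) z v k ∂μ‖ ≤
      3 * L * δ * |z.im|⁻¹ ^ 2 *
        ∫ ω, pairNorm (resolventVec (zeroOut (X ω) s(i, j)) z v) i j ∂μ := by
  have hherm (ω : Ω) := isHermitian_zeroOut (hX.isHermitian ω) s(i, j)
  have hmeas (w : EuclideanSpace ℂ ι) (b : ι) :=
    (stronglyMeasurable_resolventVec_zeroOut hX.isHermitian hz w s(i, j) b).mono
      (hX.restSigma_le _)
  have hint' : Integrable (fun ω => resolventEntry (zeroOut (X ω) s(i, j)) z a l *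
      resolventVec (zeroOut (X ω) s(i, j)) z v k) μ :=
    .of_bound ((hmeas _ a).mul (hmeas v k)).aestronglyMeasurable (|z.im|⁻¹ * |z.im|⁻¹) <|
      ae_of_all _ fun ω => norm_mul_le_of_le (norm_resolventEntry_le (hherm ω) hz a l)
        (norm_resolventVec_apply_le (hherm ω) hz hv k)
  refine (norm_integral_sub_le hint' (hX.integrable_resolventEntry_mul hz hv a l k)
    ((hX.integrable_norm_pow_mul_pairNorm_zeroOut hz hv (by norm_num)
      (.inl (by norm_num))).const_mul _) fun ω =>
      norm_resolventEntry_mul_sub_zeroOut_le (hX.isHermitian ω) hz a l (hk _)).trans ?_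
  rw [integral_const_mul]
  linear_combination 3 * |z.im|⁻¹ ^ 2 * hX.integral_norm_pow_mul_pairNorm_zeroOut_le (v := v) hz
    (i := i) (j := j) (k := 1) (by norm_num) (.inl (by norm_num))

end IsWignerModel

end Expectation

end Expansion

/-! ### The expected resolvent equation -/

section MeanExpansion

open scoped ComplexConjugate InnerProductSpace

theorem sum_norm_mul_norm_le {ι : Type*} [Fintype ι] (p q : EuclideanSpace ℂ ι) :
    ∑ i, ‖p i‖ * ‖q i‖ ≤ ‖p‖ * ‖q‖ := by
  rw [EuclideanSpace.norm_eq, EuclideanSpace.norm_eq]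
  exact Real.sum_mul_le_sqrt_mul_sqrt _ _ _

theorem mul_sum_norm_le {ι : Type*} [Fintype ι] {δ : ℝ} (hcard : Fintype.card ι * δ ^ 2 = 1)
    (w : EuclideanSpace ℂ ι) : δ * ∑ i, ‖w i‖ ≤ ‖w‖ := by
  refine le_of_sq_le_sq ?_ (norm_nonneg w)
  calc (δ * ∑ i, ‖w i‖) ^ 2 = δ ^ 2 * (∑ i, ‖w i‖) ^ 2 := mul_pow _ _ _
    _ ≤ δ ^ 2 * (Fintype.card ι * ∑ i, ‖w i‖ ^ 2) := by
        gcongr; exact sq_sum_le_card_mul_sum_sq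
    _ = ‖w‖ ^ 2 := by rw [EuclideanSpace.norm_sq_eq]; linear_combination (∑ i, ‖w i‖ ^ 2) * hcard

theorem sq_mul_sum_norm_mul_pairNorm_le {ι : Type*} [Fintype ι] {δ : ℝ}
    (hδ : 0 ≤ δ) (hcard : Fintype.card ι * δ ^ 2 = 1) {u : EuclideanSpace ℂ ι} (hu : ‖u‖ ≤ 1)
    (w : EuclideanSpace ℂ ι) : δ ^ 2 * ∑ i, ∑ j, ‖u i‖ * pairNorm w i j ≤ 2 * ‖w‖ := by
  have hsum : ∑ i, ∑ j, ‖u i‖ * pairNorm w i j =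
      Fintype.card ι * ∑ i, ‖u i‖ * ‖w i‖ + (∑ i, ‖u i‖) * ∑ j, ‖w j‖ := by
    simp only [pairNorm, mul_add, Finset.sum_add_distrib, Finset.sum_const, Finset.card_univ,
      nsmul_eq_mul, Finset.mul_sum, Finset.sum_mul]
    rw [Finset.sum_comm (f := fun i j => ‖u i‖ * ‖w j‖)]
  have hprod : (δ * ∑ i, ‖u i‖) * (δ * ∑ j, ‖w j‖) ≤ 1 * ‖w‖ :=
    mul_le_mul ((mul_sum_norm_le hcard u).trans hu) (mul_sum_norm_le hcard w) (by positivity)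
      zero_le_one
  have hinner : ∑ i, ‖u i‖ * ‖w i‖ ≤ 1 * ‖w‖ :=
    (sum_norm_mul_norm_le u w).trans (by gcongr)
  rw [hsum]
  linear_combination hprod + hinner + (∑ i, ‖u i‖ * ‖w i‖) * hcard

theorem sum_mul_integral {Ω ι : Type*} [MeasurableSpace Ω] {μ : Measure Ω} [Fintype ι]
    {f : ι → ι → Ω → ℂ} (c : ι → ℂ) (hf : ∀ i j, Integrable (f i j) μ) :
    ∑ i, ∑ j, c i * ∫ ω, f i j ω ∂μ = ∫ ω, ∑ i, ∑ j, c i * f i j ω ∂μ := by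
  have hint (i j : ι) := (hf i j).const_mul (c i)
  rw [integral_finsetSum _ fun i _ => integrable_finsetSum _ fun j _ => hint i j]
  simp only [integral_finsetSum _ fun j _ => hint _ j, integral_const_mul]

section Model

variable {Ω ι : Type*} [MeasurableSpace Ω] {μ : Measure Ω} {σ τ L δ : ℝ} {X : Ω → Matrix ι ι ℂ}
  [Fintype ι] [DecidableEq ι] {z : ℂ} {u v : EuclideanSpace ℂ ι}

/-- The error in the second order expansion of `E [X i j * (R v) j]`, with `R` the resolvent of `X`:
for independent Gaussian entries the Stein identity gives the main term `τ δ² E [R j i * (R v) j] +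
σ² δ² E [R j j * (R v) i]` up to contributions of higher order in `δ`. -/
noncomputable def expansionError (μ : Measure Ω) (σ τ δ : ℝ) (X : Ω → Matrix ι ι ℂ) (z : ℂ)
    (v : EuclideanSpace ℂ ι) (i j : ι) : ℂ :=
  ∫ ω, X ω i j * resolventVec (X ω) z v j ∂μ -
    (τ * δ ^ 2 * ∫ ω, resolventEntry (X ω) z j i * resolventVec (X ω) z v j ∂μ +
      σ ^ 2 * δ ^ 2 * ∫ ω, resolventEntry (X ω) z j j * resolventVec (X ω) z v i ∂μ)

/-- The normalized trace of the resolvent `(z - X)⁻¹`. -/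
noncomputable def resolventTrace (X : Matrix ι ι ℂ) (z : ℂ) : ℂ :=
  (Fintype.card ι : ℂ)⁻¹ * ∑ k, resolventEntry X z k k

theorem mul_inner_resolventVec {X : Matrix ι ι ℂ} (hX : X.IsHermitian) (hz : z.im ≠ 0)
    (u v : EuclideanSpace ℂ ι) : z * ⟪u, resolventVec X z v⟫_ℂ =
      ⟪u, v⟫_ℂ + ∑ i, ∑ j, conj (u i) * (X i j * resolventVec X z v j) := by
  simp only [PiLp.inner_apply, RCLike.inner_apply', ← Finset.mul_sum]
  rw [Finset.mul_sum, ← Finset.sum_add_distrib]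
  refine Finset.sum_congr rfl fun i _ => ?_
  linear_combination conj (u i) * mul_resolventVec hX hz v i

theorem resolventTrace_mul_inner (hcard : Fintype.card ι * δ ^ 2 = 1) (X : Matrix ι ι ℂ) (z : ℂ)
    (u w : EuclideanSpace ℂ ι) : resolventTrace X z * ⟪u, w⟫_ℂ =
      δ ^ 2 * ∑ i, ∑ j, conj (u i) * (resolventEntry X z j j * w i) := by
  have hinv : (Fintype.card ι : ℂ)⁻¹ = δ ^ 2 :=
    inv_eq_of_mul_eq_one_right (mod_cast hcard)
  rw [resolventTrace, hinv, PiLp.inner_apply, mul_assoc, Finset.sum_mul_sum, Finset.sum_comm]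
  simp only [RCLike.inner_apply', mul_left_comm (conj _)]

/- The reason why `τ` plays no role in the limit: this sum is `O(√N)`, while its counterpart with
`R j j * (R v) i` is of order `N`. -/
theorem norm_sum_mul_resolventEntry_transpose_le {X : Matrix ι ι ℂ} (hX : X.IsHermitian)
    (hz : z.im ≠ 0) (u : EuclideanSpace ℂ ι) (hv : ‖v‖ ≤ 1) :
    ‖∑ i, ∑ j, conj (u i) * (resolventEntry X z j i * resolventVec X z v j)‖ ≤
      (∑ i, ‖u i‖) * |z.im|⁻¹ ^ 2 := by
  rw [Finset.sum_mul]
  refine norm_sum_le_of_le _ fun i _ => ?_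
  rw [← Finset.mul_sum, norm_mul, RCLike.norm_conj, sq]
  refine mul_le_mul_of_nonneg_left ?_ (norm_nonneg _)
  calc ‖∑ j, resolventEntry X z j i * resolventVec X z v j‖
      ≤ ∑ j, ‖resolventEntry X z j i‖ * ‖resolventVec X z v j‖ :=
        norm_sum_le_of_le _ fun j _ => (norm_mul _ _).le
    _ ≤ ‖resolventVec X z (EuclideanSpace.single i 1)‖ * ‖resolventVec X z v‖ :=
        sum_norm_mul_norm_le _ _
    _ ≤ |z.im|⁻¹ * |z.im|⁻¹ := by
        gcongr
        · exact norm_resolventVec_le_inv hX hz (by simp)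
        · exact norm_resolventVec_le_inv hX hz hv

theorem norm_covariance_combination_le (hτ : |τ| ≤ L) (hσ : σ ^ 2 ≤ L) {a b : ℂ} {c : ℝ}
    (ha : ‖a‖ ≤ c) (hb : ‖b‖ ≤ c) : ‖τ * δ ^ 2 * a + σ ^ 2 * δ ^ 2 * b‖ ≤ 2 * L * δ ^ 2 * c := by
  have hL : 0 ≤ L := (abs_nonneg τ).trans hτ
  calc ‖(τ : ℂ) * δ ^ 2 * a + σ ^ 2 * δ ^ 2 * b‖
      ≤ ‖(τ : ℂ) * δ ^ 2 * a‖ + ‖(σ : ℂ) ^ 2 * δ ^ 2 * b‖ := norm_add_le _ _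
    _ = |τ| * δ ^ 2 * ‖a‖ + σ ^ 2 * δ ^ 2 * ‖b‖ := by simp
    _ ≤ L * δ ^ 2 * c + L * δ ^ 2 * c := by gcongr
    _ = 2 * L * δ ^ 2 * c := by ring

namespace IsWignerModel

variable (hX : IsWignerModel μ σ τ L δ X)
include hX

theorem norm_integral_mul_resolventVec_diag_le (hz : z.im ≠ 0) (hv : ‖v‖ ≤ 1) (i : ι) :
    ‖∫ ω, X ω i i * resolventVec (X ω) z v i ∂μ‖ ≤ 2 * L * δ ^ 2 * |z.im|⁻¹ ^ 2 := by
  have hherm (ω : Ω) := isHermitian_zeroOut (hX.isHermitian ω) s(i, i)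
  have hmeas := stronglyMeasurable_resolventVec_zeroOut hX.isHermitian hz v s(i, i) i
  have hint : Integrable (fun ω => X ω i i * resolventVec (X ω) z v i) μ :=
    hX.integrable_mul (hX.stronglyMeasurable_resolventVec hz v i).aestronglyMeasurable
      fun ω => norm_resolventVec_apply_le (hX.isHermitian ω) hz hv i
  have hint' : Integrable (fun ω => X ω i i * resolventVec (zeroOut (X ω) s(i, i)) z v i) μ :=
    hX.integrable_mul (hmeas.mono (hX.restSigma_le _)).aestronglyMeasurable
      fun ω => norm_resolventVec_apply_le (hherm ω) hz hv i
  have hzero : ∫ ω, X ω i i * resolventVec (zeroOut (X ω) s(i, i)) z v i ∂μ = 0 := by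
    rw [hX.integral_mul (measurable_entrySigma X i i).stronglyMeasurable hmeas, hX.mean, zero_mul]
  have hle (ω : Ω) : ‖X ω i i * resolventVec (X ω) z v i -
      X ω i i * resolventVec (zeroOut (X ω) s(i, i)) z v i‖ ≤
        2 * |z.im|⁻¹ ^ 2 * ‖X ω i i‖ ^ 2 := by
    rw [← mul_sub, norm_mul]
    calc _ ≤ ‖X ω i i‖ * (‖X ω i i‖ * |z.im|⁻¹ * (2 * |z.im|⁻¹)) := by
          gcongr
          exact (norm_resolventVec_sub_zeroOut_apply_le (hX.isHermitian ω) hz i i i).trans <|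
            mul_le_mul_of_nonneg_left (pairNorm_resolventVec_le (hherm ω) hz hv i i) (by positivity)
      _ = _ := by ring
  have h := norm_integral_sub_le hint hint'
    ((hX.integrable_pow i i 2 (by norm_num) (.inl le_rfl)).const_mul _) hle
  rw [hzero, sub_zero, integral_const_mul] at h
  linear_combination h + 2 * |z.im|⁻¹ ^ 2 * hX.moment_le i i 2 (by norm_num) (.inl le_rfl)

variable [IsProbabilityMeasure μ]

theorem norm_expansionError_le_of_ne (hz : z.im ≠ 0) (hv : ‖v‖ ≤ 1) {i j : ι} (hij : i ≠ j) :
    ‖expansionError μ σ τ δ X z v i j‖ ≤ 8 * L ^ 2 * δ ^ 3 * |z.im|⁻¹ ^ 2 *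
      ∫ ω, pairNorm (resolventVec (X ω) z v) i j ∂μ + 32 * L ^ 3 * δ ^ 4 * |z.im|⁻¹ ^ 4 := by
  have hδ := hX.scale_nonneg
  have hL := hX.one_le
  have hremainder := hX.norm_integral_mul_resolventVec_sub_zeroOut_le hz hv hij
  have hmain := norm_covariance_combination_le (δ := δ) hX.abs_le hX.sq_le
    (hX.norm_integral_resolventEntry_mul_sub_zeroOut_le (k := j) hz hv j i
      fun w => norm_right_le_pairNorm w i j)
    (hX.norm_integral_resolventEntry_mul_sub_zeroOut_le (k := i) hz hv j j
      fun w => norm_left_le_pairNorm w i j)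
  have hS := hX.integral_pairNorm_zeroOut_le hz hv i j
  have hS0 : 0 ≤ ∫ ω, pairNorm (resolventVec (zeroOut (X ω) s(i, j)) z v) i j ∂μ :=
    integral_nonneg fun _ => pairNorm_nonneg _ i j
  calc ‖expansionError μ σ τ δ X z v i j‖
      ≤ (2 * L + 6 * L ^ 2) * δ ^ 3 * |z.im|⁻¹ ^ 2 *
          ∫ ω, pairNorm (resolventVec (zeroOut (X ω) s(i, j)) z v) i j ∂μ := by
        refine le_trans (le_of_eq ?_) ((norm_add_le_of_le hremainder hmain).trans_eq (by ring))
        congr 1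
        rw [expansionError]
        ring
    _ ≤ 8 * L ^ 2 * δ ^ 3 * |z.im|⁻¹ ^ 2 *
          (∫ ω, pairNorm (resolventVec (X ω) z v) i j ∂μ + 4 * L * δ * |z.im|⁻¹ ^ 2) := by
        gcongr
        nlinarith
    _ = _ := by ring

theorem norm_expansionError_diag_le (hz : z.im ≠ 0) (hv : ‖v‖ ≤ 1) (i : ι) :
    ‖expansionError μ σ τ δ X z v i i‖ ≤ 4 * L * δ ^ 2 * |z.im|⁻¹ ^ 2 := by
  have hprod : ‖∫ ω, resolventEntry (X ω) z i i * resolventVec (X ω) z v i ∂μ‖ ≤ |z.im|⁻¹ ^ 2 := by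
    rw [sq]
    simpa using norm_integral_le_of_norm_le_const (μ := μ) <| ae_of_all μ fun ω =>
      norm_mul_le_of_le (norm_resolventEntry_le (hX.isHermitian ω) hz i i)
        (norm_resolventVec_apply_le (hX.isHermitian ω) hz hv i)
  exact (norm_sub_le_of_le (hX.norm_integral_mul_resolventVec_diag_le hz hv i)
    (norm_covariance_combination_le (δ := δ) hX.abs_le hX.sq_le hprod hprod)).trans_eq (by ring)

theorem norm_expansionError_le (hz : z.im ≠ 0) (hv : ‖v‖ ≤ 1) (i j : ι) :
    ‖expansionError μ σ τ δ X z v i j‖ ≤ 8 * L ^ 2 * δ ^ 3 * |z.im|⁻¹ ^ 2 *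
      ∫ ω, pairNorm (resolventVec (X ω) z v) i j ∂μ + 32 * L ^ 3 * δ ^ 4 * |z.im|⁻¹ ^ 4 +
        if i = j then 4 * L * δ ^ 2 * |z.im|⁻¹ ^ 2 else 0 := by
  have hδ := hX.scale_nonneg
  have hL := zero_le_one.trans hX.one_le
  split_ifs with hij
  · subst hij
    have hS : 0 ≤ ∫ ω, pairNorm (resolventVec (X ω) z v) i i ∂μ :=
      integral_nonneg fun _ => pairNorm_nonneg _ i i
    exact (hX.norm_expansionError_diag_le hz hv i).trans (le_add_of_nonneg_left (by positivity))
  · exact (hX.norm_expansionError_le_of_ne hz hv hij).trans_eq (add_zero _).symm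

theorem sq_mul_sum_integral_pairNorm_le (hcard : Fintype.card ι * δ ^ 2 = 1) (hz : z.im ≠ 0)
    (hu : ‖u‖ ≤ 1) (hv : ‖v‖ ≤ 1) :
    δ ^ 2 * ∑ i, ∑ j, ‖u i‖ * ∫ ω, pairNorm (resolventVec (X ω) z v) i j ∂μ ≤ 2 * |z.im|⁻¹ := by
  have hint (i j : ι) := (hX.integrable_pairNorm hz hv i j).const_mul ‖u i‖
  simp only [← integral_const_mul]
  simp only [← integral_finsetSum _ fun j _ => hint _ j]
  rw [← integral_finsetSum _ fun i _ => integrable_finsetSum _ fun j _ => hint i j,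
    ← integral_const_mul]
  refine integral_le_of_forall_le (fun ω => ?_) fun ω =>
    (sq_mul_sum_norm_mul_pairNorm_le hX.scale_nonneg hcard hu _).trans <|
      mul_le_mul_of_nonneg_left (norm_resolventVec_le_inv (hX.isHermitian ω) hz hv) zero_le_two
  exact mul_nonneg (by positivity) <| Finset.sum_nonneg fun i _ => Finset.sum_nonneg fun j _ =>
    mul_nonneg (norm_nonneg _) (pairNorm_nonneg _ i j)

theorem norm_sum_mul_expansionError_le (hcard : Fintype.card ι * δ ^ 2 = 1) (hz : z.im ≠ 0)
    (hu : ‖u‖ ≤ 1) (hv : ‖v‖ ≤ 1) :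
    ‖∑ i, ∑ j, conj (u i) * expansionError μ σ τ δ X z v i j‖ ≤
      16 * L ^ 2 * δ * |z.im|⁻¹ ^ 3 + 32 * L ^ 3 * δ * |z.im|⁻¹ ^ 4 +
        4 * L * δ * |z.im|⁻¹ ^ 2 := by
  have hδ := hX.scale_nonneg
  have hL := zero_le_one.trans hX.one_le
  have hpair := hX.sq_mul_sum_integral_pairNorm_le hcard hz hu hv
  have hsum : δ * ∑ i, ‖u i‖ ≤ 1 := (mul_sum_norm_le hcard u).trans hu
  calc ‖∑ i, ∑ j, conj (u i) * expansionError μ σ τ δ X z v i j‖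
      ≤ ∑ i, ∑ j, ‖u i‖ * (8 * L ^ 2 * δ ^ 3 * |z.im|⁻¹ ^ 2 *
          ∫ ω, pairNorm (resolventVec (X ω) z v) i j ∂μ + 32 * L ^ 3 * δ ^ 4 * |z.im|⁻¹ ^ 4 +
            if i = j then 4 * L * δ ^ 2 * |z.im|⁻¹ ^ 2 else 0) :=
        norm_sum_le_of_le _ fun i _ => norm_sum_le_of_le _ fun j _ => by
          rw [norm_mul, RCLike.norm_conj]
          exact mul_le_mul_of_nonneg_left (hX.norm_expansionError_le hz hv i j) (norm_nonneg _)
    _ = 8 * L ^ 2 * δ * |z.im|⁻¹ ^ 2 * (δ ^ 2 *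
          ∑ i, ∑ j, ‖u i‖ * ∫ ω, pairNorm (resolventVec (X ω) z v) i j ∂μ) +
        (32 * L ^ 3 * δ * |z.im|⁻¹ ^ 4 * (Fintype.card ι * δ ^ 2) +
          4 * L * δ * |z.im|⁻¹ ^ 2) * (δ * ∑ i, ‖u i‖) := by
        simp only [mul_add, Finset.sum_add_distrib, mul_ite, mul_zero, Finset.sum_ite_eq,
          Finset.mem_univ, if_true, Finset.sum_const, Finset.card_univ, nsmul_eq_mul,
          mul_left_comm ‖u _‖, ← Finset.mul_sum, ← Finset.sum_mul]
        ring
    _ ≤ 8 * L ^ 2 * δ * |z.im|⁻¹ ^ 2 * (2 * |z.im|⁻¹) +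
        (32 * L ^ 3 * δ * |z.im|⁻¹ ^ 4 * (Fintype.card ι * δ ^ 2) +
          4 * L * δ * |z.im|⁻¹ ^ 2) * 1 := by
        gcongr
    _ = _ := by rw [hcard]; ring

theorem sum_mul_expansionError (hz : z.im ≠ 0) (u : EuclideanSpace ℂ ι) (hv : ‖v‖ ≤ 1) :
    ∑ i, ∑ j, conj (u i) * expansionError μ σ τ δ X z v i j =
      ∫ ω, ∑ i, ∑ j, conj (u i) * (X ω i j * resolventVec (X ω) z v j) ∂μ -
        (τ * δ ^ 2 * ∫ ω, ∑ i, ∑ j, conj (u i) *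
            (resolventEntry (X ω) z j i * resolventVec (X ω) z v j) ∂μ +
          σ ^ 2 * δ ^ 2 * ∫ ω, ∑ i, ∑ j, conj (u i) *
            (resolventEntry (X ω) z j j * resolventVec (X ω) z v i) ∂μ) := by
  have hGb := hX.integrable_resolventEntry_mul hz hv
  rw [← sum_mul_integral _ fun i j => hX.integrable_mul
      (hX.stronglyMeasurable_resolventVec hz v j).aestronglyMeasurable
      fun ω => norm_resolventVec_apply_le (hX.isHermitian ω) hz hv j,
    ← sum_mul_integral _ fun i j => hGb j i j, ← sum_mul_integral _ fun i j => hGb j j i]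
  simp only [expansionError, mul_sub, mul_add, Finset.sum_sub_distrib, Finset.sum_add_distrib,
    Finset.mul_sum, mul_left_comm (conj _)]

theorem mul_integral_inner_resolventVec (hcard : Fintype.card ι * δ ^ 2 = 1) (hz : z.im ≠ 0)
    (u : EuclideanSpace ℂ ι) (hv : ‖v‖ ≤ 1) :
    z * ∫ ω, ⟪u, resolventVec (X ω) z v⟫_ℂ ∂μ = ⟪u, v⟫_ℂ +
      σ ^ 2 * ∫ ω, resolventTrace (X ω) z * ⟪u, resolventVec (X ω) z v⟫_ℂ ∂μ +
      (τ * δ ^ 2 * ∫ ω, ∑ i, ∑ j, conj (u i) *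
          (resolventEntry (X ω) z j i * resolventVec (X ω) z v j) ∂μ +
        ∑ i, ∑ j, conj (u i) * expansionError μ σ τ δ X z v i j) := by
  have hint : Integrable
      (fun ω => ∑ i, ∑ j, conj (u i) * (X ω i j * resolventVec (X ω) z v j)) μ :=
    integrable_finsetSum _ fun i _ => integrable_finsetSum _ fun j _ => (hX.integrable_mul
      (hX.stronglyMeasurable_resolventVec hz v j).aestronglyMeasurable
      fun ω => norm_resolventVec_apply_le (hX.isHermitian ω) hz hv j).const_mul _
  have hF : z * ∫ ω, ⟪u, resolventVec (X ω) z v⟫_ℂ ∂μ = ⟪u, v⟫_ℂ +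
      ∫ ω, ∑ i, ∑ j, conj (u i) * (X ω i j * resolventVec (X ω) z v j) ∂μ := by
    simp only [← integral_const_mul, mul_inner_resolventVec (hX.isHermitian _) hz]
    rw [integral_add (integrable_const _) hint, integral_const, probReal_univ, one_smul]
  simp only [resolventTrace_mul_inner hcard, integral_const_mul]
  linear_combination hF - hX.sum_mul_expansionError hz u hv

theorem norm_mul_integral_inner_resolventVec_sub_le (hcard : Fintype.card ι * δ ^ 2 = 1)
    (hz : z.im ≠ 0) (hu : ‖u‖ ≤ 1) (hv : ‖v‖ ≤ 1) :
    ‖z * ∫ ω, ⟪u, resolventVec (X ω) z v⟫_ℂ ∂μ -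
      σ ^ 2 * ∫ ω, resolventTrace (X ω) z * ⟪u, resolventVec (X ω) z v⟫_ℂ ∂μ - ⟪u, v⟫_ℂ‖ ≤
      40 * L ^ 3 * δ * (|z.im|⁻¹ ^ 2 + |z.im|⁻¹ ^ 4) := by
  have hδ := hX.scale_nonneg
  have hL := hX.one_le
  have htranspose : ‖(τ : ℂ) * δ ^ 2 * ∫ ω, ∑ i, ∑ j, conj (u i) *
      (resolventEntry (X ω) z j i * resolventVec (X ω) z v j) ∂μ‖ ≤ L * δ * |z.im|⁻¹ ^ 2 := by
    have hint := norm_integral_le_of_norm_le_const (μ := μ) <| ae_of_all μ fun ω =>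
      norm_sum_mul_resolventEntry_transpose_le (hX.isHermitian ω) hz u hv
    rw [probReal_univ, mul_one] at hint
    calc _ = |τ| * δ ^ 2 * ‖∫ ω, ∑ i, ∑ j, conj (u i) *
          (resolventEntry (X ω) z j i * resolventVec (X ω) z v j) ∂μ‖ := by simp
      _ ≤ L * δ ^ 2 * ((∑ i, ‖u i‖) * |z.im|⁻¹ ^ 2) := by
          gcongr
          exact hX.abs_le
      _ = L * δ * |z.im|⁻¹ ^ 2 * (δ * ∑ i, ‖u i‖) := by ring
      _ ≤ L * δ * |z.im|⁻¹ ^ 2 * 1 := by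
          gcongr
          exact (mul_sum_norm_le hcard u).trans hu
      _ = _ := mul_one _
  rw [hX.mul_integral_inner_resolventVec hcard hz u hv]
  have hsum := norm_add_le_of_le htranspose
    (hX.norm_sum_mul_expansionError_le hcard hz hu hv)
  have hL1 : L ≤ L ^ 3 := le_self_pow₀ hL (by norm_num)
  have hL2 : L ^ 2 ≤ L ^ 3 := pow_le_pow_right₀ hL (by norm_num)
  have hy : 2 * |z.im|⁻¹ ^ 3 ≤ |z.im|⁻¹ ^ 2 + |z.im|⁻¹ ^ 4 := by
    linear_combination |z.im|⁻¹ ^ 2 * sq_nonneg (1 - |z.im|⁻¹)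
  rw [show ∀ a b c d : ℂ, a + b + (c + d) - b - a = c + d by intros; ring]
  calc _ ≤ 5 * L * δ * |z.im|⁻¹ ^ 2 + 8 * L ^ 2 * δ * (2 * |z.im|⁻¹ ^ 3) +
        32 * L ^ 3 * δ * |z.im|⁻¹ ^ 4 := hsum.trans_eq (by ring)
    _ ≤ 5 * L ^ 3 * δ * |z.im|⁻¹ ^ 2 + 8 * L ^ 3 * δ * (|z.im|⁻¹ ^ 2 + |z.im|⁻¹ ^ 4) +
        32 * L ^ 3 * δ * |z.im|⁻¹ ^ 4 := by gcongr
    _ ≤ _ := by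
        have : 0 ≤ L ^ 3 * δ * |z.im|⁻¹ ^ 2 := by positivity
        linear_combination 27 * this

end IsWignerModel

end Model

end MeanExpansion

/-! ### Stability of the semicircle equation -/

section Stability

theorem abs_im_le_norm_sub {z w : ℂ} (h : z.im * w.im ≤ 0) : |z.im| ≤ ‖z - w‖ := by
  refine le_trans (sq_le_sq.1 ?_) (Complex.abs_im_le_norm (z - w))
  rw [Complex.sub_im]
  nlinarith [sq_nonneg w.im]

theorem norm_le_inv_abs_im_mul {z w : ℂ} (hz : z.im ≠ 0) (h : z.im * w.im ≤ 0) (f : ℂ) :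
    ‖f‖ ≤ |z.im|⁻¹ * ‖(z - w) * f‖ := by
  rw [← div_eq_inv_mul, le_div_iff₀' (abs_pos.2 hz), norm_mul]
  exact mul_le_mul_of_nonneg_right (abs_im_le_norm_sub h) (norm_nonneg f)

theorem norm_sub_mul_le_of_selfConsistent {c ε : ℝ} {z g m f p : ℂ} (hz : z.im ≠ 0) (hc : 0 ≤ c)
    (hg : (z - c * g) * g = 1) (hg_im : z.im * g.im ≤ 0) (hm_im : z.im * m.im ≤ 0)
    (hm : ‖(z - c * m) * m - 1‖ ≤ ε) (hf : ‖(z - c * m) * f - p‖ ≤ ε) (hp : ‖p‖ ≤ 1) :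
    ‖f - g * p‖ ≤ ε * (|z.im|⁻¹ + c * |z.im|⁻¹ ^ 3) := by
  have him {w : ℂ} (hw : z.im * w.im ≤ 0) : z.im * (c * w).im ≤ 0 := by
    rw [Complex.im_ofReal_mul]
    linear_combination c * hw
  have hg_le : ‖g‖ ≤ |z.im|⁻¹ := by
    simpa [hg] using norm_le_inv_abs_im_mul hz (him hg_im) g
  have hmg : ‖m - g‖ ≤ |z.im|⁻¹ * ε := by
    have hmg_im : z.im * (m + g).im ≤ 0 := by
      rw [Complex.add_im]
      linear_combination hm_im + hg_im
    refine (norm_le_inv_abs_im_mul hz (him hmg_im) (m - g)).trans ?_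
    rw [show (z - c * (m + g)) * (m - g) = (z - c * m) * m - 1 by linear_combination -hg]
    gcongr
  refine (norm_le_inv_abs_im_mul hz (him hm_im) (f - g * p)).trans ?_
  calc |z.im|⁻¹ * ‖(z - c * m) * (f - g * p)‖
      = |z.im|⁻¹ * ‖((z - c * m) * f - p) + c * (m - g) * g * p‖ := by
        congr 2
        linear_combination -p * hg
    _ ≤ |z.im|⁻¹ * (ε + c * (|z.im|⁻¹ * ε) * |z.im|⁻¹ * 1) := by
        refine mul_le_mul_of_nonneg_left (norm_add_le_of_le hf ?_) (by positivity)
        rw [norm_mul, norm_mul, norm_mul, Complex.norm_real, Real.norm_of_nonneg hc]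
        have hε : 0 ≤ ε := (norm_nonneg _).trans hm
        gcongr
    _ = _ := by ring

theorem norm_semicircleStieltjes_le {σ : ℝ} (hσ : 0 < σ) {z : ℂ} (hz : z.im ≠ 0) :
    ‖semicircleStieltjes σ z‖ ≤ |z.im|⁻¹ := by
  have him : z.im * ((σ : ℂ) ^ 2 * semicircleStieltjes σ z).im ≤ 0 := by
    rw [← Complex.ofReal_pow, Complex.im_ofReal_mul]
    linear_combination σ ^ 2 * im_mul_im_semicircleStieltjes_nonpos hσ hz
  simpa [sub_mul_semicircleStieltjes_mul_self hσ hz] using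
    norm_le_inv_abs_im_mul hz him (semicircleStieltjes σ z)

end Stability

section Covariance

variable {Ω : Type*} [MeasurableSpace Ω] {μ : Measure Ω}

theorem im_mul_im_integral_nonpos {z : ℂ} {f : Ω → ℂ} (hf : Integrable f μ)
    (h : ∀ ω, z.im * (f ω).im ≤ 0) : z.im * (∫ ω, f ω ∂μ).im ≤ 0 := by
  have him : (∫ ω, f ω ∂μ).im = ∫ ω, (f ω).im ∂μ := (integral_im hf).symm
  rw [him, ← integral_const_mul]
  exact integral_nonpos h

theorem integral_sub_mul_sub [IsProbabilityMeasure μ] {f g : Ω → ℂ} (hf : MemLp f 2 μ)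
    (hg : MemLp g 2 μ) :
    ∫ ω, (f ω - ∫ ω', f ω' ∂μ) * (g ω - ∫ ω', g ω' ∂μ) ∂μ =
      ∫ ω, f ω * g ω ∂μ - (∫ ω, f ω ∂μ) * ∫ ω, g ω ∂μ := by
  generalize ha : ∫ ω, f ω ∂μ = a
  generalize hb : ∫ ω, g ω ∂μ = b
  have hfi : Integrable f μ := hf.integrable one_le_two
  have hgi : Integrable g μ := hg.integrable one_le_two
  have hfg : Integrable (fun ω => f ω * g ω) μ := hf.integrable_mul hg
  calc ∫ ω, (f ω - a) * (g ω - b) ∂μ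
      = ∫ ω, (f ω * g ω - (f ω * b + a * (g ω - b))) ∂μ :=
        integral_congr_ae (ae_of_all μ fun ω => by ring)
    _ = ∫ ω, f ω * g ω ∂μ - (a * b + a * (b - b)) := by
        have hgb : Integrable (fun ω => a * (g ω - b)) μ :=
          (hgi.sub (integrable_const b)).const_mul a
        have hfb : Integrable (fun ω => f ω * b) μ := hfi.mul_const b
        rw [integral_sub hfg (hfb.fun_add hgb), integral_add hfb hgb, integral_mul_const,
          integral_const_mul, integral_sub hgi (integrable_const b), ha, hb]
        simp
    _ = ∫ ω, f ω * g ω ∂μ - a * b := by ring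

theorem norm_integral_mul_sub_le [IsProbabilityMeasure μ] {f g : Ω → ℂ} (hf : MemLp f 2 μ)
    (hg : MemLp g 2 μ) {V : ℝ} (hfV : complexVariance μ f ≤ V) (hgV : complexVariance μ g ≤ V) :
    ‖∫ ω, f ω * g ω ∂μ - (∫ ω, f ω ∂μ) * ∫ ω, g ω ∂μ‖ ≤ V := by
  rw [← integral_sub_mul_sub hf hg]
  unfold complexVariance at hfV hgV
  generalize ∫ ω, f ω ∂μ = a at *
  generalize ∫ ω, g ω ∂μ = b at *
  have hf_sq : Integrable (fun ω => ‖f ω - a‖ ^ 2) μ :=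
    (hf.sub (memLp_const a)).integrable_norm_pow two_ne_zero
  have hg_sq : Integrable (fun ω => ‖g ω - b‖ ^ 2) μ :=
    (hg.sub (memLp_const b)).integrable_norm_pow two_ne_zero
  calc ‖∫ ω, (f ω - a) * (g ω - b) ∂μ‖
      ≤ ∫ ω, 1 / 2 * (‖f ω - a‖ ^ 2 + ‖g ω - b‖ ^ 2) ∂μ := by
        refine norm_integral_le_of_norm_le ((hf_sq.fun_add hg_sq).const_mul _)
          (ae_of_all μ fun ω => ?_)
        rw [norm_mul]
        linear_combination 1 / 2 * two_mul_le_add_sq ‖f ω - a‖ ‖g ω - b‖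
    _ = 1 / 2 * (∫ ω, ‖f ω - a‖ ^ 2 ∂μ + ∫ ω, ‖g ω - b‖ ^ 2 ∂μ) := by
        rw [integral_const_mul, integral_add hf_sq hg_sq]
    _ ≤ V := by linear_combination 1 / 2 * hfV + 1 / 2 * hgV

end Covariance

section SelfConsistent

open scoped InnerProductSpace

theorem norm_inv_card_mul_sum_le {ι : Type*} [Fintype ι] {a : ι → ℂ} {c : ℝ} (hc : 0 ≤ c)
    (ha : ∀ i, ‖a i‖ ≤ c) : ‖(Fintype.card ι : ℂ)⁻¹ * ∑ i, a i‖ ≤ c := by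
  rw [norm_mul, norm_inv, Complex.norm_natCast]
  calc (Fintype.card ι : ℝ)⁻¹ * ‖∑ i, a i‖ ≤ (Fintype.card ι : ℝ)⁻¹ * (Fintype.card ι * c) := by
        gcongr
        simpa using norm_sum_le_of_le Finset.univ fun i _ => ha i
    _ ≤ c := by
        rw [← mul_assoc]
        exact mul_le_of_le_one_left hc inv_mul_le_one

theorem le_one_of_natCast_mul_sq_eq_one {n : ℕ} {δ : ℝ} (h : n * δ ^ 2 = 1) : δ ≤ 1 := by
  have hn : (1 : ℝ) ≤ n := by
    refine Nat.one_le_cast.2 (Nat.one_le_iff_ne_zero.2 ?_)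
    rintro rfl
    simp at h
  have hδ : δ ^ 2 ≤ 1 := h ▸ le_mul_of_one_le_left (sq_nonneg δ) hn
  exact (le_abs_self δ).trans ((sq_le_one_iff_abs_le_one δ).1 hδ)

variable {Ω ι : Type*} [MeasurableSpace Ω] {μ : Measure Ω} {σ τ L δ : ℝ} {X : Ω → Matrix ι ι ℂ}
  [Fintype ι] [DecidableEq ι] {z : ℂ} {u v : EuclideanSpace ℂ ι}

theorem resolventEntry_self (X : Matrix ι ι ℂ) (z : ℂ) (k : ι) : resolventEntry X z k k =
    ⟪EuclideanSpace.single k 1, resolventVec X z (EuclideanSpace.single k 1)⟫_ℂ := by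
  simp [resolventEntry, EuclideanSpace.inner_single_left]

theorem im_mul_im_resolventTrace_nonpos {X : Matrix ι ι ℂ} (hX : X.IsHermitian) (hz : z.im ≠ 0) :
    z.im * (resolventTrace X z).im ≤ 0 := by
  rw [resolventTrace, ← Complex.ofReal_natCast, ← Complex.ofReal_inv, Complex.im_ofReal_mul,
    Complex.im_sum, mul_left_comm, Finset.mul_sum]
  refine mul_nonpos_of_nonneg_of_nonpos (by positivity) (Finset.sum_nonpos fun k _ => ?_)
  rw [resolventEntry_self]
  exact im_mul_im_inner_resolventVec_nonpos hX hz _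

namespace IsWignerModel

variable [IsProbabilityMeasure μ] (hX : IsWignerModel μ σ τ L δ X)
include hX

theorem memLp_resolventEntry_self (hz : z.im ≠ 0) (k : ι) (p : ENNReal) :
    MemLp (fun ω => resolventEntry (X ω) z k k) p μ := by
  simp only [resolventEntry_self]
  exact hX.memLp_inner_resolventVec hz _ _ p

theorem integrable_resolventEntry_self (hz : z.im ≠ 0) (k : ι) :
    Integrable (fun ω => resolventEntry (X ω) z k k) μ :=
  memLp_one_iff_integrable.1 (hX.memLp_resolventEntry_self hz k 1)

theorem integral_resolventTrace (hz : z.im ≠ 0) : ∫ ω, resolventTrace (X ω) z ∂μ =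
    (Fintype.card ι : ℂ)⁻¹ * ∑ k, ∫ ω, resolventEntry (X ω) z k k ∂μ := by
  simp only [resolventTrace, integral_const_mul]
  rw [integral_finsetSum _ fun k _ => hX.integrable_resolventEntry_self hz k]

theorem im_mul_im_integral_resolventTrace_nonpos (hz : z.im ≠ 0) :
    z.im * (∫ ω, resolventTrace (X ω) z ∂μ).im ≤ 0 :=
  im_mul_im_integral_nonpos
    ((integrable_finsetSum _ fun k _ => hX.integrable_resolventEntry_self hz k).const_mul _)
    fun ω => im_mul_im_resolventTrace_nonpos (hX.isHermitian ω) hz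

theorem norm_integral_resolventTrace_mul_sub_le (hcard : Fintype.card ι * δ ^ 2 = 1)
    (hz : z.im ≠ 0) (hu : ‖u‖ ≤ 1) (hv : ‖v‖ ≤ 1) :
    ‖∫ ω, resolventTrace (X ω) z * ⟪u, resolventVec (X ω) z v⟫_ℂ ∂μ -
      (∫ ω, resolventTrace (X ω) z ∂μ) * ∫ ω, ⟪u, resolventVec (X ω) z v⟫_ℂ ∂μ‖ ≤
      2560 * L ^ 3 * δ ^ 2 * (|z.im|⁻¹ ^ 4 + |z.im|⁻¹ ^ 6 + |z.im|⁻¹ ^ 8) := by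
  have hL := zero_le_one.trans hX.one_le
  have hF := hX.memLp_inner_resolventVec hz u v 2
  have hG (k : ι) := hX.memLp_resolventEntry_self hz k 2
  have hGF (k : ι) :
      Integrable (fun ω => resolventEntry (X ω) z k k * ⟪u, resolventVec (X ω) z v⟫_ℂ) μ :=
    (hG k).integrable_mul hF
  have hVar (k : ι) : complexVariance μ (fun ω => resolventEntry (X ω) z k k) ≤
      2560 * L ^ 3 * δ ^ 2 * (|z.im|⁻¹ ^ 4 + |z.im|⁻¹ ^ 6 + |z.im|⁻¹ ^ 8) := by
    simp only [resolventEntry_self]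
    exact hX.complexVariance_inner_resolventVec_le hcard hz (by simp) (by simp)
  have hsum : ∫ ω, resolventTrace (X ω) z * ⟪u, resolventVec (X ω) z v⟫_ℂ ∂μ =
      (Fintype.card ι : ℂ)⁻¹ *
        ∑ k, ∫ ω, resolventEntry (X ω) z k k * ⟪u, resolventVec (X ω) z v⟫_ℂ ∂μ := by
    simp only [resolventTrace, mul_assoc, Finset.sum_mul, integral_const_mul]
    rw [integral_finsetSum _ fun k _ => hGF k]
  rw [hX.integral_resolventTrace hz, hsum, mul_assoc, ← mul_sub, Finset.sum_mul,
    ← Finset.sum_sub_distrib]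
  exact norm_inv_card_mul_sum_le (by positivity) fun k => norm_integral_mul_sub_le (hG k) hF
    (hVar k) (hX.complexVariance_inner_resolventVec_le hcard hz hu hv)

theorem norm_selfConsistent_le (hcard : Fintype.card ι * δ ^ 2 = 1) (hz : z.im ≠ 0)
    (hδ_le : δ ≤ 1) (hδz : δ * |z.im|⁻¹ ^ 4 ≤ 1) (hu : ‖u‖ ≤ 1) (hv : ‖v‖ ≤ 1) :
    ‖(z - (σ ^ 2 : ℝ) * ∫ ω, resolventTrace (X ω) z ∂μ) *
        ∫ ω, ⟪u, resolventVec (X ω) z v⟫_ℂ ∂μ - ⟪u, v⟫_ℂ‖ ≤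
      5160 * L ^ 4 * δ * (|z.im|⁻¹ ^ 2 + |z.im|⁻¹ ^ 4) := by
  have hδ := hX.scale_nonneg
  have hL := hX.one_le
  have hmean := hX.norm_mul_integral_inner_resolventVec_sub_le hcard hz hu hv
  have hcov := hX.norm_integral_resolventTrace_mul_sub_le hcard hz hu hv
  set y := |z.im|⁻¹
  set F := ∫ ω, ⟪u, resolventVec (X ω) z v⟫_ℂ ∂μ
  set m := ∫ ω, resolventTrace (X ω) z ∂μ
  set mF := ∫ ω, resolventTrace (X ω) z * ⟪u, resolventVec (X ω) z v⟫_ℂ ∂μ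
  have hδ_sq : δ ^ 2 * (y ^ 4 + y ^ 6 + y ^ 8) ≤ 2 * δ * (y ^ 2 + y ^ 4) := by
    have h₄ : δ * (δ * y ^ 4) ≤ δ * y ^ 4 := mul_le_of_le_one_left (by positivity) hδ_le
    have h₆ : δ * y ^ 4 * (δ * y ^ 2) ≤ δ * y ^ 2 := mul_le_of_le_one_left (by positivity) hδz
    have h₈ : δ * y ^ 4 * (δ * y ^ 4) ≤ δ * y ^ 4 := mul_le_of_le_one_left (by positivity) hδz
    linear_combination h₄ + h₆ + h₈ + δ * sq_nonneg y
  calc ‖(z - (σ ^ 2 : ℝ) * m) * F - ⟪u, v⟫_ℂ‖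
      = ‖(z * F - (σ : ℂ) ^ 2 * mF - ⟪u, v⟫_ℂ) + (σ : ℂ) ^ 2 * (mF - m * F)‖ := by
        congr 1
        push_cast
        ring
    _ ≤ 40 * L ^ 3 * δ * (y ^ 2 + y ^ 4) +
          L * (2560 * L ^ 3 * (δ ^ 2 * (y ^ 4 + y ^ 6 + y ^ 8))) := by
        refine norm_add_le_of_le hmean ?_
        rw [norm_mul, norm_pow, Complex.norm_real, Real.norm_eq_abs, sq_abs]
        exact mul_le_mul hX.sq_le (hcov.trans_eq (by ring)) (norm_nonneg _) (by positivity)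
    _ ≤ 40 * L ^ 4 * δ * (y ^ 2 + y ^ 4) + L * (2560 * L ^ 3 * (2 * δ * (y ^ 2 + y ^ 4))) := by
        gcongr
        norm_num
    _ = 5160 * L ^ 4 * δ * (y ^ 2 + y ^ 4) := by ring

theorem norm_selfConsistent_trace_le (hcard : Fintype.card ι * δ ^ 2 = 1) (hz : z.im ≠ 0)
    (hδ_le : δ ≤ 1) (hδz : δ * |z.im|⁻¹ ^ 4 ≤ 1) :
    ‖(z - (σ ^ 2 : ℝ) * ∫ ω, resolventTrace (X ω) z ∂μ) * ∫ ω, resolventTrace (X ω) z ∂μ - 1‖ ≤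
      5160 * L ^ 4 * δ * (|z.im|⁻¹ ^ 2 + |z.im|⁻¹ ^ 4) := by
  have hδ := hX.scale_nonneg
  have hne : (Fintype.card ι : ℂ) ≠ 0 := by
    rintro h
    simp [Nat.cast_eq_zero.1 h] at hcard
  set m := ∫ ω, resolventTrace (X ω) z ∂μ with hm
  have havg : (z - (σ ^ 2 : ℝ) * m) * m - 1 = (Fintype.card ι : ℂ)⁻¹ *
      ∑ k, ((z - (σ ^ 2 : ℝ) * m) * ∫ ω, resolventEntry (X ω) z k k ∂μ - 1) := by
    rw [Finset.sum_sub_distrib, ← Finset.mul_sum, mul_sub, mul_left_comm,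
      ← hX.integral_resolventTrace hz, ← hm]
    simp [hne]
  rw [havg]
  refine norm_inv_card_mul_sum_le (by positivity) fun k => ?_
  simpa [← resolventEntry_self] using hX.norm_selfConsistent_le hcard hz hδ_le hδz
    (u := EuclideanSpace.single k 1) (v := EuclideanSpace.single k 1) (by simp) (by simp)

theorem norm_integral_inner_resolventVec_sub_le_two_mul (hσ : 0 < σ) (hz : z.im ≠ 0)
    (hu : ‖u‖ ≤ 1) (hv : ‖v‖ ≤ 1) :
    ‖∫ ω, ⟪u, resolventVec (X ω) z v⟫_ℂ ∂μ - semicircleStieltjes σ z * ⟪u, v⟫_ℂ‖ ≤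
      2 * |z.im|⁻¹ := by
  have hF : ‖∫ ω, ⟪u, resolventVec (X ω) z v⟫_ℂ ∂μ‖ ≤ |z.im|⁻¹ := by
    refine (norm_integral_le_of_norm_le_const (ae_of_all μ fun ω => ?_)).trans_eq
      (by rw [probReal_univ, mul_one])
    refine (norm_inner_le_norm u _).trans ?_
    simpa using mul_le_mul hu (norm_resolventVec_le_inv (hX.isHermitian ω) hz hv)
      (norm_nonneg _) zero_le_one
  have hg : ‖semicircleStieltjes σ z * ⟪u, v⟫_ℂ‖ ≤ |z.im|⁻¹ := by
    simpa using norm_mul_le_of_le (norm_semicircleStieltjes_le hσ hz)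
      ((norm_inner_le_norm u v).trans (mul_le_one₀ hu (norm_nonneg v) hv))
  exact (norm_sub_le_of_le hF hg).trans_eq (by ring)

theorem norm_integral_inner_resolventVec_sub_le (hσ : 0 < σ) (hcard : Fintype.card ι * δ ^ 2 = 1)
    (hz : z.im ≠ 0) (hu : ‖u‖ ≤ 1) (hv : ‖v‖ ≤ 1) :
    ‖∫ ω, ⟪u, resolventVec (X ω) z v⟫_ℂ ∂μ - semicircleStieltjes σ z * ⟪u, v⟫_ℂ‖ ≤
      10320 * L ^ 5 * δ * (|z.im|⁻¹ ^ 3 + |z.im|⁻¹ ^ 7) := by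
  have hδ := hX.scale_nonneg
  have hL := hX.one_le
  have hδ_le := le_one_of_natCast_mul_sq_eq_one hcard
  have hy : 0 ≤ |z.im|⁻¹ := by positivity
  rcases le_or_gt (δ * |z.im|⁻¹ ^ 4) 1 with hδz | hδz
  · have hinner : ‖⟪u, v⟫_ℂ‖ ≤ 1 :=
      (norm_inner_le_norm u v).trans (mul_le_one₀ hu (norm_nonneg v) hv)
    have hstable := norm_sub_mul_le_of_selfConsistent hz (sq_nonneg σ)
      (by rw [Complex.ofReal_pow, sub_mul_semicircleStieltjes_mul_self hσ hz])
      (im_mul_im_semicircleStieltjes_nonpos hσ hz)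
      (hX.im_mul_im_integral_resolventTrace_nonpos hz)
      (hX.norm_selfConsistent_trace_le hcard hz hδ_le hδz)
      (hX.norm_selfConsistent_le hcard hz hδ_le hδz hu hv) hinner
    generalize |z.im|⁻¹ = y at *
    have hσL : y + σ ^ 2 * y ^ 3 ≤ L * (y + y ^ 3) := by
      linear_combination y * hL + y ^ 3 * hX.sq_le
    calc _ ≤ 5160 * L ^ 4 * δ * (y ^ 2 + y ^ 4) * (y + σ ^ 2 * y ^ 3) := hstable
      _ ≤ 5160 * L ^ 4 * δ * (y ^ 2 + y ^ 4) * (L * (y + y ^ 3)) := by gcongr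
      _ ≤ _ := by
        linear_combination 5160 * L ^ 5 * δ * y ^ 3 * sq_nonneg (y ^ 2 - 1)
  · refine (hX.norm_integral_inner_resolventVec_sub_le_two_mul hσ hz hu hv).trans ?_
    generalize |z.im|⁻¹ = y at *
    have hL₅ : 1 ≤ 10320 * L ^ 5 := by linear_combination 10320 * one_le_pow₀ hL (n := 5)
    calc 2 * y ≤ δ * (y ^ 3 + y ^ 7) := by
          linear_combination 2 * y * hδz.le + δ * y ^ 3 * sq_nonneg (y ^ 2 - 1)
      _ ≤ 10320 * L ^ 5 * (δ * (y ^ 3 + y ^ 7)) := le_mul_of_one_le_left (by positivity) hL₅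
      _ = _ := by ring

end IsWignerModel

end SelfConsistent

/-! ### Entry assumptions from the two Wigner classes -/

section WignerMatrices

theorem measurable_iSup_fiber {Ω κ α : Type*} (Y : κ → Ω → ℝ) (π : κ → α) (c : κ) :
    Measurable[⨆ d ∈ π ⁻¹' {π c}, MeasurableSpace.comap (Y d) inferInstance] (Y c) :=
  measurable_iff_comap_le.2 <|
    le_iSup₂_of_le (f := fun d (_ : d ∈ π ⁻¹' {π c}) => MeasurableSpace.comap (Y d) inferInstance)
      c rfl le_rfl

theorem pow_le_one_add_pow {x : ℝ} (hx : 0 ≤ x) {k n : ℕ} (hkn : k ≤ n) : x ^ k ≤ 1 + x ^ n := by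
  rcases le_total x 1 with h | h
  · exact (pow_le_one₀ hx h).trans (le_add_of_nonneg_right (pow_nonneg hx n))
  · exact (pow_le_pow_right₀ h hkn).trans (le_add_of_nonneg_left zero_le_one)

variable {Ω : Type*} [mΩ : MeasurableSpace Ω] {μ : Measure Ω}

theorem iIndep_iSup_fiber {κ α : Type*} {m : κ → MeasurableSpace Ω} (hm : ∀ c, m c ≤ mΩ)
    (hindep : iIndep m μ) (π : κ → α) : iIndep (fun a => ⨆ c ∈ π ⁻¹' {a}, m c) μ := by
  classical
  have hμ : IsProbabilityMeasure μ := hindep.isProbabilityMeasure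
  refine (iIndep_iff _ μ).2 fun T A hA => ?_
  induction T using Finset.induction_on with
  | empty => simp
  | insert a T ha ih =>
    rw [Finset.set_biInter_insert, Finset.prod_insert ha,
      ← ih fun b hb => hA b (Finset.mem_insert_of_mem hb)]
    have hdisj : Disjoint (π ⁻¹' {a}) (π ⁻¹' T) :=
      Disjoint.preimage π (Set.disjoint_singleton_left.2 ha)
    refine (Indep_iff _ _ μ).1 (indep_iSup_of_disjoint hm hindep hdisj) _ _
      (hA a (Finset.mem_insert_self a T)) (Finset.measurableSet_biInter T fun b hb => ?_)
    have hle : ⨆ c ∈ π ⁻¹' {b}, m c ≤ ⨆ c ∈ π ⁻¹' (T : Set α), m c :=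
      biSup_mono fun c hc => Set.preimage_mono (Set.singleton_subset_iff.2 hb) hc
    exact hle _ (hA b (Finset.mem_insert_of_mem hb))

theorem iIndep_entrySigma_of_coordinates {κ ι : Type*} [LinearOrder ι] {X : Ω → Matrix ι ι ℂ}
    (hX : ∀ ω, (X ω).IsHermitian) {Y : κ → Ω → ℝ} (hY : ∀ c, Measurable (Y c))
    (hindep : iIndepFun Y μ) (π : κ → Sym2 ι)
    (hmeas : ∀ i j, i ≤ j →
      Measurable[⨆ c ∈ π ⁻¹' {s(i, j)}, MeasurableSpace.comap (Y c) inferInstance]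
        fun ω => X ω i j) : iIndep (entrySigma X) μ := by
  refine iIndep_mono (iIndep_iSup_fiber (fun c => (hY c).comap_le) hindep π) fun s =>
    entrySigma_le ?_
  rintro i j rfl
  rcases le_total i j with hij | hij
  · exact hmeas i j hij
  · simp only [← (hX _).apply i j]
    rw [Sym2.eq_swap]
    exact Complex.continuous_conj.measurable.comp (hmeas j i hij)

variable {w : Ω → ℂ}

theorem integral_norm_pow_le_one_add [IsProbabilityMeasure μ] (hw : Measurable w) {k n : ℕ}
    (hkn : k ≤ n) (hint : Integrable (fun ω => ‖w ω‖ ^ n) μ) :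
    ∫ ω, ‖w ω‖ ^ k ∂μ ≤ 1 + ∫ ω, ‖w ω‖ ^ n ∂μ := by
  calc ∫ ω, ‖w ω‖ ^ k ∂μ ≤ ∫ ω, (1 + ‖w ω‖ ^ n) ∂μ :=
        integral_mono (integrable_norm_pow_of_le hw.aestronglyMeasurable hkn hint)
          ((integrable_const 1).add hint) fun ω => pow_le_one_add_pow (norm_nonneg _) hkn
    _ = 1 + ∫ ω, ‖w ω‖ ^ n ∂μ := by
        rw [integral_add (integrable_const 1) hint, integral_const, probReal_univ, one_smul]

theorem variance_re_eq_integral_sq (hw : Integrable w μ) (hmean : ∫ ω, w ω ∂μ = 0) :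
    variance (fun ω => (w ω).re) μ = ∫ ω, (w ω).re ^ 2 ∂μ :=
  variance_of_integral_eq_zero hw.re.aemeasurable <|
    (integral_re hw).trans (by rw [hmean, map_zero])

theorem variance_im_eq_integral_sq (hw : Integrable w μ) (hmean : ∫ ω, w ω ∂μ = 0) :
    variance (fun ω => (w ω).im) μ = ∫ ω, (w ω).im ^ 2 ∂μ :=
  variance_of_integral_eq_zero hw.im.aemeasurable <|
    (integral_im hw).trans (by rw [hmean, map_zero])

variable [IsProbabilityMeasure μ]

theorem integral_norm_sq_eq_variance_add (hw : MemLp w 2 μ) (hmean : ∫ ω, w ω ∂μ = 0) :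
    ∫ ω, ‖w ω‖ ^ 2 ∂μ =
      variance (fun ω => (w ω).re) μ + variance (fun ω => (w ω).im) μ := by
  have hre : Integrable (fun ω => (w ω).re ^ 2) μ := hw.re.integrable_sq
  have him : Integrable (fun ω => (w ω).im ^ 2) μ := hw.im.integrable_sq
  rw [variance_re_eq_integral_sq (hw.integrable one_le_two) hmean,
    variance_im_eq_integral_sq (hw.integrable one_le_two) hmean, ← integral_add hre him]
  simp only [Complex.sq_norm, Complex.normSq_apply, ← sq]

theorem integral_sq_eq_variance_sub (hw : MemLp w 2 μ) (hmean : ∫ ω, w ω ∂μ = 0)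
    (hindep : IndepFun (fun ω => (w ω).re) (fun ω => (w ω).im) μ) :
    ∫ ω, w ω ^ 2 ∂μ =
      (variance (fun ω => (w ω).re) μ - variance (fun ω => (w ω).im) μ : ℝ) := by
  have hwi := hw.integrable one_le_two
  have hre : Integrable (fun ω => (w ω).re ^ 2) μ := hw.re.integrable_sq
  have him : Integrable (fun ω => (w ω).im ^ 2) μ := hw.im.integrable_sq
  have hcross : Integrable (fun ω => (w ω).re * (w ω).im) μ := hw.re.integrable_mul hw.im
  have hcross_eq : ∫ ω, (w ω).re * (w ω).im ∂μ = 0 := by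
    have hre_eq : ∫ ω, (w ω).re ∂μ = 0 := (integral_re hwi).trans (by rw [hmean, map_zero])
    rw [hindep.integral_fun_mul_eq_mul_integral hwi.re.aestronglyMeasurable
      hwi.im.aestronglyMeasurable, hre_eq, zero_mul]
  calc ∫ ω, w ω ^ 2 ∂μ = ∫ ω, ((((w ω).re ^ 2 - (w ω).im ^ 2 : ℝ) : ℂ) +
        ((2 * ((w ω).re * (w ω).im) : ℝ) : ℂ) * Complex.I) ∂μ := by
        refine integral_congr_ae (ae_of_all μ fun ω => ?_)
        dsimp only
        conv_lhs => rw [← Complex.re_add_im (w ω)]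
        push_cast
        linear_combination ((w ω).im : ℂ) ^ 2 * Complex.I_sq
    _ = _ := by
        rw [integral_add (hre.sub him).ofReal ((hcross.const_mul 2).ofReal.mul_const _),
          integral_mul_const, integral_complex_ofReal, integral_complex_ofReal,
          integral_sub hre him, integral_const_mul, hcross_eq,
          variance_re_eq_integral_sq hwi hmean, variance_im_eq_integral_sq hwi hmean]
        simp

/-- A constant `L` dominating `σ²` and the moments of order up to four off the diagonal, and up to
two on the diagonal, of the entries of a Wigner matrix. -/
noncomputable def momentBound (σ m₅ c₃ : ℝ) : ℝ := 1 + |m₅| + |c₃| + σ ^ 2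

theorem isWignerModel_of_moments {ι : Type*} {σ τ m₅ c₃ : ℝ} {X : Ω → Matrix ι ι ℂ}
    (hmeas : ∀ i j, Measurable fun ω => X ω i j) (hherm : ∀ ω, (X ω).IsHermitian)
    (hindep : iIndep (entrySigma X) μ) (hτ : |τ| ≤ σ ^ 2)
    (hmean_off : ∀ i j, i ≠ j → ∫ ω, X ω i j ∂μ = 0) (hmean_diag : ∀ i, ∫ ω, X ω i i ∂μ = 0)
    (hnorm_sq : ∀ i j, i ≠ j → ∫ ω, ‖X ω i j‖ ^ 2 ∂μ = σ ^ 2)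
    (hsq : ∀ i j, i ≠ j → ∫ ω, X ω i j ^ 2 ∂μ = τ)
    (hint_off : ∀ i j, i ≠ j → Integrable (fun ω => ‖X ω i j‖ ^ 5) μ)
    (hoff : ∀ i j, i ≠ j → ∫ ω, ‖X ω i j‖ ^ 5 ∂μ ≤ m₅)
    (hint_diag : ∀ i, Integrable (fun ω => ‖X ω i i‖ ^ 3) μ)
    (hdiag : ∀ i, ∫ ω, ‖X ω i i‖ ^ 3 ∂μ ≤ c₃) :
    IsWignerModel μ σ τ (momentBound σ m₅ c₃) 1 X where
  measurable_entry := hmeas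
  isHermitian := hherm
  indep := hindep
  scale_nonneg := zero_le_one
  one_le := by
    unfold momentBound
    linarith [abs_nonneg m₅, abs_nonneg c₃, sq_nonneg σ]
  sq_le := by
    unfold momentBound
    linarith [abs_nonneg m₅, abs_nonneg c₃]
  abs_le := by
    unfold momentBound
    linarith [abs_nonneg m₅, abs_nonneg c₃]
  mean i j := by
    rcases eq_or_ne i j with rfl | h
    · exact hmean_diag i
    · exact hmean_off i j h
  integral_norm_sq i j h := by rw [hnorm_sq i j h, one_pow, mul_one]
  integral_sq i j h := by rw [hsq i j h, Complex.ofReal_one, one_pow, mul_one]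
  integrable_pow i j k hk hij := by
    have hmeas_ij := (hmeas i j).aestronglyMeasurable (μ := μ)
    rcases eq_or_ne i j with rfl | h
    · exact integrable_norm_pow_of_le hmeas_ij (by grind) (hint_diag i)
    · exact integrable_norm_pow_of_le hmeas_ij (by grind) (hint_off i j h)
  moment_le i j k hk hij := by
    rw [one_pow, mul_one, momentBound]
    rcases eq_or_ne i j with rfl | h
    · have hle := integral_norm_pow_le_one_add (k := k) (hmeas i i) (by grind) (hint_diag i)
      linarith [hdiag i, abs_nonneg m₅, le_abs_self c₃, sq_nonneg σ]
    · have hle := integral_norm_pow_le_one_add (k := k) (hmeas i j) (by grind) (hint_off i j h)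
      linarith [hoff i j h, abs_nonneg c₃, le_abs_self m₅, sq_nonneg σ]

end WignerMatrices

section WignerClasses

variable {Ω : Type*} [mΩ : MeasurableSpace Ω] {μ : Measure Ω} {N : ℕ} {σ m₅ c₃ : ℝ}

theorem IsRealSymmetricWigner.iIndep_entrySigma {V : Ω → Matrix (Fin N) (Fin N) ℝ}
    (hV : IsRealSymmetricWigner μ σ m₅ c₃ V) :
    iIndep (entrySigma fun ω => (V ω).map Complex.ofReal) μ := by
  refine iIndep_entrySigma_of_coordinates (fun ω => ?_) (fun _ => hV.measurable_entry _ _) hV.indep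
    (fun p => s(p.1.1, p.1.2)) fun i j hij => ?_
  · ext i j
    simp [(hV.isSymm ω).apply]
  · exact Complex.measurable_ofReal.comp (measurable_iSup_fiber
      (fun (p : {p : Fin N × Fin N // p.1 ≤ p.2}) ω => V ω p.1.1 p.1.2)
      (fun p => s(p.1.1, p.1.2)) ⟨(i, j), hij⟩)

theorem IsRealSymmetricWigner.isWignerModel [IsProbabilityMeasure μ]
    {V : Ω → Matrix (Fin N) (Fin N) ℝ} (hV : IsRealSymmetricWigner μ σ m₅ c₃ V) :
    IsWignerModel μ σ (σ ^ 2) (momentBound σ m₅ c₃) 1 fun ω => (V ω).map Complex.ofReal := by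
  have hsq (i j : Fin N) (hij : i ≠ j) : ∫ ω, V ω i j ^ 2 ∂μ = σ ^ 2 := by
    rw [← hV.variance_offDiag i j hij, variance_of_integral_eq_zero
      (hV.measurable_entry i j).aemeasurable (hV.mean_offDiag i j hij)]
  refine isWignerModel_of_moments (m₅ := m₅) (c₃ := c₃)
    (fun i j => Complex.measurable_ofReal.comp (hV.measurable_entry i j)) (fun ω => ?_)
    hV.iIndep_entrySigma (abs_of_nonneg (sq_nonneg σ)).le
    (fun i j hij => ?_) (fun i => ?_) (fun i j hij => ?_) (fun i j hij => ?_) ?_ ?_ ?_ ?_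
  · ext i j
    simp [(hV.isSymm ω).apply]
  · simp [integral_complex_ofReal, hV.mean_offDiag i j hij]
  · simp [integral_complex_ofReal, hV.mean_diag i]
  · simpa using hsq i j hij
  · simp [← hsq i j hij, ← integral_complex_ofReal]
  · simpa using hV.integrable_offDiag
  · simpa using hV.moment_offDiag
  · simpa using hV.integrable_diag
  · simpa using hV.moment_diag

variable {W : Ω → Matrix (Fin N) (Fin N) ℂ}

theorem IsHermitianWigner.measurable_hermitianCoordinates (hW : IsHermitianWigner μ σ m₅ c₃ W) :
    ∀ c, Measurable (hermitianCoordinates W c)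
  | .inl (.inl _) => Complex.measurable_re.comp (hW.measurable_entry _ _)
  | .inl (.inr _) => Complex.measurable_im.comp (hW.measurable_entry _ _)
  | .inr _ => Complex.measurable_re.comp (hW.measurable_entry _ _)

theorem IsHermitianWigner.iIndep_entrySigma (hW : IsHermitianWigner μ σ m₅ c₃ W) :
    iIndep (entrySigma W) μ := by
  let position : ({p : Fin N × Fin N // p.1 < p.2} ⊕ {p : Fin N × Fin N // p.1 < p.2}) ⊕ Fin N →
      Sym2 (Fin N) :=
    Sum.elim (Sum.elim (fun p => s(p.1.1, p.1.2)) fun p => s(p.1.1, p.1.2)) fun i => s(i, i)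
  have hcoord := measurable_iSup_fiber (hermitianCoordinates W) position
  refine iIndep_entrySigma_of_coordinates hW.isHermitian hW.measurable_hermitianCoordinates hW.indep
    position fun i j hij => ?_
  rcases hij.lt_or_eq with hlt | rfl
  · have hre := Complex.measurable_ofReal.comp (hcoord (.inl (.inl ⟨(i, j), hlt⟩)))
    have him := Complex.measurable_ofReal.comp (hcoord (.inl (.inr ⟨(i, j), hlt⟩)))
    have hentry : (fun ω => W ω i j) = fun ω => ((W ω i j).re : ℂ) + (W ω i j).im * Complex.I :=
      funext fun ω => (Complex.re_add_im (W ω i j)).symm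
    rw [hentry]
    exact hre.add (him.mul_const Complex.I)
  · have hdiag : (fun ω => W ω i i) = fun ω => ((W ω i i).re : ℂ) :=
      funext fun ω => ((hW.isHermitian ω).coe_re_apply_self i).symm
    rw [hdiag]
    exact Complex.measurable_ofReal.comp (hcoord (.inr i))

theorem IsHermitianWigner.indepFun_re_im (hW : IsHermitianWigner μ σ m₅ c₃ W) {i j : Fin N}
    (hij : i ≠ j) : IndepFun (fun ω => (W ω i j).re) (fun ω => (W ω i j).im) μ := by
  have hindep {i j : Fin N} (hlt : i < j) :
      IndepFun (fun ω => (W ω i j).re) (fun ω => (W ω i j).im) μ :=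
    hW.indep.indepFun (i := .inl (.inl ⟨(i, j), hlt⟩)) (j := .inl (.inr ⟨(i, j), hlt⟩)) (by simp)
  rcases hij.lt_or_gt with hlt | hgt
  · exact hindep hlt
  · simp only [← (hW.isHermitian _).apply i j]
    exact (hindep hgt).comp measurable_id measurable_neg

theorem IsHermitianWigner.isWignerModel [IsProbabilityMeasure μ]
    (hW : IsHermitianWigner μ σ m₅ c₃ W) :
    IsWignerModel μ σ 0 (momentBound σ m₅ c₃) 1 W := by
  have hLp (i j : Fin N) (hij : i ≠ j) : MemLp (fun ω => W ω i j) 2 μ := by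
    have hmeas := (hW.measurable_entry i j).aestronglyMeasurable (μ := μ)
    exact (memLp_two_iff_integrable_sq_norm hmeas).2
      (integrable_norm_pow_of_le hmeas (by norm_num) (hW.integrable_offDiag i j hij))
  refine isWignerModel_of_moments hW.measurable_entry hW.isHermitian hW.iIndep_entrySigma
    (by simpa using sq_nonneg σ) hW.mean_offDiag hW.mean_diag (fun i j hij => ?_)
    (fun i j hij => ?_) hW.integrable_offDiag hW.moment_offDiag hW.integrable_diag hW.moment_diag
  · rw [integral_norm_sq_eq_variance_add (hLp i j hij) (hW.mean_offDiag i j hij),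
      hW.variance_re_offDiag i j hij, hW.variance_im_offDiag i j hij, add_halves]
  · rw [integral_sq_eq_variance_sub (hLp i j hij) (hW.mean_offDiag i j hij)
      (hW.indepFun_re_im hij), hW.variance_re_offDiag i j hij, hW.variance_im_offDiag i j hij,
      sub_self]

theorem IsWigner.exists_isWignerModel [IsProbabilityMeasure μ] (hW : IsWigner μ σ m₅ c₃ W) :
    ∃ τ, IsWignerModel μ σ τ (momentBound σ m₅ c₃) 1 W := by
  rcases hW with ⟨V, hV, h⟩ | hW
  · obtain rfl : W = fun ω => (V ω).map Complex.ofReal := funext h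
    exact ⟨_, hV.isWignerModel⟩
  · exact ⟨_, hW.isWignerModel⟩

end WignerClasses

/-! ### Bounds in terms of positive polynomials -/

section PositivePolynomial

open Polynomial in
/-- The polynomial `1 + X + ⋯ + X ^ n`, the choice made for the positive polynomials of the
theorem. -/
noncomputable def geomPolynomial (n : ℕ) : ℝ[X] := ∑ k ∈ Finset.range (n + 1), X ^ k

theorem coeff_geomPolynomial (n k : ℕ) : (geomPolynomial n).coeff k = if k ≤ n then 1 else 0 := by
  simp [geomPolynomial, Polynomial.coeff_X_pow]

theorem isPositivePolynomial_geomPolynomial (n : ℕ) :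
    IsPositivePolynomial n (geomPolynomial n) := by
  refine ⟨Polynomial.natDegree_eq_of_le_of_coeff_ne_zero ?_ ?_, fun k hk => ?_⟩
  · exact Polynomial.natDegree_le_iff_coeff_eq_zero.2 fun k hk => by
      rw [coeff_geomPolynomial, if_neg hk.not_ge]
  · simp [coeff_geomPolynomial]
  · simp [coeff_geomPolynomial, hk]

theorem sum_pow_le_eval_geomPolynomial {n : ℕ} {S : Finset ℕ} (hS : S ⊆ Finset.range (n + 1))
    {x : ℝ} (hx : 0 ≤ x) : ∑ k ∈ S, x ^ k ≤ (geomPolynomial n).eval x := by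
  simp only [geomPolynomial, Polynomial.eval_finsetSum, Polynomial.eval_pow, Polynomial.eval_X]
  exact Finset.sum_le_sum_of_subset_of_nonneg hS fun k _ _ => pow_nonneg hx k

end PositivePolynomial

section ResolventForm

variable {Ω : Type*} [MeasurableSpace Ω] {μ : Measure Ω} [IsProbabilityMeasure μ] {N : ℕ}
  {σ m₅ c₃ : ℝ} {W : Ω → Matrix (Fin N) (Fin N) ℂ} {u v : EuclideanSpace ℂ (Fin N)} {z : ℂ}

theorem momentBound_nonneg (σ m₅ c₃ : ℝ) : 0 ≤ momentBound σ m₅ c₃ := by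
  unfold momentBound
  positivity

theorem resolventForm_eq_inner_resolventVec {W : Matrix (Fin N) (Fin N) ℂ}
    (hW : (((1 / √N : ℝ) : ℂ) • W).IsHermitian) (hz : z.im ≠ 0)
    (u v : EuclideanSpace ℂ (Fin N)) :
    resolventForm W u v z = inner ℂ u (resolventVec (((1 / √N : ℝ) : ℂ) • W) z v) := by
  rw [resolventVec_eq_toEuclideanCLM_inv hW hz]
  rfl

theorem neZero_of_norm_eq_one {v : EuclideanSpace ℂ (Fin N)} (hv : ‖v‖ = 1) : NeZero N := by
  refine ⟨?_⟩
  rintro rfl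
  simp [Subsingleton.elim v 0] at hv

theorem card_mul_inv_sqrt_sq (hN : N ≠ 0) : Fintype.card (Fin N) * (1 / √N) ^ 2 = 1 := by
  rw [Fintype.card_fin, div_pow, Real.sq_sqrt N.cast_nonneg, one_pow]
  exact mul_one_div_cancel (Nat.cast_ne_zero.2 hN)

namespace IsWigner

theorem exists_isWignerModel_smul (hW : IsWigner μ σ m₅ c₃ W) :
    ∃ τ, IsWignerModel μ σ τ (momentBound σ m₅ c₃) (1 / √N)
      fun ω => ((1 / √N : ℝ) : ℂ) • W ω := by
  obtain ⟨τ, hModel⟩ := hW.exists_isWignerModel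
  exact ⟨τ, by simpa using hModel.smul (c := 1 / √N) (by positivity)⟩

theorem memLp_resolventForm (hW : IsWigner μ σ m₅ c₃ W) (hz : z.im ≠ 0)
    (u v : EuclideanSpace ℂ (Fin N)) (p : ENNReal) :
    MemLp (fun ω => resolventForm (W ω) u v z) p μ := by
  obtain ⟨τ, hX⟩ := hW.exists_isWignerModel_smul
  simp only [resolventForm_eq_inner_resolventVec (hX.isHermitian _) hz]
  exact hX.memLp_inner_resolventVec hz u v p

theorem integrable_resolventForm (hW : IsWigner μ σ m₅ c₃ W) (hz : z.im ≠ 0)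
    (u v : EuclideanSpace ℂ (Fin N)) : Integrable (fun ω => resolventForm (W ω) u v z) μ :=
  memLp_one_iff_integrable.1 (hW.memLp_resolventForm hz u v 1)

theorem norm_integral_resolventForm_sub_le (hσ : 0 < σ) (hW : IsWigner μ σ m₅ c₃ W)
    (hu : ‖u‖ = 1) (hv : ‖v‖ = 1) (hz : z.im ≠ 0) :
    ‖∫ ω, resolventForm (W ω) u v z ∂μ - semicircleStieltjes σ z * inner ℂ u v‖ ≤
      10320 * momentBound σ m₅ c₃ ^ 5 * (1 / √N) * (|z.im|⁻¹ ^ 3 + |z.im|⁻¹ ^ 7) := by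
  obtain ⟨τ, hX⟩ := hW.exists_isWignerModel_smul
  simp only [resolventForm_eq_inner_resolventVec (hX.isHermitian _) hz]
  exact hX.norm_integral_inner_resolventVec_sub_le hσ
    (card_mul_inv_sqrt_sq (neZero_of_norm_eq_one hv).ne) hz hu.le hv.le

theorem norm_integral_resolventForm_sub_le_of_abs_im_le (hσ : 0 < σ) (hW : IsWigner μ σ m₅ c₃ W)
    (hu : ‖u‖ = 1) (hv : ‖v‖ = 1) (hz : z.im ≠ 0) {ρ : ℝ} (hρ : |z.im| ≤ ρ) :
    ‖∫ ω, resolventForm (W ω) u v z ∂μ - semicircleStieltjes σ z * inner ℂ u v‖ ≤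
      10320 * momentBound σ m₅ c₃ ^ 5 * (ρ ^ 4 + 1) * (1 / (|z.im| ^ 7 * √N)) := by
  have hL := momentBound_nonneg σ m₅ c₃
  have hpow : |z.im|⁻¹ ^ 3 ≤ ρ ^ 4 * |z.im|⁻¹ ^ 7 := by
    have hz' : |z.im| ≠ 0 := abs_ne_zero.2 hz
    rw [show |z.im|⁻¹ ^ 3 = |z.im| ^ 4 * |z.im|⁻¹ ^ 7 by field_simp]
    gcongr
  calc _ ≤ 10320 * momentBound σ m₅ c₃ ^ 5 * (1 / √N) * (|z.im|⁻¹ ^ 3 + |z.im|⁻¹ ^ 7) :=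
        hW.norm_integral_resolventForm_sub_le hσ hu hv hz
    _ ≤ 10320 * momentBound σ m₅ c₃ ^ 5 * (1 / √N) *
          (ρ ^ 4 * |z.im|⁻¹ ^ 7 + |z.im|⁻¹ ^ 7) := by gcongr
    _ = _ := by
        rw [one_div, one_div, mul_inv, inv_pow]
        ring

theorem norm_integral_resolventForm_sub_le_eval (hσ : 0 < σ) (hW : IsWigner μ σ m₅ c₃ W)
    (hu : ‖u‖ = 1) (hv : ‖v‖ = 1) (hz : z.im ≠ 0) :
    ‖∫ ω, resolventForm (W ω) u v z ∂μ - semicircleStieltjes σ z * inner ℂ u v‖ ≤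
      10320 * momentBound σ m₅ c₃ ^ 5 *
        ((‖z‖ + 1) * ((geomPolynomial 8).eval |z.im|⁻¹ / √N)) := by
  have hL := momentBound_nonneg σ m₅ c₃
  have hP : |z.im|⁻¹ ^ 3 + |z.im|⁻¹ ^ 7 ≤ (geomPolynomial 8).eval |z.im|⁻¹ := by
    simpa using sum_pow_le_eval_geomPolynomial (n := 8) (S := {3, 7}) (by decide)
      (inv_nonneg.2 (abs_nonneg z.im))
  have hP₀ : 0 ≤ (geomPolynomial 8).eval |z.im|⁻¹ := le_trans (by positivity) hP
  calc _ ≤ 10320 * momentBound σ m₅ c₃ ^ 5 * (1 / √N) * (|z.im|⁻¹ ^ 3 + |z.im|⁻¹ ^ 7) :=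
        hW.norm_integral_resolventForm_sub_le hσ hu hv hz
    _ ≤ 10320 * momentBound σ m₅ c₃ ^ 5 * (1 / √N) * (geomPolynomial 8).eval |z.im|⁻¹ := by gcongr
    _ = 10320 * momentBound σ m₅ c₃ ^ 5 * (1 * ((geomPolynomial 8).eval |z.im|⁻¹ / √N)) := by ring
    _ ≤ _ := by
        gcongr
        exact le_add_of_nonneg_left (norm_nonneg z)

theorem complexVariance_resolventForm_le (hW : IsWigner μ σ m₅ c₃ W) (hu : ‖u‖ = 1)
    (hv : ‖v‖ = 1) (hz : z.im ≠ 0) :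
    complexVariance μ (fun ω => resolventForm (W ω) u v z) ≤
      2560 * momentBound σ m₅ c₃ ^ 3 * ((geomPolynomial 8).eval |z.im|⁻¹ / N) := by
  have hL := momentBound_nonneg σ m₅ c₃
  have hP : |z.im|⁻¹ ^ 4 + |z.im|⁻¹ ^ 6 + |z.im|⁻¹ ^ 8 ≤ (geomPolynomial 8).eval |z.im|⁻¹ := by
    simpa [add_assoc] using sum_pow_le_eval_geomPolynomial (n := 8) (S := {4, 6, 8}) (by decide)
      (inv_nonneg.2 (abs_nonneg z.im))
  obtain ⟨τ, hX⟩ := hW.exists_isWignerModel_smul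
  simp only [resolventForm_eq_inner_resolventVec (hX.isHermitian _) hz]
  calc _ ≤ 2560 * momentBound σ m₅ c₃ ^ 3 * (1 / √N) ^ 2 *
          (|z.im|⁻¹ ^ 4 + |z.im|⁻¹ ^ 6 + |z.im|⁻¹ ^ 8) :=
        hX.complexVariance_inner_resolventVec_le
          (card_mul_inv_sqrt_sq (neZero_of_norm_eq_one hv).ne) hz hu.le hv.le
    _ ≤ 2560 * momentBound σ m₅ c₃ ^ 3 * (1 / √N) ^ 2 * (geomPolynomial 8).eval |z.im|⁻¹ := by
        gcongr
    _ = _ := by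
        rw [div_pow, Real.sq_sqrt N.cast_nonneg]
        ring

end IsWigner

end ResolventForm

end WignerResolvent

theorem proposition2p1 (σ m₅ c₃ : ℝ) (hσ : 0 < σ) :
    (∀ B : Set ℂ, Bornology.IsBounded B → (∀ z ∈ B, z.im ≠ 0) →
      ∃ C : ℝ, ∀ (N : ℕ) (Ω : Type u) [MeasurableSpace Ω] (μ : Measure Ω)
        [IsProbabilityMeasure μ] (W : Ω → Matrix (Fin N) (Fin N) ℂ),
        WignerResolvent.IsWigner μ σ m₅ c₃ W →
        ∀ u v : EuclideanSpace ℂ (Fin N), ‖u‖ = 1 → ‖v‖ = 1 → ∀ z ∈ B,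
          Integrable (fun ω => WignerResolvent.resolventForm (W ω) u v z) μ ∧
          ‖(∫ ω, WignerResolvent.resolventForm (W ω) u v z ∂μ)
              - WignerResolvent.semicircleStieltjes σ z * inner ℂ u v‖
            ≤ C * (1 / (|z.im| ^ 7 * Real.sqrt N))) ∧
    (∃ (C M : ℝ) (P₈ : Polynomial ℝ), WignerResolvent.IsPositivePolynomial 8 P₈ ∧
      ∀ (N : ℕ) (Ω : Type u) [MeasurableSpace Ω] (μ : Measure Ω)
        [IsProbabilityMeasure μ] (W : Ω → Matrix (Fin N) (Fin N) ℂ),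
        WignerResolvent.IsWigner μ σ m₅ c₃ W →
        ∀ u v : EuclideanSpace ℂ (Fin N), ‖u‖ = 1 → ‖v‖ = 1 → ∀ z : ℂ, z.im ≠ 0 →
          Integrable (fun ω => WignerResolvent.resolventForm (W ω) u v z) μ ∧
          ‖(∫ ω, WignerResolvent.resolventForm (W ω) u v z ∂μ)
              - WignerResolvent.semicircleStieltjes σ z * inner ℂ u v‖
            ≤ C * ((‖z‖ + M) * (P₈.eval (|z.im|⁻¹) / Real.sqrt N))) ∧
    (∃ (C : ℝ) (P₈ : Polynomial ℝ), WignerResolvent.IsPositivePolynomial 8 P₈ ∧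
      ∀ (N : ℕ) (Ω : Type u) [MeasurableSpace Ω] (μ : Measure Ω)
        [IsProbabilityMeasure μ] (W : Ω → Matrix (Fin N) (Fin N) ℂ),
        WignerResolvent.IsWigner μ σ m₅ c₃ W →
        ∀ u v : EuclideanSpace ℂ (Fin N), ‖u‖ = 1 → ‖v‖ = 1 → ∀ z : ℂ, z.im ≠ 0 →
          MemLp (fun ω => WignerResolvent.resolventForm (W ω) u v z) 2 μ ∧
          WignerResolvent.complexVariance μ
              (fun ω => WignerResolvent.resolventForm (W ω) u v z)
            ≤ C * (P₈.eval (|z.im|⁻¹) / N)) := by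
  open WignerResolvent in
  refine ⟨fun B hB hBim => ?_,
    ⟨10320 * momentBound σ m₅ c₃ ^ 5, 1, geomPolynomial 8, isPositivePolynomial_geomPolynomial 8,
      fun N Ω _ μ _ W hW u v hu hv z hz => ⟨hW.integrable_resolventForm hz u v,
        hW.norm_integral_resolventForm_sub_le_eval hσ hu hv hz⟩⟩,
    ⟨2560 * momentBound σ m₅ c₃ ^ 3, geomPolynomial 8, isPositivePolynomial_geomPolynomial 8,
      fun N Ω _ μ _ W hW u v hu hv z hz => ⟨hW.memLp_resolventForm hz u v 2,
        hW.complexVariance_resolventForm_le hu hv hz⟩⟩⟩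
  obtain ⟨ρ, hρ⟩ := isBounded_iff_forall_norm_le.1 hB
  exact ⟨10320 * momentBound σ m₅ c₃ ^ 5 * (ρ ^ 4 + 1), fun N Ω _ μ _ W hW u v hu hv z hzB =>
    ⟨hW.integrable_resolventForm (hBim z hzB) u v,
      hW.norm_integral_resolventForm_sub_le_of_abs_im_le hσ hu hv (hBim z hzB)
        ((Complex.abs_im_le_norm z).trans (hρ z hzB))⟩⟩
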